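/- **Setting.** Fix a horizon $T$ and consider the unconstrained linear time-varying control problem $$\min_{x_{0:T},u_{0:T-1}}\ \sum_{t=0}^{T-1}\bigl(f^x_t(x_t)+f^u_t(u_t)\bigr)+F_T(x_T)\quad\text{s.t. } x_{t+1}=A_tx_t+B_tu_t+w_t(\xi^*_t)\ (0\le t<T),\quad x_0=x(0),$$ with $x_t\in\mathbb R^n$, $u_t\in\mathbb R^m$, Euclidean norms, and true parameters $\xi^*_t\in\Xi_t$, where $\Xi_t$ is a subset of a Euclidean space whose dimension may depend on $t$. $\mathsf{OPT}$ is an optimal trajectory of this problem. Assume, with constants $\mu,\ell,\sigma,a,b,b'>0$, $L_w\ge 0$, $D_w$ and an integer $d\ge1$: * all $f^x_t,f^u_t$ ($0\le t<T$) and $F_T$ are nonnegative, $\mu$-strongly convex, $\ell$-smooth (differentiable with $\ell$-Lipschitz gradient), and vanish at $0$; * $\|A_t\|\le a$, $\|B_t\|\le b$, $\|B_t^\dagger\|\le b'$ for $0\le t<T$ ($B_t^\dagger$ the Moore–Penrose inverse), and $\{A_t,B_t\}$ is $\sigma$-uniformly controllable with controllability index $d$: with $\Phi(t_2,t_1)=A_{t_2-1}\cdots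 A_{t_1}$ for $t_2>t_1$, $\Phi(t_2,t_1)=I$ otherwise, and $M(t,p)=[\Phi(t+p,t+1)B_t,\ \Phi(t+p,t+2)B_{t+1},\ \dots,\ \Phi(t+p,t+p)B_{t+p-1}]\in\mathbb R^{n\times mp}$, $d$ is the smallest positive integer with $\sigma_{\min}(M(t,d))>0$ for all integers $0\le t\le T-d$, and $\sigma_{\min}(M(t,d))\ge\sigma$ for these $t$, where $\sigma_{\min}(M)=\min_{\|y\|=1}\|M^\top y\|$; * $\|w_t(\xi)\|\le D_w$ and $\|w_t(\xi)-w_t(\xi')\|\le L_w\|\xi-\xi'\|$ for all $0\le t<T$ and $\xi,\xi'\in\Xi_t$. For $t_1\le t_2\le T$, an initial state $z$, parameters $\xi_{t_1:t_2-1}$ and a terminal cost $F:\mathbb R^n\to\mathbb R\cup\{+\infty\}$, let $\psi_{t_1}^{t_2}(z,\xi;F)$ denote an optimal solution (of finite cost), with states $y_{t_1:t_2}$ and actions $v_{t_1:t_2-1}$, of minimizing $\sum_{t=t_1}^{t_2-1}(f^x_t(y_t)+f^u_t(v_t))+F(y_{t_2})$ subject to $y_{t+1}=A_ty_t+B_tv_t+w_t(\xi_t)$,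 $y_{t_1}=z$. Let $\mathbb I(\cdot;\zeta)$ be $0$ at $\zeta$ and $+\infty$ elsewhere. At each time $t<T$, given predictions $\xi_{s\mid t}\in\Xi_s$ ($t\le s\le\min\{t+k,T\}$), $\mathsf{MPC}_k$ ($k\ge1$) commits the first action $u_t=\psi_t^{\min\{t+k,T\}}(x_t,\xi_{\cdot\mid t};F)_{v_t}$, where $F=\mathbb I(\cdot;0)$ if $t+k<T$ and $F=F_T$ otherwise; the state then evolves under the true dynamics. Write $\rho_{t,\tau}=\|\xi_{t+\tau\mid t}-\xi^*_{t+\tau}\|$ and $P(\tau)=\sum_{t=0}^{T-\tau}\rho_{t,\tau}^2$; the prediction errors are arbitrary. **Theorem.** There are constants $H_1\ge1$ and $\lambda_1\in(0,1)$, depending only on $\mu,\ell,d,\sigma,a,b,b',L_w$, such that for every such problem: 1. (Perturbation bounds, for parameters $\xi_t,\xi_t'\in\Xi_t$.) For a fixed initial state, the first actions of $\psi_{t_1}^{t_2}(z,\xi;\mathbb I(\cdot;\zeta))$ and $\psi_{t_1}^{t_2}(z,\xi';\mathbb I(\cdot;\zeta'))$ with $t_1+d\le t_2\le T$ differ by at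 most $\sum_{t=t_1}^{t_2-1}H_1\lambda_1^{t-t_1}\|\xi_t-\xi'_t\|+H_1\lambda_1^{t_2-t_1}\|\zeta-\zeta'\|$, and those of $\psi_{t_1}^{T}(z,\xi;F_T)$ and $\psi_{t_1}^{T}(z,\xi';F_T)$ with $t_1<T$ by at most $\sum_{t=t_1}^{T-1}H_1\lambda_1^{t-t_1}\|\xi_t-\xi'_t\|$. For fixed parameters (and a fixed target $\zeta$ with $t_1+d\le t_2\le T$, respectively terminal cost $F_T$ and $t_2=T$), the solutions from $z$ and $z'$ satisfy $\|y_t-y'_t\|\le H_1\lambda_1^{t-t_1}\|z-z'\|$ for $t_1\le t\le t_2$ and $\|v_t-v'_t\|\le H_1\lambda_1^{t-t_1}\|z-z'\|$ for $t_1\le t<t_2$. 2. Let moreover $\|x(0)\|\le D_0$, and let $L_g>0$ be a Lipschitz constant in the action of the dynamics $u\mapsto A_tx+B_tu+w_t(\xi_t^*)$, $0\le t<T$. If $k\ge1$ and $$k\ \ge\ \ln\!\Bigl(\tfrac{4H_1^3L_g}{(1-\lambda_1)^2}\Bigr)\Big/\ln(1/\lambda_1),$$ then $\mathsf{OPT}$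 exists, a trajectory of $\mathsf{MPC}_k$ exists if $d\le T$, and $$\mathrm{cost}(\mathsf{MPC}_k)-\mathrm{cost}(\mathsf{OPT})\ \le\ C\Bigl(\sqrt{T\sum_{\tau=0}^{k-1}\lambda_1^\tau P(\tau)+\lambda_1^{2k}T^2}+\sum_{\tau=0}^{k-1}\lambda_1^\tau P(\tau)\Bigr),$$ where $C$ depends only on $\mu,\ell,d,\sigma,a,b,b',L_w,H_1,\lambda_1,D_w,D_0,L_g$ (not on $T$, $k$, $n$, $m$, the initial state, the true parameters or the predictions). -/

import Mathlib

open scoped BigOperators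

noncomputable section

namespace MPCRegret

/-- `ℝⁿ` with the Euclidean norm. -/
abbrev E (n : ℕ) : Type := EuclideanSpace ℝ (Fin n)

/-- The data of an unconstrained linear time-varying control problem with horizon `T`,
decomposable costs and parametrized disturbances. Only the indices `t < T` of `A`, `B`, `fx`,
`fu`, `w` and `t ≤ T` of `Ξ` matter. The parameter space `Ξ t` lies in `ℝ^(r t)`. -/
structure Problem (n m : ℕ) where
  T : ℕ
  A : ℕ → (E n →L[ℝ] E n)
  B : ℕ → (E m →L[ℝ] E n)
  fx : ℕ → E n → ℝ
  fu : ℕ → E m → ℝ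
  FT : E n → ℝ
  r : ℕ → ℕ
  Ξ : ∀ t, Set (E (r t))
  w : ∀ t, E (r t) → E n

/-- Moore–Penrose inverse, through the four Penrose equations. -/
structure IsMoorePenroseInverse {n m : ℕ} (B : E m →L[ℝ] E n) (P : E n →L[ℝ] E m) : Prop where
  left : B ∘L P ∘L B = B
  right : P ∘L B ∘L P = P
  left_symm : ContinuousLinearMap.adjoint (B ∘L P) = B ∘L P
  right_symm : ContinuousLinearMap.adjoint (P ∘L B) = P ∘L B

/-- `A (s + l - 1) ∘ ⋯ ∘ A s`. -/
def transitionAux {n : ℕ} (A : ℕ → (E n →L[ℝ] E n)) (s : ℕ) : ℕ → (E n →L[ℝ] E n)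
  | 0 => ContinuousLinearMap.id ℝ (E n)
  | l + 1 => A (s + l) ∘L transitionAux A s l

/-- Transition matrix `Φ(t₂, t₁) = A (t₂ - 1) ⋯ A t₁` if `t₂ > t₁`, and the identity otherwise. -/
def transition {n : ℕ} (A : ℕ → (E n →L[ℝ] E n)) (t₂ t₁ : ℕ) : E n →L[ℝ] E n :=
  transitionAux A t₁ (t₂ - t₁)

/-- Controllability matrix
`M(t, p) = [Φ(t+p, t+1) B_t, Φ(t+p, t+2) B_{t+1}, …, Φ(t+p, t+p) B_{t+p-1}]`,
as an operator from `(ℝᵐ)ᵖ` to `ℝⁿ`. -/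
def controllabilityMatrix {n m : ℕ} (A : ℕ → (E n →L[ℝ] E n)) (B : ℕ → (E m →L[ℝ] E n))
    (t p : ℕ) : PiLp 2 (fun _ : Fin p => E m) →L[ℝ] E n :=
  ∑ i : Fin p, transition A (t + p) (t + i + 1) ∘L B (t + i) ∘L
    PiLp.proj (𝕜 := ℝ) 2 (fun _ : Fin p => E m) i

/-- The smallest singular value of a matrix `M` with `n` rows, i.e. the `n`-th one, which is
positive exactly if `M` has full row rank: `min {‖Mᵀ y‖ : ‖y‖ = 1}`. -/
def sigmaMin {V W : Type*} [NormedAddCommGroup V] [InnerProductSpace ℝ V] [CompleteSpace V]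
    [NormedAddCommGroup W] [InnerProductSpace ℝ W] [CompleteSpace W] (M : V →L[ℝ] W) : ℝ :=
  sInf {s | ∃ y : W, ‖y‖ = 1 ∧ s = ‖ContinuousLinearMap.adjoint M y‖}

/-- `σ`-uniform controllability with controllability index `d` over the horizon `T`. -/
def IsUniformlyControllable {n m : ℕ} (A : ℕ → (E n →L[ℝ] E n)) (B : ℕ → (E m →L[ℝ] E n))
    (T d : ℕ) (σ : ℝ) : Prop :=
  IsLeast {p : ℕ | 0 < p ∧ ∀ t, t + p ≤ T → 0 < sigmaMin (controllabilityMatrix A B t p)} d ∧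
    ∀ t, t + d ≤ T → σ ≤ sigmaMin (controllabilityMatrix A B t d)

/-- Nonnegative, `μ`-strongly convex, `ℓ`-smooth (differentiable with `ℓ`-Lipschitz gradient),
with value `0` at `0`. -/
structure IsWellConditioned {n : ℕ} (μ ℓ : ℝ) (f : E n → ℝ) : Prop where
  nonneg : ∀ x, 0 ≤ f x
  strongConvex : StrongConvexOn Set.univ μ f
  differentiable : Differentiable ℝ f
  smooth : ∀ x y, ‖gradient f x - gradient f y‖ ≤ ℓ * ‖x - y‖
  zero : f 0 = 0

namespace Problem

variable {n m : ℕ}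

/-- The dynamical function `g_t(x, u; ξ) = A_t x + B_t u + w_t(ξ)`. -/
def g (S : Problem n m) (t : ℕ) (x : E n) (u : E m) (ξ : E (S.r t)) : E n :=
  S.A t x + S.B t u + S.w t ξ

/-- The standing assumptions on costs, dynamics and predicted quantities. -/
structure Assumptions (S : Problem n m) (μ ℓ : ℝ) (d : ℕ) (σ a b b' Lw Dw : ℝ) : Prop where
  fx : ∀ t < S.T, IsWellConditioned μ ℓ (S.fx t)
  fu : ∀ t < S.T, IsWellConditioned μ ℓ (S.fu t)
  FT : IsWellConditioned μ ℓ S.FT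
  controllable : IsUniformlyControllable S.A S.B S.T d σ
  norm_A : ∀ t < S.T, ‖S.A t‖ ≤ a
  norm_B : ∀ t < S.T, ‖S.B t‖ ≤ b
  norm_pinv : ∀ t < S.T, ∃ P, IsMoorePenroseInverse (S.B t) P ∧ ‖P‖ ≤ b'
  norm_w : ∀ t < S.T, ∀ ξ ∈ S.Ξ t, ‖S.w t ξ‖ ≤ Dw
  lipschitz_w : ∀ t < S.T, ∀ ξ ∈ S.Ξ t, ∀ ξ' ∈ S.Ξ t, ‖S.w t ξ - S.w t ξ'‖ ≤ Lw * ‖ξ - ξ'‖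

/-- The total cost of a trajectory of the online control problem. -/
def cost (S : Problem n m) (x : ℕ → E n) (u : ℕ → E m) : ℝ :=
  ∑ t ∈ Finset.range S.T, (S.fx t (x t) + S.fu t (u t)) + S.FT (x S.T)

/-- The objective of the finite-time optimal control problem over `[t₁, t₂]` with terminal cost
`F`, which may take the value `+∞`. -/
def ftocpObjective (S : Problem n m) (t₁ t₂ : ℕ) (F : E n → EReal) (y : ℕ → E n) (v : ℕ → E m) :
    EReal :=
  ((∑ t ∈ Finset.Ico t₁ t₂, (S.fx t (y t) + S.fu t (v t)) : ℝ) : EReal) + F (y t₂)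

/-- The constraints of the finite-time optimal control problem over `[t₁, t₂]` with initial
state `z` and parameters `ξ`. -/
def IsFTOCPTrajectory (S : Problem n m) (t₁ t₂ : ℕ) (z : E n) (ξ : ∀ t, E (S.r t))
    (y : ℕ → E n) (v : ℕ → E m) : Prop :=
  y t₁ = z ∧ ∀ t, t₁ ≤ t → t < t₂ → y (t + 1) = S.g t (y t) (v t) (ξ t)

/-- `(y, v)` is an optimal solution `ψ_{t₁}^{t₂}(z, ξ; F)` of the finite-time optimal control
problem: it is admissible, of finite cost, and minimizes the objective. Only `y t` for
`t₁ ≤ t ≤ t₂` and `v t` for `t₁ ≤ t < t₂` matter. -/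
def IsFTOCPSolution (S : Problem n m) (t₁ t₂ : ℕ) (z : E n) (ξ : ∀ t, E (S.r t))
    (F : E n → EReal) (y : ℕ → E n) (v : ℕ → E m) : Prop :=
  S.IsFTOCPTrajectory t₁ t₂ z ξ y v ∧ S.ftocpObjective t₁ t₂ F y v < ⊤ ∧
    ∀ y' v', S.IsFTOCPTrajectory t₁ t₂ z ξ y' v' →
      S.ftocpObjective t₁ t₂ F y v ≤ S.ftocpObjective t₁ t₂ F y' v'

/-- The true terminal cost, as an extended-real-valued function. -/
def terminalCost (S : Problem n m) : E n → EReal := fun y => (S.FT y : EReal)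

end Problem

open Classical in
/-- The indicator terminal cost: `0` at `ζ` and `+∞` elsewhere. -/
def indicatorCost {n : ℕ} (ζ : E n) : E n → EReal := fun y => if y = ζ then 0 else ⊤

namespace Problem

variable {n m : ℕ}

/-- The offline optimal trajectory. -/
def IsOPT (S : Problem n m) (x₀ : E n) (ξs : ∀ t, E (S.r t)) (x : ℕ → E n) (u : ℕ → E m) : Prop :=
  S.IsFTOCPSolution 0 S.T x₀ ξs S.terminalCost x u

/-- The terminal cost used by `MPC_k` at time `t`: the indicator of the state `0` if
`t + k < T`, and the true terminal cost otherwise. -/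
def mpcTerminalCost (S : Problem n m) (k t : ℕ) : E n → EReal :=
  if t + k < S.T then indicatorCost 0 else S.terminalCost

/-- `(x, u)` is the trajectory of `MPC_k` started at `x₀`, with true parameters `ξs` and
predictions `ξp t s` (the prediction of `ξs s` available at time `t`): at each time `t < T` it
commits the first action of a solution of the predicted finite-time optimal control problem over
`[t, min (t + k) T]`, and the state evolves under the true dynamics. -/
def IsMPC (S : Problem n m) (k : ℕ) (x₀ : E n) (ξs : ∀ t, E (S.r t))
    (ξp : ℕ → ∀ s, E (S.r s)) (x : ℕ → E n) (u : ℕ → E m) : Prop :=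
  x 0 = x₀ ∧ ∀ t < S.T,
    (∃ y v, S.IsFTOCPSolution t (min (t + k) S.T) (x t) (ξp t) (S.mpcTerminalCost k t) y v ∧
      u t = v t) ∧
    x (t + 1) = S.g t (x t) (u t) (ξs t)

/-- The prediction error `ρ_{t,τ} = ‖ξ_{t+τ|t} - ξ*_{t+τ}‖`. -/
def predError (S : Problem n m) (ξs : ∀ t, E (S.r t)) (ξp : ℕ → ∀ s, E (S.r s)) (t τ : ℕ) : ℝ :=
  ‖ξp t (t + τ) - ξs (t + τ)‖

/-- The power of `τ`-step-away predictions `P(τ) = ∑_{t=0}^{T-τ} ρ_{t,τ}²`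
(an empty sum if `τ > T`). -/
def predPower (S : Problem n m) (ξs : ∀ t, E (S.r t)) (ξp : ℕ → ∀ s, E (S.r s)) (τ : ℕ) : ℝ :=
  ∑ t ∈ (Finset.range (S.T + 1)).filter (fun t => t + τ ≤ S.T), S.predError ξs ξp t τ ^ 2

/-- The exponentially decaying perturbation bounds, holding globally with constants `H` and `lam`:
dependence of the first action on the parameters (including the target state, for the indicator
terminal cost), and dependence of the whole solution on the initial state. For the indicator
terminal cost the horizon is at least the controllability index `d`. -/
structure PerturbationBounds (S : Problem n m) (d : ℕ) (H lam : ℝ) : Prop where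
  parameters_indicator : ∀ t₁ t₂, t₁ + d ≤ t₂ → t₂ ≤ S.T →
    ∀ (z ζ ζ' : E n) (ξ ξ' : ∀ t, E (S.r t)),
    (∀ t, t₁ ≤ t → t < t₂ → ξ t ∈ S.Ξ t) → (∀ t, t₁ ≤ t → t < t₂ → ξ' t ∈ S.Ξ t) →
    ∀ y v y' v', S.IsFTOCPSolution t₁ t₂ z ξ (indicatorCost ζ) y v →
      S.IsFTOCPSolution t₁ t₂ z ξ' (indicatorCost ζ') y' v' →
      ‖v t₁ - v' t₁‖ ≤ ∑ t ∈ Finset.Ico t₁ t₂, H * lam ^ (t - t₁) * ‖ξ t - ξ' t‖ +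
        H * lam ^ (t₂ - t₁) * ‖ζ - ζ'‖
  parameters_terminal : ∀ t₁, t₁ < S.T →
    ∀ (z : E n) (ξ ξ' : ∀ t, E (S.r t)),
    (∀ t, t₁ ≤ t → t < S.T → ξ t ∈ S.Ξ t) → (∀ t, t₁ ≤ t → t < S.T → ξ' t ∈ S.Ξ t) →
    ∀ y v y' v', S.IsFTOCPSolution t₁ S.T z ξ S.terminalCost y v →
      S.IsFTOCPSolution t₁ S.T z ξ' S.terminalCost y' v' →
      ‖v t₁ - v' t₁‖ ≤ ∑ t ∈ Finset.Ico t₁ S.T, H * lam ^ (t - t₁) * ‖ξ t - ξ' t‖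
  initial_indicator : ∀ t₁ t₂, t₁ + d ≤ t₂ → t₂ ≤ S.T →
    ∀ (z z' ζ : E n) (ξ : ∀ t, E (S.r t)), (∀ t, t₁ ≤ t → t < t₂ → ξ t ∈ S.Ξ t) →
    ∀ y v y' v', S.IsFTOCPSolution t₁ t₂ z ξ (indicatorCost ζ) y v →
      S.IsFTOCPSolution t₁ t₂ z' ξ (indicatorCost ζ) y' v' →
      (∀ t, t₁ ≤ t → t ≤ t₂ → ‖y t - y' t‖ ≤ H * lam ^ (t - t₁) * ‖z - z'‖) ∧
      (∀ t, t₁ ≤ t → t < t₂ → ‖v t - v' t‖ ≤ H * lam ^ (t - t₁) * ‖z - z'‖)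
  initial_terminal : ∀ t₁, t₁ ≤ S.T →
    ∀ (z z' : E n) (ξ : ∀ t, E (S.r t)), (∀ t, t₁ ≤ t → t < S.T → ξ t ∈ S.Ξ t) →
    ∀ y v y' v', S.IsFTOCPSolution t₁ S.T z ξ S.terminalCost y v →
      S.IsFTOCPSolution t₁ S.T z' ξ S.terminalCost y' v' →
      (∀ t, t₁ ≤ t → t ≤ S.T → ‖y t - y' t‖ ≤ H * lam ^ (t - t₁) * ‖z - z'‖) ∧
      (∀ t, t₁ ≤ t → t < S.T → ‖v t - v' t‖ ≤ H * lam ^ (t - t₁) * ‖z - z'‖)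

end Problem

end MPCRegret

end

open scoped BigOperators

noncomputable section

namespace MPCRegret

/-! ### Well-conditioned functions -/

namespace IsWellConditioned

variable {n : ℕ} {μ ℓ : ℝ} {f : E n → ℝ}

/-! The perturbation bounds come from one weighted energy estimate. Two solutions of finite-horizon
problems satisfy first-order conditions with costates `p`, `p'`. Pairing the difference of the
costates with the difference of the states gives a storage `V t` whose decrease dominates `μ` times
the squared distance of states and actions at time `t`, up to the disturbance difference paired with
the next costate difference (`dissipation_step`). Controllability bounds the costate difference by
the distances over a window of length `d`: if the sources and the pairings with the inputs are
small, then so is the costate, because the controllability matrix is surjective with margin `σ`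
(`IsCostate.norm_le_of_controllable`). Near the end of a horizon shorter than `d` the gradient of
`F_T` supplies this bound.

Since the storage is controlled by the dissipation, the telescoping argument survives geometric
weights `ρ ^ t` with `ρ` close enough to `1`, on either side (`weighted_energy_le`). A weight `ρ >
1` forces the influence of the initial state to decay forward in time. A weight `ρ < 1` makes the
influence of late disturbances and targets on the first action decay. The rate satisfies `lam ^ 2 =
1 / (1 + gap)`, so that both weights are admissible.

For the regret, the first variation of the total cost vanishes at the optimum, so the excess cost is
at most `ℓ` times the squared distance to the optimal trajectory (`cost_sub_cost_le`). Re-optimizing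
from every state that MPC visits writes this distance as a discounted sum of per-step errors
(`reoptimized_sub_le`). A per-step error is bounded by discounted prediction errors plus `lam ^ k`
times the re-optimized state at time `t + k`, for which MPC substitutes the target `0`. That state
differs from the optimal one by a further factor `lam ^ k` times the current distance. The resulting
feedback of earlier errors is absorbed by the lookahead condition (`sum_error_sq_le`), and the
optimal states have mean-square size independent of `T`. This yields a bound linear in the
prediction power and in `lam ^ (2 * k) * T`, which is stronger than the square-root form.

The perturbation bounds with a target need a horizon of at least `d`. Including `b' / lam ^ d` in
`H₁` makes the lookahead condition imply `d ≤ k` as soon as some `B_t` is nonzero. If all of them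
vanish, both trajectories use zero actions and coincide. -/

lemma hasDerivAt_line (hf : IsWellConditioned μ ℓ f) (x v : E n) :
    HasDerivAt (fun θ : ℝ => f (x + θ • v)) (inner ℝ (gradient f x) v) 0 := by
  have h1 : HasFDerivAt f (InnerProductSpace.toDual ℝ (E n) (gradient f x)) (x + (0 : ℝ) • v) := by
    simpa using (hf.differentiable x).hasGradientAt.hasFDerivAt
  have h2 : HasDerivAt (fun θ : ℝ => x + θ • v) v 0 := by
    simpa using ((hasDerivAt_id (0 : ℝ)).smul_const v).const_add x
  exact h1.comp_hasDerivAt (0 : ℝ) h2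

/-- Strong convexity on the segment from `x` to `y` bounds the difference quotient at `x`; the bound
passes to the limit as the step tends to `0` from the right. -/
lemma gradient_ineq (hf : IsWellConditioned μ ℓ f) (x y : E n) :
    f x + inner ℝ (gradient f x) (y - x) + μ / 2 * ‖y - x‖ ^ 2 ≤ f y := by
  have h1 := (hf.hasDerivAt_line x (y - x)).tendsto_slope_zero_right
  have h2 : Filter.Tendsto (fun θ : ℝ => f y - f x - (1 - θ) * (μ / 2 * ‖y - x‖ ^ 2))
      (nhdsWithin 0 (Set.Ioi 0)) (nhds (f y - f x - (1 - 0) * (μ / 2 * ‖y - x‖ ^ 2))) := by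
    apply Filter.Tendsto.mono_left _ nhdsWithin_le_nhds
    apply Continuous.tendsto (f := fun θ : ℝ => f y - f x - (1 - θ) * (μ / 2 * ‖y - x‖ ^ 2))
    fun_prop
  have h3 := le_of_tendsto_of_tendsto h1 h2 (by
    have : Set.Ioo (0 : ℝ) 1 ∈ nhdsWithin (0 : ℝ) (Set.Ioi 0) := Ioo_mem_nhdsGT one_pos
    filter_upwards [this] with θ hθ
    have h := hf.strongConvex.2 (Set.mem_univ x) (Set.mem_univ y)
      (show 0 ≤ 1 - θ by linarith [hθ.2]) hθ.1.le (by ring)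
    have e : (1 - θ) • x + θ • y = x + θ • (y - x) := by module
    rw [e, norm_sub_rev] at h
    simp only [smul_eq_mul] at h
    simp only [zero_add, zero_smul, add_zero, smul_eq_mul]
    rw [inv_mul_le_iff₀ hθ.1]
    nlinarith)
  linarith

lemma strongly_monotone (hf : IsWellConditioned μ ℓ f) (x y : E n) :
    μ * ‖x - y‖ ^ 2 ≤ inner ℝ (gradient f x - gradient f y) (x - y) := by
  have h1 := hf.gradient_ineq x y
  have h2 := hf.gradient_ineq y x
  rw [← neg_sub x y, inner_neg_right, norm_neg] at h1
  rw [inner_sub_left]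
  linarith

lemma gradient_zero (hf : IsWellConditioned μ ℓ f) : gradient f 0 = 0 := by
  have h : IsLocalMin f 0 := Filter.Eventually.of_forall fun x => by
    simpa [hf.zero] using hf.nonneg x
  simp [gradient, h.fderiv_eq_zero]

lemma quadratic_lower (hf : IsWellConditioned μ ℓ f) (x : E n) : μ / 2 * ‖x‖ ^ 2 ≤ f x := by
  simpa [hf.gradient_zero, hf.zero] using hf.gradient_ineq 0 x

/-- The gradient inequality at `y`, with the gradient then moved back to `x` by its Lipschitz bound.
This avoids integration along the segment, at the price of `ℓ` instead of `ℓ / 2`. -/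
lemma quadratic_upper (hf : IsWellConditioned μ ℓ f) (hμ : 0 ≤ μ) (x y : E n) :
    f y - f x ≤ inner ℝ (gradient f x) (y - x) + ℓ * ‖y - x‖ ^ 2 := by
  have h1 := hf.gradient_ineq y x
  have h2 : inner ℝ (gradient f y - gradient f x) (y - x) ≤ ℓ * ‖y - x‖ * ‖y - x‖ :=
    (real_inner_le_norm _ _).trans
      (mul_le_mul_of_nonneg_right (hf.smooth y x) (norm_nonneg _))
  rw [← neg_sub y x, inner_neg_right, norm_neg] at h1
  rw [inner_sub_left] at h2
  nlinarith [mul_nonneg hμ (sq_nonneg ‖y - x‖)]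

lemma continuous (hf : IsWellConditioned μ ℓ f) : Continuous f := hf.differentiable.continuous

end IsWellConditioned

/-! ### A weighted energy estimate -/

/-- Summation by parts. The weights disturb the telescoping only through the factor `ρ - 1`, which
is what allows a small deviation from `1` to be absorbed. -/
lemma sum_pow_mul_sub_succ (ρ : ℝ) (V : ℕ → ℝ) (M : ℕ) :
    ∑ t ∈ Finset.range (M + 1), ρ ^ t * (V t - V (t + 1)) =
      V 0 - ρ ^ M * V (M + 1) + (ρ - 1) * ∑ t ∈ Finset.range M, ρ ^ t * V (t + 1) := by
  induction M with
  | zero => simp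
  | succ M ih =>
    rw [Finset.sum_range_succ, ih, Finset.sum_range_succ]
    ring

lemma pow_le_two_pow_mul_pow {ρ : ℝ} (h1 : 1 / 2 ≤ ρ) (h2 : ρ ≤ 2) {d t r : ℕ}
    (hr : r ≤ t + d) (ht : t ≤ r + d) : ρ ^ t ≤ 2 ^ d * ρ ^ r := by
  have hρ : 0 < ρ := by linarith
  rcases le_total t r with h | h
  · obtain ⟨j, rfl⟩ := Nat.exists_eq_add_of_le h
    have hj : j ≤ d := by omega
    have h3 : 1 ≤ (2 * ρ) ^ j := one_le_pow₀ (by linarith)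
    calc ρ ^ t ≤ ρ ^ t * (2 * ρ) ^ j := le_mul_of_one_le_right (by positivity) h3
      _ = 2 ^ j * ρ ^ (t + j) := by rw [mul_pow, pow_add]; ring
      _ ≤ 2 ^ d * ρ ^ (t + j) := by gcongr; norm_num
  · obtain ⟨j, rfl⟩ := Nat.exists_eq_add_of_le h
    have hj : j ≤ d := by omega
    calc ρ ^ (r + j) = ρ ^ j * ρ ^ r := by rw [pow_add]; ring
      _ ≤ 2 ^ j * ρ ^ r := by gcongr
      _ ≤ 2 ^ d * ρ ^ r := by gcongr; norm_num

/-- Summing local window bounds `L t ^ 2 ≤ K ∑ E r` against geometric weights. -/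
lemma sum_window_le {N d : ℕ} {K ρ : ℝ} {U W : ℕ → ℝ} (hK : 0 ≤ K) (hW : ∀ t, 0 ≤ W t)
    (h1 : 1 / 2 ≤ ρ) (h2 : ρ ≤ 2)
    (hU : ∀ t ≤ N, U t ≤ K * ∑ r ∈ (Finset.range N).filter (fun r => r ≤ t + d ∧ t ≤ r + d), W r) :
    ∑ t ∈ Finset.range (N + 1), ρ ^ t * U t ≤
      K * ((2 * d + 1) * 2 ^ d) * ∑ r ∈ Finset.range N, ρ ^ r * W r := by
  have hρ : 0 < ρ := by linarith
  calc ∑ t ∈ Finset.range (N + 1), ρ ^ t * U t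
      ≤ ∑ t ∈ Finset.range (N + 1), ∑ r ∈ Finset.range N,
          if r ≤ t + d ∧ t ≤ r + d then K * (2 ^ d * (ρ ^ r * W r)) else 0 := by
        apply Finset.sum_le_sum
        intro t ht
        have ht' : t ≤ N := by have := Finset.mem_range.1 ht; omega
        calc ρ ^ t * U t ≤ ρ ^ t * (K *
              ∑ r ∈ (Finset.range N).filter (fun r => r ≤ t + d ∧ t ≤ r + d), W r) := by
              gcongr; exact hU t ht'
          _ = ∑ r ∈ (Finset.range N).filter (fun r => r ≤ t + d ∧ t ≤ r + d),
              K * (ρ ^ t * W r) := by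
              rw [Finset.mul_sum, Finset.mul_sum]
              exact Finset.sum_congr rfl fun _ _ => by ring
          _ ≤ ∑ r ∈ (Finset.range N).filter (fun r => r ≤ t + d ∧ t ≤ r + d),
              K * (2 ^ d * (ρ ^ r * W r)) := by
              apply Finset.sum_le_sum
              intro r hr
              have hr' := (Finset.mem_filter.1 hr).2
              rw [← mul_assoc ((2 : ℝ) ^ d)]
              gcongr
              · exact hW r
              · exact pow_le_two_pow_mul_pow h1 h2 hr'.1 hr'.2
          _ = _ := Finset.sum_filter _ _
    _ = ∑ r ∈ Finset.range N, ∑ t ∈ Finset.range (N + 1),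
          if r ≤ t + d ∧ t ≤ r + d then K * (2 ^ d * (ρ ^ r * W r)) else 0 := Finset.sum_comm
    -- After exchanging the sums, each `r` lies in the windows of at most `2 * d + 1` times `t`.
    _ ≤ ∑ r ∈ Finset.range N, (2 * d + 1) * (K * (2 ^ d * (ρ ^ r * W r))) := by
        apply Finset.sum_le_sum
        intro r _
        have h0 : 0 ≤ K * (2 ^ d * (ρ ^ r * W r)) := by have := hW r; positivity
        rw [← Finset.sum_filter, Finset.sum_const, nsmul_eq_mul]
        gcongr
        have hsub : (Finset.range (N + 1)).filter (fun t => r ≤ t + d ∧ t ≤ r + d) ⊆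
            Finset.Icc (r - d) (r + d) := by
          intro t ht
          have := (Finset.mem_filter.1 ht).2
          simp only [Finset.mem_Icc]; omega
        have hc := Finset.card_le_card hsub
        rw [Nat.card_Icc] at hc
        have : ((Finset.range (N + 1)).filter (fun t => r ≤ t + d ∧ t ≤ r + d)).card
            ≤ 2 * d + 1 := by omega
        exact_mod_cast this
    _ = _ := by
        rw [Finset.mul_sum]
        exact Finset.sum_congr rfl fun _ _ => by ring

/-- A dissipation inequality `μ E t ≤ V t - V (t + 1) + L (t + 1) p t` whose storage `V` and
multiplier `L` are controlled by the dissipation `E` over windows of radius `d` yields bounds on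
the dissipation in all norms with sufficiently slowly varying geometric weights. -/
lemma weighted_energy_le {N d : ℕ} {μ K ρ q₀ q₁ : ℝ} {W V L p : ℕ → ℝ} (hμ : 0 < μ) (hK : 0 ≤ K)
    (hN : 1 ≤ N) (hW : ∀ t, 0 ≤ W t)
    (hstep : ∀ t < N, μ * W t ≤ V t - V (t + 1) + L (t + 1) * p t)
    (hV0 : V 0 ≤ L 0 * q₀) (hVN : -V N ≤ L N * q₁)
    (hV : ∀ t, t < N → |V t| ≤ L t ^ 2 + W t)
    (hL : ∀ t ≤ N, L t ^ 2 ≤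
      K * ∑ r ∈ (Finset.range N).filter (fun r => r ≤ t + d ∧ t ≤ r + d), W r)
    (hρ : |ρ - 1| ≤ min (1 / 2) (μ / (8 * (K * ((2 * d + 1) * 2 ^ d) + 1)))) :
    ∑ t ∈ Finset.range N, ρ ^ t * W t ≤ 20 * (K * ((2 * d + 1) * 2 ^ d) + 1) / μ ^ 2 *
      (q₀ ^ 2 + ∑ t ∈ Finset.range N, ρ ^ t * p t ^ 2 + ρ ^ N * q₁ ^ 2) := by
  have hb := abs_le.1 (hρ.trans (min_le_left _ _))
  have h1 : 1 / 2 ≤ ρ := by linarith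
  have h2 : ρ ≤ 2 := by linarith
  have hρ0 : 0 < ρ := by linarith
  set κ := K * ((2 * d + 1) * 2 ^ d) with hκ
  have hκ0 : 0 ≤ κ := by positivity
  set S := ∑ t ∈ Finset.range N, ρ ^ t * W t with hS
  have hS0 : 0 ≤ S := Finset.sum_nonneg fun t _ => by have := hW t; positivity
  have hX := sum_window_le (U := fun t => L t ^ 2) hK hW h1 h2 hL
  set X := ∑ t ∈ Finset.range (N + 1), ρ ^ t * L t ^ 2 with hXdef
  obtain ⟨M, rfl⟩ : ∃ M, N = M + 1 := ⟨N - 1, by omega⟩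
  -- The three Young inequalities below cost `ε`, `2 * ε` and `2 * ε` times `X`, and `X ≤ κ * S`;
  -- this choice keeps their total below a quarter of the dissipation `μ * S`.
  set ε := μ / (20 * (κ + 1)) with hε
  have hε0 : 0 < ε := by positivity
  have young : ∀ x y : ℝ, x * y ≤ ε * x ^ 2 + y ^ 2 / (4 * ε) := by
    intro x y
    have : ε * x ^ 2 + y ^ 2 / (4 * ε) - x * y = (2 * ε * x - y) ^ 2 / (4 * ε) := by
      field_simp; ring
    have : 0 ≤ (2 * ε * x - y) ^ 2 / (4 * ε) := by positivity
    linarith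
  have hsum : μ * S ≤ V 0 - ρ ^ M * V (M + 1) + (ρ - 1) * ∑ t ∈ Finset.range M, ρ ^ t * V (t + 1)
      + ∑ t ∈ Finset.range (M + 1), ρ ^ t * (L (t + 1) * p t) := by
    rw [← sum_pow_mul_sub_succ, ← Finset.sum_add_distrib, hS, Finset.mul_sum]
    apply Finset.sum_le_sum
    intro t ht
    have := mul_le_mul_of_nonneg_left (hstep t (Finset.mem_range.1 ht)) (pow_pos hρ0 t).le
    linarith
  -- Multipliers and storage appear at time `t + 1` under the weight of time `t`; the shift costs a
  -- factor `2` because `ρ ≥ 1 / 2`.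
  have hpow : ∀ t, ρ ^ t ≤ 2 * ρ ^ (t + 1) := by
    intro t
    rw [pow_succ]
    nlinarith [pow_pos hρ0 t]
  have hnn : ∀ t, 0 ≤ ρ ^ t * L t ^ 2 := fun t => by positivity
  have b0 : V 0 ≤ ε * X + q₀ ^ 2 / (4 * ε) := by
    have : ρ ^ 0 * L 0 ^ 2 ≤ X :=
      Finset.single_le_sum (f := fun t => ρ ^ t * L t ^ 2) (fun t _ => hnn t) (by simp)
    have h := young (L 0) q₀
    rw [pow_zero, one_mul] at this
    nlinarith
  have bN : -(ρ ^ M * V (M + 1)) ≤ 2 * ε * X + 2 * (ρ ^ (M + 1) * q₁ ^ 2 / (4 * ε)) := by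
    have hle : ρ ^ (M + 1) * L (M + 1) ^ 2 ≤ X :=
      Finset.single_le_sum (f := fun t => ρ ^ t * L t ^ 2) (fun t _ => hnn t) (by simp)
    have h := young (L (M + 1)) q₁
    have h4 : 0 ≤ ε * L (M + 1) ^ 2 + q₁ ^ 2 / (4 * ε) := by positivity
    calc -(ρ ^ M * V (M + 1)) = ρ ^ M * (-V (M + 1)) := by ring
      _ ≤ ρ ^ M * (ε * L (M + 1) ^ 2 + q₁ ^ 2 / (4 * ε)) := by
        gcongr; exact hVN.trans h
      _ ≤ 2 * ρ ^ (M + 1) * (ε * L (M + 1) ^ 2 + q₁ ^ 2 / (4 * ε)) := by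
        gcongr; exact hpow M
      _ = 2 * ε * (ρ ^ (M + 1) * L (M + 1) ^ 2) + 2 * (ρ ^ (M + 1) * q₁ ^ 2 / (4 * ε)) := by ring
      _ ≤ _ := by gcongr
  have hshift : ∑ t ∈ Finset.range (M + 1), ρ ^ (t + 1) * L (t + 1) ^ 2 ≤ X := by
    rw [hXdef, Finset.sum_range_succ' _ (M + 1)]
    have := hnn 0
    linarith
  have bp : ∑ t ∈ Finset.range (M + 1), ρ ^ t * (L (t + 1) * p t) ≤
      2 * ε * X + (∑ t ∈ Finset.range (M + 1), ρ ^ t * p t ^ 2) / (4 * ε) := by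
    calc ∑ t ∈ Finset.range (M + 1), ρ ^ t * (L (t + 1) * p t)
        ≤ ∑ t ∈ Finset.range (M + 1), (2 * ε * (ρ ^ (t + 1) * L (t + 1) ^ 2)
            + ρ ^ t * p t ^ 2 / (4 * ε)) := by
          apply Finset.sum_le_sum
          intro t _
          have h := mul_le_mul_of_nonneg_left (young (L (t + 1)) (p t)) (pow_pos hρ0 t).le
          have h' := mul_le_mul_of_nonneg_right (hpow t)
            (show 0 ≤ ε * L (t + 1) ^ 2 by positivity)
          calc _ ≤ ρ ^ t * (ε * L (t + 1) ^ 2) + ρ ^ t * p t ^ 2 / (4 * ε) := by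
                rw [mul_add] at h; rwa [mul_div_assoc]
            _ ≤ _ := by linarith
      _ = 2 * ε * ∑ t ∈ Finset.range (M + 1), ρ ^ (t + 1) * L (t + 1) ^ 2 +
            (∑ t ∈ Finset.range (M + 1), ρ ^ t * p t ^ 2) / (4 * ε) := by
          rw [Finset.sum_add_distrib, Finset.mul_sum, Finset.sum_div]
      _ ≤ _ := by gcongr
  have bV : (ρ - 1) * ∑ t ∈ Finset.range M, ρ ^ t * V (t + 1) ≤ |ρ - 1| * (2 * (X + S)) := by
    have e1 : |∑ t ∈ Finset.range M, ρ ^ t * V (t + 1)| ≤ 2 * (X + S) := by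
      calc |∑ t ∈ Finset.range M, ρ ^ t * V (t + 1)|
          ≤ ∑ t ∈ Finset.range M, |ρ ^ t * V (t + 1)| := Finset.abs_sum_le_sum_abs _ _
        _ ≤ ∑ t ∈ Finset.range M, 2 * (ρ ^ (t + 1) * L (t + 1) ^ 2 + ρ ^ (t + 1) * W (t + 1)) := by
            apply Finset.sum_le_sum
            intro t ht
            have ht' : t + 1 < M + 1 := by have := Finset.mem_range.1 ht; omega
            rw [abs_mul, abs_of_pos (pow_pos hρ0 t)]
            have hw := hW (t + 1)
            calc ρ ^ t * |V (t + 1)| ≤ (2 * ρ ^ (t + 1)) * (L (t + 1) ^ 2 + W (t + 1)) := by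
                  gcongr
                  · exact hpow t
                  · exact hV _ ht'
              _ = _ := by ring
        _ = 2 * (∑ t ∈ Finset.range M, ρ ^ (t + 1) * L (t + 1) ^ 2 +
              ∑ t ∈ Finset.range M, ρ ^ (t + 1) * W (t + 1)) := by
            rw [← Finset.mul_sum, Finset.sum_add_distrib]
        _ ≤ 2 * (X + S) := by
            have i1 : ∑ t ∈ Finset.range M, ρ ^ (t + 1) * L (t + 1) ^ 2 ≤ X := by
              refine le_trans ?_ hshift
              rw [Finset.sum_range_succ]
              linarith [hnn (M + 1)]
            have i2 : ∑ t ∈ Finset.range M, ρ ^ (t + 1) * W (t + 1) ≤ S := by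
              rw [hS, Finset.sum_range_succ' _ M]
              have : 0 ≤ ρ ^ 0 * W 0 := by have := hW 0; positivity
              linarith
            linarith
    calc _ ≤ |(ρ - 1) * ∑ t ∈ Finset.range M, ρ ^ t * V (t + 1)| := le_abs_self _
      _ ≤ _ := by rw [abs_mul]; gcongr
  -- The change of weights consumes a second quarter of the dissipation, which determines the
  -- admissible size of `|ρ - 1|`.
  have hδ : |ρ - 1| * (2 * (X + S)) ≤ μ / 4 * S := by
    have hd := hρ.trans (min_le_right _ _)
    calc |ρ - 1| * (2 * (X + S)) ≤ μ / (8 * (κ + 1)) * (2 * (κ * S + S)) := by gcongr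
      _ = μ / 4 * S := by field_simp; ring
  have hεX : 5 * ε * X ≤ μ / 4 * S := by
    calc 5 * ε * X ≤ 5 * ε * (κ * S) := by gcongr
      _ ≤ 5 * ε * ((κ + 1) * S) := by gcongr; linarith
      _ = μ / 4 * S := by rw [hε]; field_simp; ring
  set P := ∑ t ∈ Finset.range (M + 1), ρ ^ t * p t ^ 2 with hP
  have hP0 : 0 ≤ P := Finset.sum_nonneg fun t _ => by positivity
  have hfin : μ / 2 * S ≤ (q₀ ^ 2 + P + ρ ^ (M + 1) * q₁ ^ 2) / (2 * ε) := by
    have : (q₀ ^ 2 + P + ρ ^ (M + 1) * q₁ ^ 2) / (2 * ε) =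
      2 * (q₀ ^ 2 / (4 * ε)) + 2 * (P / (4 * ε)) + 2 * (ρ ^ (M + 1) * q₁ ^ 2 / (4 * ε)) := by
      field_simp; ring
    rw [this]
    have z1 : 0 ≤ q₀ ^ 2 / (4 * ε) := by positivity
    have z2 : 0 ≤ P / (4 * ε) := by positivity
    linarith
  calc S = 2 / μ * (μ / 2 * S) := by field_simp
    _ ≤ 2 / μ * ((q₀ ^ 2 + P + ρ ^ (M + 1) * q₁ ^ 2) / (2 * ε)) := by gcongr
    _ = _ := by rw [hε]; field_simp

/-! ### Rollouts and the controllability matrix -/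

section Rollout

variable {n m : ℕ}

/-- The state at time `t` of the system with disturbances `c` and actions `ω`, started from `z` at
time `t₁`; it equals `z` for `t ≤ t₁`. -/
def rollout (A : ℕ → (E n →L[ℝ] E n)) (B : ℕ → (E m →L[ℝ] E n)) (c : ℕ → E n) (t₁ : ℕ) (z : E n)
    (ω : ℕ → E m) : ℕ → E n
  | 0 => z
  | t + 1 => if t < t₁ then z else A t (rollout A B c t₁ z ω t) + B t (ω t) + c t

/-- The state at time `t` of the undisturbed system started from `0` at time `t₁`, as a linear
function of the actions. -/
def response (A : ℕ → (E n →L[ℝ] E n)) (B : ℕ → (E m →L[ℝ] E n)) (t₁ : ℕ) :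
    ℕ → ((ℕ → E m) →ₗ[ℝ] E n)
  | 0 => 0
  | t + 1 => if t < t₁ then 0 else
      (A t).toLinearMap ∘ₗ response A B t₁ t + (B t).toLinearMap ∘ₗ LinearMap.proj t

variable (A : ℕ → (E n →L[ℝ] E n)) (B : ℕ → (E m →L[ℝ] E n)) (c : ℕ → E n)

lemma rollout_of_le {t₁ t : ℕ} (h : t ≤ t₁) (z : E n) (ω : ℕ → E m) :
    rollout A B c t₁ z ω t = z := by
  cases t with
  | zero => rfl
  | succ t => simp [rollout, show t < t₁ by omega]

lemma rollout_succ {t₁ t : ℕ} (h : t₁ ≤ t) (z : E n) (ω : ℕ → E m) :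
    rollout A B c t₁ z ω (t + 1) = A t (rollout A B c t₁ z ω t) + B t (ω t) + c t := by
  simp [rollout, show ¬ t < t₁ by omega]

lemma response_of_le {t₁ t : ℕ} (h : t ≤ t₁) (ω : ℕ → E m) : response A B t₁ t ω = 0 := by
  cases t with
  | zero => rfl
  | succ t => simp [response, show t < t₁ by omega]

lemma response_succ {t₁ t : ℕ} (h : t₁ ≤ t) (ω : ℕ → E m) :
    response A B t₁ (t + 1) ω = A t (response A B t₁ t ω) + B t (ω t) := by
  simp [response, show ¬ t < t₁ by omega]

lemma rollout_add (t₁ t : ℕ) (z : E n) (ω ω' : ℕ → E m) :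
    rollout A B c t₁ z (ω + ω') t = rollout A B c t₁ z ω t + response A B t₁ t ω' := by
  induction t with
  | zero => simp [rollout, response]
  | succ t ih =>
    rcases lt_or_ge t t₁ with h | h
    · rw [rollout_of_le _ _ _ h, rollout_of_le _ _ _ h, response_of_le _ _ h, add_zero]
    · rw [rollout_succ _ _ _ h, rollout_succ _ _ _ h, response_succ _ _ h, ih]
      simp only [Pi.add_apply, map_add]
      abel

/-- With no input the undisturbed system rests at `0`, so the start may be postponed to the first
action. This is how a control acting only on the last `d` steps is read off the controllability
matrix. -/
lemma response_eq_of_zero_before {t₁ s : ℕ} (hs : t₁ ≤ s) {ω : ℕ → E m}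
    (hω : ∀ t < s, ω t = 0) (t : ℕ) : response A B t₁ t ω = response A B s t ω := by
  induction t with
  | zero => simp [response]
  | succ t ih =>
    rcases lt_or_ge t t₁ with h | h
    · rw [response_of_le _ _ h, response_of_le _ _ (show t + 1 ≤ s by omega)]
    · rcases lt_or_ge t s with h' | h'
      · rw [response_succ _ _ h, ih, response_of_le _ _ h'.le, response_of_le _ _ h', hω t h']
        simp
      · rw [response_succ _ _ h, response_succ _ _ h', ih]

lemma continuous_rollout (t₁ t : ℕ) (z : E n) :
    Continuous fun ω : ℕ → E m => rollout A B c t₁ z ω t := by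
  induction t with
  | zero => exact continuous_const
  | succ t ih =>
    rcases lt_or_ge t t₁ with h | h
    · simp only [rollout_of_le A B c (show t + 1 ≤ t₁ from h)]
      exact continuous_const
    · simp only [rollout_succ A B c h]
      exact (((A t).continuous.comp ih).add ((B t).continuous.comp (continuous_apply t))).add
        continuous_const

/-- This turns the singular value assumption into a statement about trajectories: an extra step
applies `A (t + p)` to every existing block and appends the block `B (t + p)`. -/
lemma controllabilityMatrix_apply (t p : ℕ) (ω : ℕ → E m) :
    controllabilityMatrix A B t p (WithLp.toLp 2 fun i : Fin p => ω (t + i)) =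
      response A B t (t + p) ω := by
  have key : ∀ p, ∑ i : Fin p, transition A (t + p) (t + i + 1) (B (t + i) (ω (t + i))) =
      response A B t (t + p) ω := by
    intro p
    induction p with
    | zero => simp [response_of_le A B le_rfl]
    | succ p ih =>
      rw [Fin.sum_univ_castSucc, ← add_assoc, response_succ A B (Nat.le_add_right t p), ← ih,
        map_sum]
      congr 1
      · apply Finset.sum_congr rfl
        intro i _
        have hi := i.isLt
        simp only [Fin.val_castSucc, transition]
        rw [show t + p + 1 - (t + i + 1) = (t + p - (t + i + 1)) + 1 by omega, transitionAux,
          show t + i + 1 + (t + p - (t + i + 1)) = t + p by omega]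
        rfl
      · simp [transition, transitionAux]
  rw [← key]
  simp [controllabilityMatrix]

/-- Extension of a finite sequence of actions by zero. -/
def extendActions (t : ℕ) {p : ℕ} (ω : PiLp 2 fun _ : Fin p => E m) (s : ℕ) : E m :=
  if h : t ≤ s ∧ s < t + p then ω ⟨s - t, by omega⟩ else 0

lemma extendActions_add (t : ℕ) {p : ℕ} (ω : PiLp 2 fun _ : Fin p => E m) (i : Fin p) :
    extendActions t ω (t + i) = ω i := by
  simp [extendActions]

lemma extendActions_of_lt {t s : ℕ} {p : ℕ} (ω : PiLp 2 fun _ : Fin p => E m) (h : s < t) :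
    extendActions t ω s = 0 := by
  simp [extendActions, show ¬ t ≤ s by omega]

lemma norm_extendActions_le (t : ℕ) {p : ℕ} (ω : PiLp 2 fun _ : Fin p => E m) (s : ℕ) :
    ‖extendActions t ω s‖ ≤ ‖ω‖ := by
  unfold extendActions
  split_ifs
  · exact PiLp.norm_apply_le ω _
  · simp

lemma controllabilityMatrix_eq_response (t p : ℕ) (ω : PiLp 2 fun _ : Fin p => E m) :
    controllabilityMatrix A B t p ω = response A B t (t + p) (extendActions t ω) := by
  rw [← controllabilityMatrix_apply]
  congr 1
  ext i : 1
  simp [extendActions_add]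

lemma norm_response_le {s d : ℕ} {α b κ : ℝ} (hα : 1 ≤ α) (hb : 0 ≤ b) (hκ : 0 ≤ κ)
    (hA : ∀ t, s ≤ t → t < s + d → ‖A t‖ ≤ α) (hB : ∀ t, s ≤ t → t < s + d → ‖B t‖ ≤ b)
    {ω : ℕ → E m} (hω : ∀ t, ‖ω t‖ ≤ κ) {i : ℕ} (hi : i ≤ d) :
    ‖response A B s (s + i) ω‖ ≤ i * (α ^ i * (b * κ)) := by
  induction i with
  | zero => simp [response_of_le A B le_rfl]
  | succ i ih =>
    rw [← add_assoc, response_succ A B (Nat.le_add_right s i)]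
    have h1 : ‖A (s + i) (response A B s (s + i) ω)‖ ≤ α * (i * (α ^ i * (b * κ))) :=
      (ContinuousLinearMap.le_opNorm _ _).trans
        (mul_le_mul (hA _ (by omega) (by omega)) (ih (by omega)) (norm_nonneg _) (by linarith))
    have h2 : ‖B (s + i) (ω (s + i))‖ ≤ b * κ :=
      (ContinuousLinearMap.le_opNorm _ _).trans
        (mul_le_mul (hB _ (by omega) (by omega)) (hω _) (norm_nonneg _) hb)
    have h3 : b * κ ≤ α ^ (i + 1) * (b * κ) :=
      le_mul_of_one_le_left (by positivity) (one_le_pow₀ hα)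
    calc _ ≤ _ := norm_add_le _ _
      _ ≤ α * (i * (α ^ i * (b * κ))) + α ^ (i + 1) * (b * κ) := by linarith
      _ = _ := by push_cast; ring

end Rollout

lemma sigmaMin_mul_norm_le {V W : Type*} [NormedAddCommGroup V] [InnerProductSpace ℝ V]
    [CompleteSpace V] [NormedAddCommGroup W] [InnerProductSpace ℝ W] [CompleteSpace W]
    (M : V →L[ℝ] W) (y : W) : sigmaMin M * ‖y‖ ≤ ‖ContinuousLinearMap.adjoint M y‖ := by
  rcases eq_or_ne y 0 with rfl | hy
  · simp
  have hy' : 0 < ‖y‖ := norm_pos_iff.2 hy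
  have h : sigmaMin M ≤ ‖ContinuousLinearMap.adjoint M (‖y‖⁻¹ • y)‖ := by
    apply csInf_le
    · exact ⟨0, by rintro _ ⟨_, _, rfl⟩; exact norm_nonneg _⟩
    · exact ⟨_, by rw [norm_smul, norm_inv, norm_norm, inv_mul_cancel₀ hy'.ne'], rfl⟩
  rw [map_smul, norm_smul, norm_inv, norm_norm, ← div_eq_inv_mul, le_div_iff₀ hy'] at h
  exact h

/-- A vector orthogonal to the range is killed by the adjoint, hence zero; in finite dimension a
subspace with trivial orthogonal complement is everything. -/
lemma surjective_of_sigmaMin_pos {V W : Type*} [NormedAddCommGroup V] [InnerProductSpace ℝ V]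
    [CompleteSpace V] [NormedAddCommGroup W] [InnerProductSpace ℝ W] [FiniteDimensional ℝ W]
    [CompleteSpace W]
    (M : V →L[ℝ] W) (h : 0 < sigmaMin M) : Function.Surjective M := by
  have hbot : (LinearMap.range M.toLinearMap)ᗮ = ⊥ := by
    rw [Submodule.eq_bot_iff]
    intro y hy
    have h0 : ContinuousLinearMap.adjoint M y = 0 := by
      apply ext_inner_left ℝ
      intro v
      rw [ContinuousLinearMap.adjoint_inner_right, inner_zero_right]
      exact (Submodule.mem_orthogonal _ _).1 hy _ ⟨v, rfl⟩
    have h1 := sigmaMin_mul_norm_le M y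
    rw [h0, norm_zero] at h1
    by_contra hy0
    nlinarith [norm_pos_iff.2 hy0]
  have := Submodule.orthogonal_eq_bot_iff.1 hbot
  exact LinearMap.range_eq_top.1 this

/-! ### Costates -/

section Costate

variable {n m : ℕ} {A : ℕ → (E n →L[ℝ] E n)} {B : ℕ → (E m →L[ℝ] E n)}

/-- `p` is the costate with sources `γ` on `[t₁, t₂]`, and `χ` is its pairing with the actions. -/
structure IsCostate (A : ℕ → (E n →L[ℝ] E n)) (B : ℕ → (E m →L[ℝ] E n)) (t₁ t₂ : ℕ)
    (γ : ℕ → E n) (χ : ℕ → E m) (p : ℕ → E n) : Prop where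
  costate : ∀ t, t₁ ≤ t → t < t₂ → p t = γ t + ContinuousLinearMap.adjoint (A t) (p (t + 1))
  stationary : ∀ t, t₁ ≤ t → t < t₂ → χ t + ContinuousLinearMap.adjoint (B t) (p (t + 1)) = 0

/-- The discrete integration by parts behind everything that follows: the two terms containing `A`
cancel by adjointness. -/
lemma inner_costate_sub_succ {A : E n →L[ℝ] E n} {B : E m →L[ℝ] E n} {p p' γ η η' c : E n}
    {ω : E m} (hp : p = γ + ContinuousLinearMap.adjoint A p') (hη : η' = A η + B ω + c) :
    inner ℝ p η - inner ℝ p' η' =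
      inner ℝ γ η - inner ℝ (ContinuousLinearMap.adjoint B p') ω - inner ℝ p' c := by
  rw [hp, hη, inner_add_left, inner_add_right, inner_add_right,
    ContinuousLinearMap.adjoint_inner_left, ContinuousLinearMap.adjoint_inner_left]
  ring

lemma sum_Ico_sub_succ (f : ℕ → ℝ) {a b : ℕ} (h : a ≤ b) :
    ∑ t ∈ Finset.Ico a b, (f t - f (t + 1)) = f a - f b := by
  induction b, h using Nat.le_induction with
  | base => simp
  | succ b h ih => rw [Finset.sum_Ico_succ_top h, ih]; ring

lemma IsCostate.mono {t₁ t₂ s₁ s₂ : ℕ} {γ : ℕ → E n} {χ : ℕ → E m} {p : ℕ → E n}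
    (h : IsCostate A B t₁ t₂ γ χ p) (h1 : t₁ ≤ s₁) (h2 : s₂ ≤ t₂) : IsCostate A B s₁ s₂ γ χ p :=
  ⟨fun t ht ht' => h.costate t (by omega) (by omega),
    fun t ht ht' => h.stationary t (by omega) (by omega)⟩

/-- The costate equations are linear in sources, pairings and costate. The difference of two KKT
points of nonlinear problems is therefore again a costate, with gradient differences as its data. -/
lemma IsCostate.sub {t₁ t₂ : ℕ} {γ γ' : ℕ → E n} {χ χ' : ℕ → E m} {p p' : ℕ → E n}
    (h : IsCostate A B t₁ t₂ γ χ p) (h' : IsCostate A B t₁ t₂ γ' χ' p') :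
    IsCostate A B t₁ t₂ (γ - γ') (χ - χ') (p - p') where
  costate t ht ht' := by
    simp only [Pi.sub_apply, map_sub]
    rw [h.costate t ht ht', h'.costate t ht ht']
    abel
  stationary t ht ht' := by
    simp only [Pi.sub_apply, map_sub]
    rw [← sub_zero (0 : E m)]
    nth_rw 1 [← h.stationary t ht ht', ← h'.stationary t ht ht']
    abel

lemma IsCostate.inner_step {t₁ t₂ : ℕ} {γ : ℕ → E n} {χ : ℕ → E m} {p : ℕ → E n}
    (h : IsCostate A B t₁ t₂ γ χ p) {η c : ℕ → E n} {ω : ℕ → E m} {t : ℕ} (h1 : t₁ ≤ t)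
    (h2 : t < t₂) (hη : η (t + 1) = A t (η t) + B t (ω t) + c t) :
    inner ℝ (p t) (η t) - inner ℝ (p (t + 1)) (η (t + 1)) =
      inner ℝ (γ t) (η t) + inner ℝ (χ t) (ω t) - inner ℝ (p (t + 1)) (c t) := by
  rw [inner_costate_sub_succ (h.costate t h1 h2) hη,
    eq_neg_of_add_eq_zero_left (h.stationary t h1 h2), inner_neg_left]
  ring

lemma IsCostate.inner_sum {t₁ t₂ : ℕ} {γ : ℕ → E n} {χ : ℕ → E m} {p : ℕ → E n}
    (h : IsCostate A B t₁ t₂ γ χ p) (h12 : t₁ ≤ t₂) {η : ℕ → E n} {ω : ℕ → E m}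
    (hη : ∀ t, t₁ ≤ t → t < t₂ → η (t + 1) = A t (η t) + B t (ω t)) :
    inner ℝ (p t₁) (η t₁) - inner ℝ (p t₂) (η t₂) =
      ∑ t ∈ Finset.Ico t₁ t₂, (inner ℝ (γ t) (η t) + inner ℝ (χ t) (ω t)) := by
  rw [← sum_Ico_sub_succ (fun t => inner ℝ (p t) (η t)) h12]
  apply Finset.sum_congr rfl
  intro t ht
  obtain ⟨ht1, ht2⟩ := Finset.mem_Ico.1 ht
  have := h.inner_step (c := 0) ht1 ht2 (by simpa using hη t ht1 ht2)
  simpa using this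

/-- Backward recursion from time `s`: every step multiplies by at most `α` and adds one source, and
`α ≥ 1` lets a single power cover all terms. -/
lemma IsCostate.norm_le {t₁ t₂ : ℕ} {γ : ℕ → E n} {χ : ℕ → E m} {p : ℕ → E n} {α : ℝ}
    (h : IsCostate A B t₁ t₂ γ χ p) (hα : 1 ≤ α) (hA : ∀ t, t₁ ≤ t → t < t₂ → ‖A t‖ ≤ α)
    {s : ℕ} (hs : s ≤ t₂) (i : ℕ) {t : ℕ} (ht : t₁ ≤ t) (hi : t + i = s) :
    ‖p t‖ ≤ α ^ i * (‖p s‖ + ∑ r ∈ Finset.Ico t s, ‖γ r‖) := by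
  induction i generalizing t with
  | zero => simp [show t = s by omega]
  | succ i ih =>
    have h1 := ih (t := t + 1) (by omega) (by omega)
    rw [Finset.sum_eq_sum_Ico_succ_bot (show t < s by omega), h.costate t ht (by omega)]
    set X := ∑ r ∈ Finset.Ico (t + 1) s, ‖γ r‖
    have hX : 0 ≤ X := Finset.sum_nonneg fun _ _ => norm_nonneg _
    have h2 : ‖ContinuousLinearMap.adjoint (A t) (p (t + 1))‖ ≤ α * (α ^ i * (‖p s‖ + X)) := by
      refine (ContinuousLinearMap.le_opNorm _ _).trans ?_
      rw [LinearIsometryEquiv.norm_map]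
      exact mul_le_mul (hA t ht (by omega)) h1 (norm_nonneg _) (by linarith)
    have h3 : ‖γ t‖ ≤ α ^ (i + 1) * ‖γ t‖ :=
      le_mul_of_one_le_left (norm_nonneg _) (one_le_pow₀ hα)
    calc _ ≤ _ := norm_add_le _ _
      _ ≤ α ^ (i + 1) * ‖γ t‖ + α * (α ^ i * (‖p s‖ + X)) := by linarith
      _ = _ := by ring

/-- Over a controllable window the final costate is determined by sources and pairings. -/
lemma IsCostate.norm_le_of_controllable {s d : ℕ} {γ : ℕ → E n} {χ : ℕ → E m} {p : ℕ → E n}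
    {α b σ : ℝ} (h : IsCostate A B s (s + d) γ χ p) (hα : 1 ≤ α) (hb : 0 ≤ b)
    (hA : ∀ t, s ≤ t → t < s + d → ‖A t‖ ≤ α) (hB : ∀ t, s ≤ t → t < s + d → ‖B t‖ ≤ b)
    (hσ : σ ≤ sigmaMin (controllabilityMatrix A B s d)) :
    σ * ‖p (s + d)‖ ≤
      (1 + d * (α ^ d * b)) * ∑ r ∈ Finset.Ico s (s + d), (‖γ r‖ + ‖χ r‖) := by
  set M := controllabilityMatrix A B s d
  -- These inputs steer the undisturbed system from rest so that its final state pairs with the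
  -- costate to `‖ω‖ ^ 2`. The summed pairing identity bounds that by `‖ω‖` times the data, and one
  -- factor `‖ω‖` cancels.
  set ω := ContinuousLinearMap.adjoint M (p (s + d)) with hω
  have h1 : σ * ‖p (s + d)‖ ≤ ‖ω‖ :=
    (mul_le_mul_of_nonneg_right hσ (norm_nonneg _)).trans (sigmaMin_mul_norm_le M _)
  set η := fun t => response A B s t (extendActions s ω) with hη
  set Y := ∑ r ∈ Finset.Ico s (s + d), (‖γ r‖ + ‖χ r‖)
  have hY : 0 ≤ Y := Finset.sum_nonneg fun _ _ => by positivity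
  have h2 : ‖ω‖ ^ 2 = inner ℝ (p (s + d)) (η (s + d)) := by
    rw [← real_inner_self_eq_norm_sq]
    conv_lhs => rw [hω]
    rw [ContinuousLinearMap.adjoint_inner_left, hη]
    simp only []
    rw [← controllabilityMatrix_eq_response]
  have h3 := h.inner_sum (Nat.le_add_right s d) (η := η) (ω := extendActions s ω)
    (fun t ht _ => response_succ A B ht _)
  have h4 : η s = 0 := response_of_le A B le_rfl _
  rw [h4, inner_zero_right, zero_sub] at h3
  have h5 : ‖ω‖ ^ 2 ≤ (1 + d * (α ^ d * b)) * ‖ω‖ * Y := by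
    rw [h2, ← neg_neg (inner ℝ (p (s + d)) (η (s + d))), h3, ← Finset.sum_neg_distrib,
      Finset.mul_sum]
    apply Finset.sum_le_sum
    intro t ht
    obtain ⟨ht1, ht2⟩ := Finset.mem_Ico.1 ht
    obtain ⟨i, rfl⟩ := Nat.exists_eq_add_of_le ht1
    have e1 : ‖η (s + i)‖ ≤ d * (α ^ d * b) * ‖ω‖ := by
      refine (norm_response_le A B hα hb (norm_nonneg ω) hA hB (norm_extendActions_le s ω)
        (show i ≤ d by omega)).trans ?_
      have : (i : ℝ) ≤ d := by exact_mod_cast (show i ≤ d by omega)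
      calc (i : ℝ) * (α ^ i * (b * ‖ω‖)) ≤ d * (α ^ d * (b * ‖ω‖)) := by
            gcongr
            omega
        _ = _ := by ring
    have e2 := norm_extendActions_le s ω (s + i)
    have e3 := neg_le_of_abs_le (abs_real_inner_le_norm (γ (s + i)) (η (s + i)))
    have e4 := neg_le_of_abs_le (abs_real_inner_le_norm (χ (s + i)) (extendActions s ω (s + i)))
    have hk : 0 ≤ d * (α ^ d * b) := by positivity
    have e5 : ‖γ (s + i)‖ * ‖η (s + i)‖ ≤ ‖γ (s + i)‖ * ((1 + d * (α ^ d * b)) * ‖ω‖) := by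
      gcongr
      nlinarith [norm_nonneg ω]
    have e6 : ‖χ (s + i)‖ * ‖extendActions s ω (s + i)‖ ≤
        ‖χ (s + i)‖ * ((1 + d * (α ^ d * b)) * ‖ω‖) := by
      gcongr
      nlinarith [norm_nonneg ω, mul_nonneg hk (norm_nonneg ω)]
    linarith
  refine h1.trans ?_
  rcases (norm_nonneg ω).eq_or_lt with h0 | h0
  · rw [← h0]
    positivity
  · nlinarith

end Costate

namespace Problem

variable {n m : ℕ} {S : Problem n m}

/-! ### Solutions in real-valued terms -/

/-- The sum of the stage costs over `[t₁, t₂)`. -/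
def stageCost (S : Problem n m) (t₁ t₂ : ℕ) (y : ℕ → E n) (v : ℕ → E m) : ℝ :=
  ∑ t ∈ Finset.Ico t₁ t₂, (S.fx t (y t) + S.fu t (v t))

lemma ftocpObjective_terminal (t₁ t₂ : ℕ) (y : ℕ → E n) (v : ℕ → E m) :
    S.ftocpObjective t₁ t₂ S.terminalCost y v =
      ((S.stageCost t₁ t₂ y v + S.FT (y t₂) : ℝ) : EReal) := by
  rw [EReal.coe_add]; rfl

lemma ftocpObjective_indicator_of_eq {t₁ t₂ : ℕ} {ζ : E n} {y : ℕ → E n} (h : y t₂ = ζ)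
    (v : ℕ → E m) :
    S.ftocpObjective t₁ t₂ (indicatorCost ζ) y v = ((S.stageCost t₁ t₂ y v : ℝ) : EReal) := by
  simp [ftocpObjective, indicatorCost, h, stageCost]

lemma ftocpObjective_indicator_of_ne {t₁ t₂ : ℕ} {ζ : E n} {y : ℕ → E n} (h : y t₂ ≠ ζ)
    (v : ℕ → E m) : S.ftocpObjective t₁ t₂ (indicatorCost ζ) y v = ⊤ := by
  simp only [ftocpObjective, indicatorCost, h, if_false]
  exact EReal.coe_add_top _

lemma isFTOCPSolution_terminal_iff {t₁ t₂ : ℕ} {z : E n} {ξ : ∀ t, E (S.r t)} {y : ℕ → E n}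
    {v : ℕ → E m} :
    S.IsFTOCPSolution t₁ t₂ z ξ S.terminalCost y v ↔ S.IsFTOCPTrajectory t₁ t₂ z ξ y v ∧
      ∀ y' v', S.IsFTOCPTrajectory t₁ t₂ z ξ y' v' →
        S.stageCost t₁ t₂ y v + S.FT (y t₂) ≤ S.stageCost t₁ t₂ y' v' + S.FT (y' t₂) := by
  simp only [IsFTOCPSolution, ftocpObjective_terminal, EReal.coe_le_coe_iff, EReal.coe_lt_top,
    true_and]

lemma isFTOCPSolution_indicator_iff {t₁ t₂ : ℕ} {z ζ : E n} {ξ : ∀ t, E (S.r t)} {y : ℕ → E n}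
    {v : ℕ → E m} :
    S.IsFTOCPSolution t₁ t₂ z ξ (indicatorCost ζ) y v ↔
      S.IsFTOCPTrajectory t₁ t₂ z ξ y v ∧ y t₂ = ζ ∧
      ∀ y' v', S.IsFTOCPTrajectory t₁ t₂ z ξ y' v' → y' t₂ = ζ →
        S.stageCost t₁ t₂ y v ≤ S.stageCost t₁ t₂ y' v' := by
  constructor
  · rintro ⟨h1, h2, h3⟩
    have hy : y t₂ = ζ := by
      by_contra h
      rw [ftocpObjective_indicator_of_ne h] at h2
      exact lt_irrefl _ h2
    refine ⟨h1, hy, fun y' v' h' hy' => ?_⟩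
    have := h3 y' v' h'
    rwa [ftocpObjective_indicator_of_eq hy, ftocpObjective_indicator_of_eq hy',
      EReal.coe_le_coe_iff] at this
  · rintro ⟨h1, hy, h3⟩
    refine ⟨h1, ?_, fun y' v' h' => ?_⟩
    · rw [ftocpObjective_indicator_of_eq hy]
      exact EReal.coe_lt_top _
    · by_cases hy' : y' t₂ = ζ
      · rw [ftocpObjective_indicator_of_eq hy, ftocpObjective_indicator_of_eq hy',
          EReal.coe_le_coe_iff]
        exact h3 y' v' h' hy'
      · rw [ftocpObjective_indicator_of_ne hy']
        exact le_top

/-! ### Optimality conditions -/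

/-- `(y, v)` satisfies the first-order conditions over `[t₁, t₂]` with costate `p`. -/
def IsKKT (S : Problem n m) (t₁ t₂ : ℕ) (y : ℕ → E n) (v : ℕ → E m) (p : ℕ → E n) : Prop :=
  IsCostate S.A S.B t₁ t₂ (fun t => gradient (S.fx t) (y t)) (fun t => gradient (S.fu t) (v t)) p

/-- The costs appearing over `[t₁, t₂)` are well-conditioned. -/
def CostsOn (S : Problem n m) (μ ℓ : ℝ) (t₁ t₂ : ℕ) : Prop :=
  ∀ t, t₁ ≤ t → t < t₂ → IsWellConditioned μ ℓ (S.fx t) ∧ IsWellConditioned μ ℓ (S.fu t)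

variable {μ ℓ : ℝ} {t₁ t₂ : ℕ} {z ζ : E n} {ξ : ∀ t, E (S.r t)} {y : ℕ → E n} {v : ℕ → E m}

lemma hasDerivAt_stageCost (hf : S.CostsOn μ ℓ t₁ t₂) (y η : ℕ → E n) (v ω : ℕ → E m) :
    HasDerivAt (fun θ : ℝ => S.stageCost t₁ t₂ (fun t => y t + θ • η t) (fun t => v t + θ • ω t))
      (∑ t ∈ Finset.Ico t₁ t₂, (inner ℝ (gradient (S.fx t) (y t)) (η t) +
        inner ℝ (gradient (S.fu t) (v t)) (ω t))) 0 := by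
  unfold stageCost
  apply HasDerivAt.fun_sum
  intro t ht
  obtain ⟨h1, h2⟩ := Finset.mem_Ico.1 ht
  exact ((hf t h1 h2).1.hasDerivAt_line _ _).add ((hf t h1 h2).2.hasDerivAt_line _ _)

lemma IsFTOCPTrajectory.add_smul (h : S.IsFTOCPTrajectory t₁ t₂ z ξ y v) {η : ℕ → E n}
    {ω : ℕ → E m} (hη0 : η t₁ = 0)
    (hη : ∀ t, t₁ ≤ t → t < t₂ → η (t + 1) = S.A t (η t) + S.B t (ω t)) (θ : ℝ) :
    S.IsFTOCPTrajectory t₁ t₂ z ξ (fun t => y t + θ • η t) (fun t => v t + θ • ω t) := by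
  refine ⟨by simp [h.1, hη0], fun t h1 h2 => ?_⟩
  simp only [h.2 t h1 h2, hη t h1 h2, g, map_add, map_smul, smul_add]
  abel

lemma first_order_terminal (hf : S.CostsOn μ ℓ t₁ t₂) (hF : IsWellConditioned μ ℓ S.FT)
    (h : S.IsFTOCPSolution t₁ t₂ z ξ S.terminalCost y v) {η : ℕ → E n}
    {ω : ℕ → E m} (hη0 : η t₁ = 0)
    (hη : ∀ t, t₁ ≤ t → t < t₂ → η (t + 1) = S.A t (η t) + S.B t (ω t)) :
    ∑ t ∈ Finset.Ico t₁ t₂, (inner ℝ (gradient (S.fx t) (y t)) (η t) +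
      inner ℝ (gradient (S.fu t) (v t)) (ω t)) + inner ℝ (gradient S.FT (y t₂)) (η t₂) = 0 := by
  rw [isFTOCPSolution_terminal_iff] at h
  refine IsLocalMin.hasDerivAt_eq_zero ?_
    ((hasDerivAt_stageCost hf y η v ω).add (hF.hasDerivAt_line (y t₂) (η t₂)))
  refine Filter.Eventually.of_forall fun θ => ?_
  have := h.2 _ _ (h.1.add_smul hη0 hη θ)
  simpa using this

lemma first_order_indicator (hf : S.CostsOn μ ℓ t₁ t₂)
    (h : S.IsFTOCPSolution t₁ t₂ z ξ (indicatorCost ζ) y v) {η : ℕ → E n}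
    {ω : ℕ → E m} (hη0 : η t₁ = 0)
    (hη : ∀ t, t₁ ≤ t → t < t₂ → η (t + 1) = S.A t (η t) + S.B t (ω t)) (hη2 : η t₂ = 0) :
    ∑ t ∈ Finset.Ico t₁ t₂, (inner ℝ (gradient (S.fx t) (y t)) (η t) +
      inner ℝ (gradient (S.fu t) (v t)) (ω t)) = 0 := by
  rw [isFTOCPSolution_indicator_iff] at h
  refine IsLocalMin.hasDerivAt_eq_zero ?_ (hasDerivAt_stageCost hf y η v ω)
  refine Filter.Eventually.of_forall fun θ => ?_
  have := h.2.2 _ _ (h.1.add_smul hη0 hη θ) (by simp [hη2, h.2.1])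
  simpa using this

/-- Backward recursion for the costate, `j` steps before time `t₂`. -/
def backwardCostate (A : ℕ → (E n →L[ℝ] E n)) (γ : ℕ → E n) (t₂ : ℕ) (π : E n) : ℕ → E n
  | 0 => π
  | j + 1 => γ (t₂ - 1 - j) +
      ContinuousLinearMap.adjoint (A (t₂ - 1 - j)) (backwardCostate A γ t₂ π j)

/-- A terminal multiplier turns the first-order condition for variations into a costate. -/
lemma exists_isKKT_of_multiplier (h12 : t₁ ≤ t₂) (π : E n)
    (hfoc : ∀ ω : ℕ → E m, ∑ t ∈ Finset.Ico t₁ t₂,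
      (inner ℝ (gradient (S.fx t) (y t)) (response S.A S.B t₁ t ω) +
      inner ℝ (gradient (S.fu t) (v t)) (ω t)) + inner ℝ π (response S.A S.B t₁ t₂ ω) = 0) :
    ∃ p, S.IsKKT t₁ t₂ y v p ∧ p t₂ = π := by
  set p : ℕ → E n := fun t => backwardCostate S.A (fun t => gradient (S.fx t) (y t)) t₂ π (t₂ - t)
  have hp : ∀ t, t < t₂ →
      p t = gradient (S.fx t) (y t) + ContinuousLinearMap.adjoint (S.A t) (p (t + 1)) := by
    intro t ht
    simp only [p]
    rw [show t₂ - t = (t₂ - (t + 1)) + 1 by omega, backwardCostate,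
      show t₂ - 1 - (t₂ - (t + 1)) = t by omega]
  have hp2 : p t₂ = π := by simp [p, backwardCostate]
  refine ⟨p, ⟨fun t _ ht => hp t ht, ?_⟩, hp2⟩
  -- The stationarity residual is itself used as the variation; the first-order condition then says
  -- that the sum of its squared norms is zero.
  set ω : ℕ → E m := fun t => gradient (S.fu t) (v t) +
    ContinuousLinearMap.adjoint (S.B t) (p (t + 1)) with hω
  have h0 := hfoc ω
  have h1 := sum_Ico_sub_succ (fun t => inner ℝ (p t) (response S.A S.B t₁ t ω)) h12
  rw [response_of_le _ _ le_rfl, inner_zero_right, zero_sub, hp2] at h1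
  have h2 : ∑ t ∈ Finset.Ico t₁ t₂, ‖ω t‖ ^ 2 = 0 := by
    rw [← h0, ← neg_neg (inner ℝ π _), ← h1, ← sub_eq_add_neg, ← Finset.sum_sub_distrib]
    apply Finset.sum_congr rfl
    intro t ht
    obtain ⟨ht1, ht2⟩ := Finset.mem_Ico.1 ht
    rw [inner_costate_sub_succ (c := 0) (ω := ω t) (B := S.B t) (hp t ht2)
      (by rw [response_succ _ _ ht1, add_zero]), ← real_inner_self_eq_norm_sq]
    nth_rw 1 [hω]
    rw [inner_add_left, inner_zero_right]
    ring
  intro t ht1 ht2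
  have h3 := (Finset.sum_eq_zero_iff_of_nonneg (fun t _ => by positivity)).1 h2 t
    (Finset.mem_Ico.2 ⟨ht1, ht2⟩)
  exact norm_eq_zero.1 (pow_eq_zero_iff two_ne_zero |>.1 h3)

lemma IsFTOCPSolution.exists_isKKT_terminal (hf : S.CostsOn μ ℓ t₁ t₂)
    (hF : IsWellConditioned μ ℓ S.FT) (h12 : t₁ ≤ t₂)
    (h : S.IsFTOCPSolution t₁ t₂ z ξ S.terminalCost y v) :
    ∃ p, S.IsKKT t₁ t₂ y v p ∧ p t₂ = gradient S.FT (y t₂) :=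
  exists_isKKT_of_multiplier h12 _ fun ω =>
    first_order_terminal hf hF h (η := fun t => response S.A S.B t₁ t ω)
      (response_of_le _ _ le_rfl _) (fun _ ht _ => response_succ _ _ ht _)

/-- The first variation vanishes on all inputs whose response is zero at `t₂`, so it factors through
the final response, and the factor represents a Lagrange multiplier. No controllability is needed
for its existence. -/
lemma IsFTOCPSolution.exists_isKKT_indicator (hf : S.CostsOn μ ℓ t₁ t₂) (h12 : t₁ ≤ t₂)
    (h : S.IsFTOCPSolution t₁ t₂ z ξ (indicatorCost ζ) y v) :
    ∃ p, S.IsKKT t₁ t₂ y v p := by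
  let φ : (ℕ → E m) →ₗ[ℝ] ℝ := ∑ t ∈ Finset.Ico t₁ t₂,
    ((innerₗ (E n) (gradient (S.fx t) (y t))) ∘ₗ response S.A S.B t₁ t +
      (innerₗ (E m) (gradient (S.fu t) (v t))) ∘ₗ LinearMap.proj t)
  have hφ : ∀ ω, φ ω = ∑ t ∈ Finset.Ico t₁ t₂,
      (inner ℝ (gradient (S.fx t) (y t)) (response S.A S.B t₁ t ω) +
      inner ℝ (gradient (S.fu t) (v t)) (ω t)) := by
    intro ω
    simp [φ, LinearMap.sum_apply]
  have hker : φ ∈ LinearMap.range (response S.A S.B t₁ t₂).dualMap := by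
    rw [LinearMap.range_dualMap_eq_dualAnnihilator_ker, Submodule.mem_dualAnnihilator]
    intro ω hω
    rw [hφ]
    exact first_order_indicator hf h (η := fun t => response S.A S.B t₁ t ω)
      (response_of_le _ _ le_rfl _) (fun _ ht _ => response_succ _ _ ht _) hω
  obtain ⟨ψ, hψ⟩ := hker
  set π := (InnerProductSpace.toDual ℝ (E n)).symm (LinearMap.toContinuousLinearMap ψ)
  obtain ⟨p, hp, -⟩ := exists_isKKT_of_multiplier (S := S) (y := y) (v := v) h12 (-π) (fun ω => by
    rw [← hφ, ← hψ, inner_neg_left, InnerProductSpace.toDual_symm_apply]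
    simp)
  exact ⟨p, hp⟩

end Problem

/-- Constant in the bound of the costate by the energy over a window. -/
def costateGain (ℓ : ℝ) (d : ℕ) (σ a b : ℝ) : ℝ :=
  2 * d * ((1 + a) ^ d * ((1 + d * ((1 + a) ^ d * b)) / σ + 1) * ℓ) ^ 2

lemma costateGain_nonneg {ℓ σ a b : ℝ} {d : ℕ} : 0 ≤ costateGain ℓ d σ a b := by
  unfold costateGain; positivity

/-- Constant in the weighted energy estimate for a costate constant `K`. -/
def energyGain (μ : ℝ) (d : ℕ) (K : ℝ) : ℝ := 20 * (K * ((2 * d + 1) * 2 ^ d) + 1) / μ ^ 2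

/-- Admissible deviation from `1` of the ratio of the weights. -/
def ratioGap (μ : ℝ) (d : ℕ) (K : ℝ) : ℝ :=
  min (1 / 2) (μ / (8 * (K * ((2 * d + 1) * 2 ^ d) + 1)))

lemma sq_sum_add_le {ι : Type*} (s : Finset ι) (Y U : ι → ℝ) {d : ℕ} (hd : s.card ≤ d) :
    (∑ i ∈ s, (Y i + U i)) ^ 2 ≤ 2 * d * ∑ i ∈ s, (Y i ^ 2 + U i ^ 2) := by
  have h0 : 0 ≤ ∑ i ∈ s, (Y i ^ 2 + U i ^ 2) := Finset.sum_nonneg fun _ _ => by positivity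
  calc (∑ i ∈ s, (Y i + U i)) ^ 2 ≤ s.card * ∑ i ∈ s, (Y i + U i) ^ 2 :=
        sq_sum_le_card_mul_sum_sq
    _ ≤ s.card * ∑ i ∈ s, 2 * (Y i ^ 2 + U i ^ 2) := by
        gcongr with i
        nlinarith [sq_nonneg (Y i - U i)]
    _ = 2 * s.card * ∑ i ∈ s, (Y i ^ 2 + U i ^ 2) := by rw [← Finset.mul_sum]; ring
    _ ≤ _ := by gcongr

/-! ### Bounds on costates by the energy in a window. -/

section Costate

variable {n m : ℕ} {A : ℕ → (E n →L[ℝ] E n)} {B : ℕ → (E m →L[ℝ] E n)}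
  {t₁ N d : ℕ} {γ : ℕ → E n} {χ : ℕ → E m} {p : ℕ → E n} {a b σ ℓ : ℝ} {Y U : ℕ → ℝ}

/-- Controllability bounds the costate at the right end of a window containing `i`, the backward
recursion carries the bound to `i`, and Cauchy–Schwarz squares the sum of the sources. -/
lemma IsCostate.norm_sq_le_window (h : IsCostate A B t₁ (t₁ + N) γ χ p) (ha : 0 < a) (hb : 0 < b)
    (hσ : 0 < σ) (hℓ : 0 < ℓ) (hdN : d ≤ N)
    (hA : ∀ t, t₁ ≤ t → t < t₁ + N → ‖A t‖ ≤ a) (hB : ∀ t, t₁ ≤ t → t < t₁ + N → ‖B t‖ ≤ b)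
    (hctr : ∀ s, t₁ ≤ s → s + d ≤ t₁ + N → σ ≤ sigmaMin (controllabilityMatrix A B s d))
    (hγ : ∀ i < N, ‖γ (t₁ + i)‖ ≤ ℓ * Y i) (hχ : ∀ i < N, ‖χ (t₁ + i)‖ ≤ ℓ * U i)
    {i : ℕ} (hi : i ≤ N) :
    ‖p (t₁ + i)‖ ^ 2 ≤ costateGain ℓ d σ a b *
      ∑ r ∈ (Finset.range N).filter (fun r => r ≤ i + d ∧ i ≤ r + d), (Y r ^ 2 + U r ^ 2) := by
  -- Powers of `1 + a` increase with the exponent, whereas `a` itself may be below `1`.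
  have hα : 1 ≤ 1 + a := by linarith
  have hA' : ∀ t, t₁ ≤ t → t < t₁ + N → ‖A t‖ ≤ 1 + a := fun t h1 h2 =>
    (hA t h1 h2).trans (by linarith)
  -- The window starts at `i` where possible and is otherwise pushed left to end at `N`; in both
  -- cases `s ≤ i ≤ s + d`.
  set s := min i (N - d) with hs
  have hsN : s + d ≤ N := by omega
  set X := ∑ r ∈ Finset.Ico s (s + d), (Y r + U r) with hX
  have hterm : ∀ r ∈ Finset.Ico s (s + d), ‖γ (t₁ + r)‖ + ‖χ (t₁ + r)‖ ≤ ℓ * (Y r + U r) := by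
    intro r hr
    obtain ⟨_, h2⟩ := Finset.mem_Ico.1 hr
    rw [mul_add]
    exact add_le_add (hγ r (by omega)) (hχ r (by omega))
  have hsum : ∑ r ∈ Finset.Ico (t₁ + s) (t₁ + s + d), (‖γ r‖ + ‖χ r‖) ≤ ℓ * X := by
    rw [add_assoc, add_comm t₁ s, add_comm t₁ (s + d),
      ← Finset.sum_Ico_add (fun r => ‖γ r‖ + ‖χ r‖) s (s + d) t₁, hX, Finset.mul_sum]
    exact Finset.sum_le_sum hterm
  have h1 := (h.mono (Nat.le_add_right t₁ s) (show t₁ + s + d ≤ t₁ + N by omega)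
    ).norm_le_of_controllable hα hb.le
    (fun t h1 h2 => hA' t (by omega) (by omega)) (fun t h1 h2 => hB t (by omega) (by omega))
    (hctr _ (by omega) (by omega))
  have hk : 0 < 1 + d * ((1 + a) ^ d * b) := by positivity
  have h2 : ‖p (t₁ + s + d)‖ ≤ (1 + d * ((1 + a) ^ d * b)) / σ * (ℓ * X) := by
    rw [div_mul_eq_mul_div, le_div_iff₀ hσ, mul_comm]
    exact h1.trans (mul_le_mul_of_nonneg_left hsum hk.le)
  have h3 := h.norm_le hα hA' (show t₁ + s + d ≤ t₁ + N by omega) (s + d - i)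
    (Nat.le_add_right t₁ i) (by omega)
  have h4 : ∑ r ∈ Finset.Ico (t₁ + i) (t₁ + s + d), ‖γ r‖ ≤ ℓ * X := by
    refine le_trans ?_ hsum
    refine (Finset.sum_le_sum_of_subset_of_nonneg (Finset.Ico_subset_Ico_left (by omega))
      (fun _ _ _ => norm_nonneg _)).trans (Finset.sum_le_sum fun r _ => ?_)
    linarith [norm_nonneg (χ r)]
  have hX0 : 0 ≤ ℓ * X := le_trans (Finset.sum_nonneg fun _ _ => by positivity) hsum
  have h5 : ‖p (t₁ + i)‖ ≤ (1 + a) ^ d * ((1 + d * ((1 + a) ^ d * b)) / σ + 1) * ℓ * X := by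
    calc ‖p (t₁ + i)‖ ≤ _ := h3
      _ ≤ (1 + a) ^ d * ((1 + d * ((1 + a) ^ d * b)) / σ * (ℓ * X) + ℓ * X) := by
        gcongr
        omega
      _ = _ := by ring
  have h6 : X ^ 2 ≤ 2 * d * ∑ r ∈ (Finset.range N).filter (fun r => r ≤ i + d ∧ i ≤ r + d),
      (Y r ^ 2 + U r ^ 2) := by
    refine (sq_sum_add_le _ _ _ (d := d) (by simp)).trans ?_
    refine mul_le_mul_of_nonneg_left (Finset.sum_le_sum_of_subset_of_nonneg ?_
      (fun _ _ _ => by positivity)) (by positivity)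
    intro r hr
    obtain ⟨_, _⟩ := Finset.mem_Ico.1 hr
    simp only [Finset.mem_filter, Finset.mem_range]
    omega
  calc ‖p (t₁ + i)‖ ^ 2
      ≤ ((1 + a) ^ d * ((1 + d * ((1 + a) ^ d * b)) / σ + 1) * ℓ * X) ^ 2 := by gcongr
    _ = ((1 + a) ^ d * ((1 + d * ((1 + a) ^ d * b)) / σ + 1) * ℓ) ^ 2 * X ^ 2 := by ring
    _ ≤ ((1 + a) ^ d * ((1 + d * ((1 + a) ^ d * b)) / σ + 1) * ℓ) ^ 2 * _ :=
        mul_le_mul_of_nonneg_left h6 (by positivity)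
    _ = _ := by rw [costateGain]; ring

/-- Horizons too short for controllability: the final costate is bounded directly, as the terminal
gradient allows, and fewer than `d` backward steps remain. -/
lemma IsCostate.norm_sq_le_short (h : IsCostate A B t₁ (t₁ + N) γ χ p) (ha : 0 < a) (hb : 0 < b)
    (hσ : 0 < σ) (hℓ : 0 < ℓ) (hdN : N < d) (hA : ∀ t, t₁ ≤ t → t < t₁ + N → ‖A t‖ ≤ a)
    (hγ : ∀ i < N, ‖γ (t₁ + i)‖ ≤ ℓ * Y i) (hp : ‖p (t₁ + N)‖ ≤ ℓ * Y N)
    {i : ℕ} (hi : i ≤ N) :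
    ‖p (t₁ + i)‖ ^ 2 ≤ costateGain ℓ d σ a b * ∑ r ∈ Finset.range (N + 1), Y r ^ 2 := by
  have hα : 1 ≤ 1 + a := by linarith
  have h3 := h.norm_le hα (fun t h1 h2 => (hA t h1 h2).trans (by linarith)) le_rfl (N - i)
    (Nat.le_add_right t₁ i) (by omega)
  set X := ∑ r ∈ Finset.range (N + 1), Y r with hX
  have hY : ∀ j ≤ N, 0 ≤ Y j := by
    intro j hj
    rcases hj.eq_or_lt with rfl | hj
    · exact nonneg_of_mul_nonneg_right ((norm_nonneg _).trans hp) hℓ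
    · exact nonneg_of_mul_nonneg_right ((norm_nonneg _).trans (hγ j hj)) hℓ
  have hX0 : 0 ≤ X := Finset.sum_nonneg fun j hj => hY j (by have := Finset.mem_range.1 hj; omega)
  have h4 : ‖p (t₁ + N)‖ + ∑ r ∈ Finset.Ico (t₁ + i) (t₁ + N), ‖γ r‖ ≤ ℓ * X := by
    rw [show ∑ r ∈ Finset.Ico (t₁ + i) (t₁ + N), ‖γ r‖ = ∑ r ∈ Finset.Ico i N, ‖γ (t₁ + r)‖ by
        rw [Finset.sum_Ico_add (fun r => ‖γ r‖), add_comm t₁ i, add_comm t₁ N],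
      hX, Finset.sum_range_succ, mul_add, add_comm]
    refine add_le_add ?_ hp
    rw [Finset.mul_sum, Finset.range_eq_Ico]
    refine (Finset.sum_le_sum fun r hr => hγ r (Finset.mem_Ico.1 hr).2).trans
      (Finset.sum_le_sum_of_subset_of_nonneg (Finset.Ico_subset_Ico_left (by omega)) ?_)
    intro r hr _
    exact mul_nonneg hℓ.le (hY r (Finset.mem_Ico.1 hr).2.le)
  have hk : 0 ≤ (1 + d * ((1 + a) ^ d * b)) / σ := by positivity
  have h5 : ‖p (t₁ + i)‖ ≤ (1 + a) ^ d * ((1 + d * ((1 + a) ^ d * b)) / σ + 1) * ℓ * X := by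
    calc ‖p (t₁ + i)‖ ≤ _ := h3
      _ ≤ (1 + a) ^ d * (ℓ * X) := by
        gcongr
        omega
      _ ≤ (1 + a) ^ d * (((1 + d * ((1 + a) ^ d * b)) / σ + 1) * (ℓ * X)) := by
        refine mul_le_mul_of_nonneg_left (le_mul_of_one_le_left ?_ ?_) (by positivity)
        · positivity
        · linarith
      _ = _ := by ring
  have h6 : X ^ 2 ≤ 2 * d * ∑ r ∈ Finset.range (N + 1), Y r ^ 2 := by
    simpa using sq_sum_add_le (Finset.range (N + 1)) Y 0 (d := d) (by simpa using hdN)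
  calc ‖p (t₁ + i)‖ ^ 2
      ≤ ((1 + a) ^ d * ((1 + d * ((1 + a) ^ d * b)) / σ + 1) * ℓ * X) ^ 2 := by gcongr
    _ = ((1 + a) ^ d * ((1 + d * ((1 + a) ^ d * b)) / σ + 1) * ℓ) ^ 2 * X ^ 2 := by ring
    _ ≤ ((1 + a) ^ d * ((1 + d * ((1 + a) ^ d * b)) / σ + 1) * ℓ) ^ 2 *
        (2 * d * ∑ r ∈ Finset.range (N + 1), Y r ^ 2) := by gcongr
    _ = _ := by rw [costateGain]; ring

end Costate

namespace Problem

variable {n m : ℕ} {S : Problem n m} {μ ℓ : ℝ} {d : ℕ} {σ a b b' Lw Dw : ℝ}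

lemma Assumptions.costsOn (hS : S.Assumptions μ ℓ d σ a b b' Lw Dw) {t₁ t₂ : ℕ} (h : t₂ ≤ S.T) :
    S.CostsOn μ ℓ t₁ t₂ := fun t _ ht => ⟨hS.fx t (by omega), hS.fu t (by omega)⟩

/-! ### Energy estimates for pairs of KKT points. -/

section Energy

variable {t₁ N : ℕ} {y y' p p' c c' : ℕ → E n} {v v' : ℕ → E m} {ρ : ℝ}

/-- The gradient differences are paired with the corresponding differences of states and actions, so
strong monotonicity of both stage costs produces the dissipation. -/
lemma dissipation_step (hS : S.Assumptions μ ℓ d σ a b b' Lw Dw) (hT : t₁ + N ≤ S.T)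
    (h : S.IsKKT t₁ (t₁ + N) y v p) (h' : S.IsKKT t₁ (t₁ + N) y' v' p')
    (hy : ∀ t, t₁ ≤ t → t < t₁ + N → y (t + 1) = S.A t (y t) + S.B t (v t) + c t)
    (hy' : ∀ t, t₁ ≤ t → t < t₁ + N → y' (t + 1) = S.A t (y' t) + S.B t (v' t) + c' t)
    {t : ℕ} (h1 : t₁ ≤ t) (h2 : t < t₁ + N) :
    μ * (‖y t - y' t‖ ^ 2 + ‖v t - v' t‖ ^ 2) ≤
      inner ℝ (p t - p' t) (y t - y' t) - inner ℝ (p (t + 1) - p' (t + 1)) (y (t + 1) - y' (t + 1))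
        + ‖p (t + 1) - p' (t + 1)‖ * ‖c t - c' t‖ := by
  have hd := IsCostate.inner_step (IsCostate.sub h h') (η := y - y') (ω := v - v') (c := c - c')
    h1 h2 (by
      simp only [Pi.sub_apply, map_sub]
      rw [hy t h1 h2, hy' t h1 h2]; abel)
  simp only [Pi.sub_apply] at hd
  have m1 := (hS.fx t (by omega)).strongly_monotone (y t) (y' t)
  have m2 := (hS.fu t (by omega)).strongly_monotone (v t) (v' t)
  have m3 := real_inner_le_norm (p (t + 1) - p' (t + 1)) (c t - c' t)
  linarith

lemma abs_inner_le_sq_add (x z : E n) (w : ℝ) (hw : 0 ≤ w) :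
    |inner ℝ x z| ≤ ‖x‖ ^ 2 + (‖z‖ ^ 2 + w) := by
  have := abs_real_inner_le_norm x z
  nlinarith [sq_nonneg (‖x‖ - ‖z‖), sq_nonneg ‖x‖, sq_nonneg ‖z‖]

/-- Weighted distance of two KKT points over a horizon exceeding the controllability index. -/
theorem energy_le_of_isKKT (hμ : 0 < μ) (hℓ : 0 < ℓ) (hσ : 0 < σ) (ha : 0 < a) (hb : 0 < b)
    (hS : S.Assumptions μ ℓ d σ a b b' Lw Dw) (hdN : d ≤ N) (hT : t₁ + N ≤ S.T)
    (h : S.IsKKT t₁ (t₁ + N) y v p) (h' : S.IsKKT t₁ (t₁ + N) y' v' p')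
    (hy : ∀ t, t₁ ≤ t → t < t₁ + N → y (t + 1) = S.A t (y t) + S.B t (v t) + c t)
    (hy' : ∀ t, t₁ ≤ t → t < t₁ + N → y' (t + 1) = S.A t (y' t) + S.B t (v' t) + c' t)
    (hρ : |ρ - 1| ≤ ratioGap μ d (costateGain ℓ d σ a b)) :
    ∑ i ∈ Finset.range N,
        ρ ^ i * (‖y (t₁ + i) - y' (t₁ + i)‖ ^ 2 + ‖v (t₁ + i) - v' (t₁ + i)‖ ^ 2) ≤
      energyGain μ d (costateGain ℓ d σ a b) * (‖y t₁ - y' t₁‖ ^ 2 +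
        ∑ i ∈ Finset.range N, ρ ^ i * ‖c (t₁ + i) - c' (t₁ + i)‖ ^ 2 +
        ρ ^ N * ‖y (t₁ + N) - y' (t₁ + N)‖ ^ 2) := by
  have hd : 1 ≤ d := hS.controllable.1.1.1
  refine weighted_energy_le (V := fun i => inner ℝ (p (t₁ + i) - p' (t₁ + i))
    (y (t₁ + i) - y' (t₁ + i))) (L := fun i => ‖p (t₁ + i) - p' (t₁ + i)‖) hμ costateGain_nonneg
    (hd.trans hdN) (fun i => by positivity) ?_ ?_ ?_ ?_ ?_ hρ
  · intro i hi
    exact dissipation_step hS hT h h' hy hy' (Nat.le_add_right _ _) (by omega)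
  · exact real_inner_le_norm _ _
  · exact (neg_le_abs _).trans (abs_real_inner_le_norm _ _)
  · intro i _
    exact abs_inner_le_sq_add _ _ _ (by positivity)
  · intro i hi
    exact IsCostate.norm_sq_le_window (IsCostate.sub h h') ha hb hσ hℓ hdN
      (fun t _ ht => hS.norm_A t (by omega)) (fun t _ ht => hS.norm_B t (by omega))
      (fun s _ hs => hS.controllable.2 s (by omega))
      (fun i hi => (hS.fx _ (by omega)).smooth _ _) (fun i hi => (hS.fu _ (by omega)).smooth _ _) hi

/-- Weighted distance of two KKT points with the true terminal cost. -/
theorem energy_le_of_isKKT_terminal (hμ : 0 < μ) (hℓ : 0 < ℓ) (hσ : 0 < σ) (ha : 0 < a) (hb : 0 < b)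
    (hS : S.Assumptions μ ℓ d σ a b b' Lw Dw) (hT : t₁ + N = S.T)
    (h : S.IsKKT t₁ (t₁ + N) y v p) (h' : S.IsKKT t₁ (t₁ + N) y' v' p')
    (hp : p (t₁ + N) = gradient S.FT (y (t₁ + N)))
    (hp' : p' (t₁ + N) = gradient S.FT (y' (t₁ + N)))
    (hy : ∀ t, t₁ ≤ t → t < t₁ + N → y (t + 1) = S.A t (y t) + S.B t (v t) + c t)
    (hy' : ∀ t, t₁ ≤ t → t < t₁ + N → y' (t + 1) = S.A t (y' t) + S.B t (v' t) + c' t)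
    (hρ : |ρ - 1| ≤ ratioGap μ d (costateGain ℓ d σ a b)) :
    ∑ i ∈ Finset.range N,
        ρ ^ i * (‖y (t₁ + i) - y' (t₁ + i)‖ ^ 2 + ‖v (t₁ + i) - v' (t₁ + i)‖ ^ 2) +
        ρ ^ N * ‖y (t₁ + N) - y' (t₁ + N)‖ ^ 2 ≤
      energyGain μ d (costateGain ℓ d σ a b) * (‖y t₁ - y' t₁‖ ^ 2 +
        ∑ i ∈ Finset.range N, ρ ^ i * ‖c (t₁ + i) - c' (t₁ + i)‖ ^ 2) := by
  set Y : ℕ → ℝ := fun i => ‖y (t₁ + i) - y' (t₁ + i)‖ with hYdef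
  -- The terminal cost is treated as an additional step `N` with no action and no disturbance, after
  -- which storage and multiplier are zero. This removes the boundary term at the end.
  set U : ℕ → ℝ := fun i => if i < N then ‖v (t₁ + i) - v' (t₁ + i)‖ else 0 with hUdef
  set W : ℕ → ℝ := fun i => Y i ^ 2 + U i ^ 2 with hWdef
  set V : ℕ → ℝ := fun i => if i ≤ N then inner ℝ (p (t₁ + i) - p' (t₁ + i))
    (y (t₁ + i) - y' (t₁ + i)) else 0 with hVdef
  set L : ℕ → ℝ := fun i => if i ≤ N then ‖p (t₁ + i) - p' (t₁ + i)‖ else 0 with hLdef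
  set P : ℕ → ℝ := fun i => if i < N then ‖c (t₁ + i) - c' (t₁ + i)‖ else 0 with hPdef
  have hW0 : ∀ i, 0 ≤ W i := fun i => by positivity
  have key : ∑ i ∈ Finset.range (N + 1), ρ ^ i * W i ≤
      energyGain μ d (costateGain ℓ d σ a b) * (‖y t₁ - y' t₁‖ ^ 2 +
        ∑ i ∈ Finset.range (N + 1), ρ ^ i * P i ^ 2 + ρ ^ (N + 1) * (0 : ℝ) ^ 2) := by
    refine weighted_energy_le (V := V) (L := L) hμ costateGain_nonneg (by omega) hW0
      ?_ ?_ ?_ ?_ ?_ hρ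
    · intro i hi
      rcases (Nat.lt_succ_iff.1 hi).lt_or_eq with hi | rfl
      · simp only [W, V, L, P, U, Y, hi, hi.le, show i + 1 ≤ N by omega, if_true]
        exact dissipation_step hS hT.le h h' hy hy' (Nat.le_add_right _ _) (by omega)
      -- In the additional step the final costate difference is the difference of terminal
      -- gradients, so strong monotonicity of `F_T` provides the dissipation.
      · have := hS.FT.strongly_monotone (y (t₁ + i)) (y' (t₁ + i))
        simp only [W, V, L, P, U, Y, lt_irrefl, le_refl, if_true, if_false,
          show ¬ i + 1 ≤ i by omega, hp, hp']
        linarith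
    · simp only [V, L, Nat.zero_le, if_true]
      exact real_inner_le_norm _ _
    · simp [V]
    · intro i hi
      simp only [V, L, W, Y, Nat.lt_succ_iff.1 hi, if_true]
      exact abs_inner_le_sq_add _ _ _ (by positivity)
    · intro i hi
      rcases hi.lt_or_eq with hi | rfl
      swap
      · simp only [L, show ¬ N + 1 ≤ N by omega, if_false]
        exact le_trans (by norm_num)
          (mul_nonneg costateGain_nonneg (Finset.sum_nonneg fun r _ => hW0 r))
      have hi' : i ≤ N := by omega
      simp only [L, hi', if_true]
      have hA : ∀ t, t₁ ≤ t → t < t₁ + N → ‖S.A t‖ ≤ a := fun t _ ht => hS.norm_A t (by omega)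
      have hγ : ∀ i < N, ‖gradient (S.fx (t₁ + i)) (y (t₁ + i)) -
          gradient (S.fx (t₁ + i)) (y' (t₁ + i))‖ ≤ ℓ * Y i :=
        fun i hi => (hS.fx _ (by omega)).smooth _ _
      rcases le_or_gt d N with hdN | hdN
      · refine (IsCostate.norm_sq_le_window (Y := Y) (U := U) (IsCostate.sub h h') ha hb hσ hℓ hdN
          hA (fun t _ ht => hS.norm_B t (by omega))
          (fun s _ hs => hS.controllable.2 s (by omega)) hγ
          (fun i hi => ?_) hi').trans ?_
        · simp only [U, hi, if_true]
          exact (hS.fu _ (by omega)).smooth _ _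
        · refine mul_le_mul_of_nonneg_left (Finset.sum_le_sum_of_subset_of_nonneg
            (Finset.filter_subset_filter _ (Finset.range_mono (by omega))) (fun r _ _ => hW0 r))
            costateGain_nonneg
      · refine (IsCostate.norm_sq_le_short (Y := Y) (IsCostate.sub h h') ha hb hσ hℓ hdN
          hA hγ (by simp only [Pi.sub_apply, hp, hp']; exact hS.FT.smooth _ _) hi').trans ?_
        refine mul_le_mul_of_nonneg_left ?_ costateGain_nonneg
        rw [Finset.filter_true_of_mem (fun r hr => by have := Finset.mem_range.1 hr; omega)]
        exact Finset.sum_le_sum fun r _ => by simp only [W]; nlinarith [sq_nonneg (U r)]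
  rw [Finset.sum_range_succ, Finset.sum_range_succ] at key
  have e1 : ∑ i ∈ Finset.range N, ρ ^ i * W i = ∑ i ∈ Finset.range N,
      ρ ^ i * (‖y (t₁ + i) - y' (t₁ + i)‖ ^ 2 + ‖v (t₁ + i) - v' (t₁ + i)‖ ^ 2) :=
    Finset.sum_congr rfl fun i hi => by simp [W, Y, U, Finset.mem_range.1 hi]
  have e2 : ∑ i ∈ Finset.range N, ρ ^ i * P i ^ 2 = ∑ i ∈ Finset.range N,
      ρ ^ i * ‖c (t₁ + i) - c' (t₁ + i)‖ ^ 2 :=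
    Finset.sum_congr rfl fun i hi => by simp [P, Finset.mem_range.1 hi]
  rw [e1, e2] at key
  simpa [W, Y, U, P] using key

end Energy

end Problem

/-- The decay rate of the perturbation bounds for a costate constant `K`. -/
def decayRate (μ : ℝ) (d : ℕ) (K : ℝ) : ℝ := Real.sqrt (1 / (1 + ratioGap μ d K))

/-! ### The decay rate and the admissible weights. -/

section Rate

variable {μ K : ℝ} {d : ℕ}

lemma ratioGap_pos (hμ : 0 < μ) (hK : 0 ≤ K) : 0 < ratioGap μ d K := by
  unfold ratioGap; positivity

lemma decayRate_sq (hμ : 0 < μ) (hK : 0 ≤ K) :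
    decayRate μ d K ^ 2 = 1 / (1 + ratioGap μ d K) := by
  have := ratioGap_pos (d := d) hμ hK
  exact Real.sq_sqrt (by positivity)

lemma decayRate_pos (hμ : 0 < μ) (hK : 0 ≤ K) : 0 < decayRate μ d K := by
  have := ratioGap_pos (d := d) hμ hK
  exact Real.sqrt_pos.2 (by positivity)

lemma decayRate_lt_one (hμ : 0 < μ) (hK : 0 ≤ K) : decayRate μ d K < 1 := by
  have h := ratioGap_pos (d := d) hμ hK
  rw [decayRate, Real.sqrt_lt' one_pos, div_lt_iff₀ (by linarith)]
  linarith

/-- The squared rate is the inverse of `1 + gap`, and inversion only brings it closer to `1`. Hence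
it is as admissible a weight as `1 + gap`. -/
lemma abs_decayRate_sq_sub_one_le (hμ : 0 < μ) (hK : 0 ≤ K) :
    |decayRate μ d K ^ 2 - 1| ≤ ratioGap μ d K := by
  have h := ratioGap_pos (d := d) hμ hK
  rw [decayRate_sq hμ hK, abs_le]
  have e : 1 / (1 + ratioGap μ d K) - 1 = -(ratioGap μ d K / (1 + ratioGap μ d K)) := by
    field_simp; ring
  have h1 : ratioGap μ d K / (1 + ratioGap μ d K) ≤ ratioGap μ d K :=
    div_le_self h.le (by linarith)
  have h2 : 0 ≤ ratioGap μ d K / (1 + ratioGap μ d K) := by positivity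
  rw [e]
  constructor <;> linarith

lemma energyGain_nonneg (hK : 0 ≤ K) : 0 ≤ energyGain μ d K := by
  unfold energyGain; positivity

end Rate

lemma le_of_weighted_sq_le {ρ lam G e x : ℝ} {i : ℕ} (hρ : ρ * lam ^ 2 = 1) (hlam : 0 < lam)
    (hG : 0 ≤ G) (he : 0 ≤ e) (h : ρ ^ i * x ^ 2 ≤ G * e ^ 2) :
    x ≤ Real.sqrt G * lam ^ i * e := by
  have hρ0 : 0 < ρ := pos_of_mul_pos_left (hρ ▸ one_pos) (by positivity)
  have h1 : (ρ ^ i) * (lam ^ i) ^ 2 = 1 := by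
    rw [← pow_mul, mul_comm i, pow_mul, ← mul_pow, hρ, one_pow]
  refine le_of_abs_le (abs_le_of_sq_le_sq ?_ (by positivity))
  rw [mul_pow, mul_pow, Real.sq_sqrt hG]
  calc x ^ 2 = (lam ^ i) ^ 2 * (ρ ^ i * x ^ 2) := by linear_combination (-x ^ 2) * h1
    _ ≤ (lam ^ i) ^ 2 * (G * e ^ 2) := by gcongr
    _ = _ := by ring

lemma sum_sq_add_sq_le (s : Finset ℕ) (f : ℕ → ℝ) (hf : ∀ i ∈ s, 0 ≤ f i) {e : ℝ} (he : 0 ≤ e) :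
    ∑ i ∈ s, f i ^ 2 + e ^ 2 ≤ (∑ i ∈ s, f i + e) ^ 2 := by
  have h1 : ∑ i ∈ s, f i ^ 2 ≤ (∑ i ∈ s, f i) ^ 2 := Finset.sum_sq_le_sq_sum_of_nonneg hf
  have h2 := Finset.sum_nonneg hf
  nlinarith [mul_nonneg h2 he]

/-! ### The exponentially decaying perturbation bounds. -/

namespace Problem

variable {n m : ℕ} {S : Problem n m} {μ ℓ : ℝ} {d : ℕ} {σ a b b' Lw Dw : ℝ}

lemma lipschitz_w_sum_le (hS : S.Assumptions μ ℓ d σ a b b' Lw Dw) {lam H G : ℝ}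
    (hlam : 0 < lam) (hG : Real.sqrt G * (1 + Lw) ≤ H) {t₁ N : ℕ} (hT : t₁ + N ≤ S.T)
    {ξ ξ' : ∀ t, E (S.r t)} (hξ : ∀ t, t₁ ≤ t → t < t₁ + N → ξ t ∈ S.Ξ t)
    (hξ' : ∀ t, t₁ ≤ t → t < t₁ + N → ξ' t ∈ S.Ξ t) :
    Real.sqrt G * ∑ i ∈ Finset.range N,
      lam ^ i * ‖S.w (t₁ + i) (ξ (t₁ + i)) - S.w (t₁ + i) (ξ' (t₁ + i))‖ ≤
      ∑ t ∈ Finset.Ico t₁ (t₁ + N), H * lam ^ (t - t₁) * ‖ξ t - ξ' t‖ := by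
  rw [Finset.sum_Ico_eq_sum_range, Finset.mul_sum, Nat.add_sub_cancel_left]
  apply Finset.sum_le_sum
  intro i hi
  have hi' := Finset.mem_range.1 hi
  rw [Nat.add_sub_cancel_left]
  have h1 := hS.lipschitz_w (t₁ + i) (by omega) _ (hξ _ (by omega) (by omega)) _
    (hξ' _ (by omega) (by omega))
  have h2 : 0 ≤ Real.sqrt G := Real.sqrt_nonneg _
  calc _ ≤ Real.sqrt G * (lam ^ i * (Lw * ‖ξ (t₁ + i) - ξ' (t₁ + i)‖)) := by gcongr
    _ = (Real.sqrt G * Lw) * (lam ^ i * ‖ξ (t₁ + i) - ξ' (t₁ + i)‖) := by ring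
    _ ≤ H * (lam ^ i * ‖ξ (t₁ + i) - ξ' (t₁ + i)‖) := by
      gcongr
      linarith
    _ = _ := by ring

/-- The first action of solutions from the same initial state, from a weighted energy bound. -/
lemma first_action_le {lam G x e : ℝ} {N : ℕ} {W P : ℕ → ℝ} (hN : 0 < N) (hlam : 0 < lam)
    (hG : 0 ≤ G) (he : 0 ≤ e) (hW : ∀ i, 0 ≤ W i) (hP : ∀ i, 0 ≤ P i) (hx : x ^ 2 ≤ W 0)
    (h : ∑ i ∈ Finset.range N, (lam ^ 2) ^ i * W i ≤
      G * (∑ i ∈ Finset.range N, (lam ^ 2) ^ i * P i ^ 2 + (lam ^ 2) ^ N * e ^ 2)) :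
    x ≤ Real.sqrt G * ∑ i ∈ Finset.range N, lam ^ i * P i + Real.sqrt G * (lam ^ N * e) := by
  have h0 : (lam ^ 2) ^ 0 * W 0 ≤ ∑ i ∈ Finset.range N, (lam ^ 2) ^ i * W i :=
    Finset.single_le_sum (f := fun i => (lam ^ 2) ^ i * W i)
      (fun i _ => by have := hW i; positivity) (Finset.mem_range.2 hN)
  have h1 := sum_sq_add_sq_le (Finset.range N) (fun i => lam ^ i * P i)
    (fun i _ => by have := hP i; positivity) (e := lam ^ N * e) (by positivity)
  have hQ : 0 ≤ ∑ i ∈ Finset.range N, lam ^ i * P i + lam ^ N * e :=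
    add_nonneg (Finset.sum_nonneg fun i _ => by have := hP i; positivity) (by positivity)
  rw [← mul_add]
  refine le_of_abs_le (abs_le_of_sq_le_sq ?_ (by positivity))
  rw [mul_pow, Real.sq_sqrt hG]
  have e1 : ∑ i ∈ Finset.range N, (lam ^ i * P i) ^ 2 + (lam ^ N * e) ^ 2 =
      ∑ i ∈ Finset.range N, (lam ^ 2) ^ i * P i ^ 2 + (lam ^ 2) ^ N * e ^ 2 := by
    congr 1
    · exact Finset.sum_congr rfl fun i _ => by rw [mul_pow, ← pow_mul, ← pow_mul, mul_comm i]
    · rw [mul_pow, ← pow_mul, ← pow_mul, mul_comm N]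
  rw [e1] at h1
  rw [pow_zero, one_mul] at h0
  exact hx.trans (h0.trans (h.trans (mul_le_mul_of_nonneg_left h1 hG)))

/-- The exponentially decaying perturbation bounds. -/
theorem perturbationBounds (hμ : 0 < μ) (hℓ : 0 < ℓ) (hσ : 0 < σ) (ha : 0 < a) (hb : 0 < b)
    (hLw : 0 ≤ Lw) (hS : S.Assumptions μ ℓ d σ a b b' Lw Dw) {H : ℝ}
    (hH : Real.sqrt (energyGain μ d (costateGain ℓ d σ a b)) * (1 + Lw) ≤ H) :
    S.PerturbationBounds d H (decayRate μ d (costateGain ℓ d σ a b)) := by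
  set K := costateGain ℓ d σ a b with hKdef
  have hK : 0 ≤ K := costateGain_nonneg
  set G := energyGain μ d K with hGdef
  have hG : 0 ≤ G := energyGain_nonneg hK
  set lam := decayRate μ d K with hlamdef
  have hlam : 0 < lam := decayRate_pos hμ hK
  -- The weight `lam ^ 2 < 1` serves the dependence on parameters and target, by discounting late
  -- perturbations; the weight `1 + ratioGap μ d K > 1` serves the decay from the initial state.
  have hgap : |lam ^ 2 - 1| ≤ ratioGap μ d K := abs_decayRate_sq_sub_one_le hμ hK
  have hd : 1 ≤ d := hS.controllable.1.1.1
  have hgp : 0 < ratioGap μ d K := ratioGap_pos hμ hK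
  have hgap' : |(1 + ratioGap μ d K) - 1| ≤ ratioGap μ d K := by
    rw [add_sub_cancel_left, abs_of_pos hgp]
  have hinv : (1 + ratioGap μ d K) * lam ^ 2 = 1 := by
    rw [hlamdef, decayRate_sq hμ hK]; field_simp
  have hGH : Real.sqrt G ≤ H := by nlinarith [Real.sqrt_nonneg G]
  have hρ0 : 0 < 1 + ratioGap μ d K := by linarith
  have decay : ∀ {N : ℕ} {X U : ℕ → ℝ} {e : ℝ}, 0 ≤ e →
      ∑ i ∈ Finset.range N, (1 + ratioGap μ d K) ^ i * (X i ^ 2 + U i ^ 2) ≤ G * e ^ 2 →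
      ∀ i < N, X i ≤ H * lam ^ i * e ∧ U i ≤ H * lam ^ i * e := by
    intro N X U e he h i hi
    have h1 : (1 + ratioGap μ d K) ^ i * (X i ^ 2 + U i ^ 2) ≤ G * e ^ 2 :=
      (Finset.single_le_sum (f := fun i => (1 + ratioGap μ d K) ^ i * (X i ^ 2 + U i ^ 2))
        (fun i _ => by positivity) (Finset.mem_range.2 hi)).trans h
    have hp := pow_pos hρ0 i
    have hHe : Real.sqrt G * lam ^ i * e ≤ H * lam ^ i * e := by gcongr
    exact ⟨(le_of_weighted_sq_le hinv hlam hG he (by nlinarith [sq_nonneg (U i)])).trans hHe,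
      (le_of_weighted_sq_le hinv hlam hG he (by nlinarith [sq_nonneg (X i)])).trans hHe⟩
  refine ⟨?_, ?_, ?_, ?_⟩
  · intro t₁ t₂ h12 hT z ζ ζ' ξ ξ' hξ hξ' y v y' v' h h'
    obtain ⟨N, rfl⟩ := Nat.exists_eq_add_of_le (show t₁ ≤ t₂ by omega)
    obtain ⟨p, hp⟩ := h.exists_isKKT_indicator (hS.costsOn hT) (Nat.le_add_right _ _)
    obtain ⟨p', hp'⟩ := h'.exists_isKKT_indicator (hS.costsOn hT) (Nat.le_add_right _ _)
    rw [isFTOCPSolution_indicator_iff] at h h'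
    have key := energy_le_of_isKKT hμ hℓ hσ ha hb hS (show d ≤ N by omega) hT hp hp'
      (c := fun t => S.w t (ξ t)) (c' := fun t => S.w t (ξ' t)) h.1.2 h'.1.2 hgap
    rw [h.1.1, h'.1.1, h.2.1, h'.2.1, sub_self, norm_zero, zero_pow two_ne_zero, zero_add] at key
    have h1 := first_action_le (x := ‖v t₁ - v' t₁‖) (show 0 < N by omega) hlam hG (norm_nonneg _)
      (fun i => by positivity) (fun i => norm_nonneg _) (by simp) key
    refine h1.trans (add_le_add (lipschitz_w_sum_le hS hlam hH hT hξ hξ') ?_)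
    rw [Nat.add_sub_cancel_left, mul_assoc]
    gcongr
  · intro t₁ hT z ξ ξ' hξ hξ' y v y' v' h h'
    obtain ⟨N, hN⟩ := Nat.exists_eq_add_of_le hT.le
    rw [hN] at h h' hξ hξ' ⊢
    obtain ⟨p, hp, hpT⟩ := h.exists_isKKT_terminal (hS.costsOn hN.ge) hS.FT (Nat.le_add_right _ _)
    obtain ⟨p', hp', hpT'⟩ :=
      h'.exists_isKKT_terminal (hS.costsOn hN.ge) hS.FT (Nat.le_add_right _ _)
    rw [isFTOCPSolution_terminal_iff] at h h'
    have key := energy_le_of_isKKT_terminal hμ hℓ hσ ha hb hS hN.symm hp hp' hpT hpT'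
      (c := fun t => S.w t (ξ t)) (c' := fun t => S.w t (ξ' t)) h.1.2 h'.1.2 hgap
    rw [h.1.1, h'.1.1, sub_self, norm_zero, zero_pow two_ne_zero, zero_add] at key
    have h1 := first_action_le (x := ‖v t₁ - v' t₁‖) (e := 0)
      (W := fun i => ‖y (t₁ + i) - y' (t₁ + i)‖ ^ 2 + ‖v (t₁ + i) - v' (t₁ + i)‖ ^ 2)
      (P := fun i => ‖S.w (t₁ + i) (ξ (t₁ + i)) - S.w (t₁ + i) (ξ' (t₁ + i))‖)
      (show 0 < N by omega) hlam hG le_rfl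
      (fun i => by positivity) (fun i => norm_nonneg _) (by simp) (by
        refine le_trans ?_ (key.trans (by simp [G, K]))
        have : 0 ≤ (lam ^ 2) ^ N * ‖y (t₁ + N) - y' (t₁ + N)‖ ^ 2 := by positivity
        linarith)
    refine h1.trans ?_
    simpa using lipschitz_w_sum_le hS hlam hH hN.ge hξ hξ'
  · intro t₁ t₂ h12 hT z z' ζ ξ hξ y v y' v' h h'
    obtain ⟨N, rfl⟩ := Nat.exists_eq_add_of_le (show t₁ ≤ t₂ by omega)
    obtain ⟨p, hp⟩ := h.exists_isKKT_indicator (hS.costsOn hT) (Nat.le_add_right _ _)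
    obtain ⟨p', hp'⟩ := h'.exists_isKKT_indicator (hS.costsOn hT) (Nat.le_add_right _ _)
    rw [isFTOCPSolution_indicator_iff] at h h'
    have key := energy_le_of_isKKT hμ hℓ hσ ha hb hS (show d ≤ N by omega) hT hp hp'
      (c := fun t => S.w t (ξ t)) (c' := fun t => S.w t (ξ t)) h.1.2 h'.1.2 hgap'
    rw [h.1.1, h'.1.1, h.2.1, h'.2.1] at key
    have key' := decay (N := N) (X := fun i => ‖y (t₁ + i) - y' (t₁ + i)‖)
      (U := fun i => ‖v (t₁ + i) - v' (t₁ + i)‖) (norm_nonneg (z - z')) (by simpa using key)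
    refine ⟨fun t h1 h2 => ?_, fun t h1 h2 => ?_⟩
    · obtain ⟨i, rfl⟩ := Nat.exists_eq_add_of_le h1
      rw [Nat.add_sub_cancel_left]
      -- The energy does not cover the final time, but there both solutions sit at the same target.
      rcases h2.lt_or_eq with h2 | h2
      · exact (key' i (by omega)).1
      · rw [h2, h.2.1, h'.2.1, sub_self, norm_zero]
        have := (Real.sqrt_nonneg G).trans hGH
        positivity
    · obtain ⟨i, rfl⟩ := Nat.exists_eq_add_of_le h1
      rw [Nat.add_sub_cancel_left]
      exact (key' i (by omega)).2
  · intro t₁ hT z z' ξ hξ y v y' v' h h'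
    obtain ⟨N, hN⟩ := Nat.exists_eq_add_of_le hT
    rw [hN] at h h' hξ ⊢
    obtain ⟨p, hp, hpT⟩ := h.exists_isKKT_terminal (hS.costsOn hN.ge) hS.FT (Nat.le_add_right _ _)
    obtain ⟨p', hp', hpT'⟩ :=
      h'.exists_isKKT_terminal (hS.costsOn hN.ge) hS.FT (Nat.le_add_right _ _)
    rw [isFTOCPSolution_terminal_iff] at h h'
    have key := energy_le_of_isKKT_terminal hμ hℓ hσ ha hb hS hN.symm hp hp' hpT hpT'
      (c := fun t => S.w t (ξ t)) (c' := fun t => S.w t (ξ t)) h.1.2 h'.1.2 hgap'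
    rw [h.1.1, h'.1.1] at key
    -- The terminal state enters as one more entry, with zero in place of an action, so that the
    -- bound also covers time `T`.
    have key' := decay (N := N + 1) (X := fun i => ‖y (t₁ + i) - y' (t₁ + i)‖)
      (U := fun i => if i < N then ‖v (t₁ + i) - v' (t₁ + i)‖ else 0) (norm_nonneg (z - z')) (by
        rw [Finset.sum_range_succ]
        refine le_trans (le_of_eq ?_) (key.trans (by simp [G, K]))
        congr 1
        · exact Finset.sum_congr rfl fun i hi => by simp [Finset.mem_range.1 hi]
        · simp)
    refine ⟨fun t h1 h2 => ?_, fun t h1 h2 => ?_⟩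
    · obtain ⟨i, rfl⟩ := Nat.exists_eq_add_of_le h1
      rw [Nat.add_sub_cancel_left]
      exact (key' i (by omega)).1
    · obtain ⟨i, rfl⟩ := Nat.exists_eq_add_of_le h1
      rw [Nat.add_sub_cancel_left]
      have := (key' i (by omega)).2
      rwa [if_pos (show i < N by omega)] at this

end Problem

namespace Problem

variable {n m : ℕ} {S : Problem n m} {μ ℓ : ℝ} {d : ℕ} {σ a b b' Lw Dw : ℝ}
  {t₁ t₂ : ℕ} {z : E n} {ξ : ∀ t, E (S.r t)}

/-! ### Existence of solutions -/

lemma isFTOCPTrajectory_rollout (t₁ t₂ : ℕ) (z : E n) (ξ : ∀ t, E (S.r t)) (ω : ℕ → E m) :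
    S.IsFTOCPTrajectory t₁ t₂ z ξ (rollout S.A S.B (fun t => S.w t (ξ t)) t₁ z ω) ω :=
  ⟨rollout_of_le _ _ _ le_rfl _ _, fun _ h _ => rollout_succ _ _ _ h _ _⟩

lemma IsFTOCPTrajectory.eq_rollout {y : ℕ → E n} {v ω : ℕ → E m}
    (h : S.IsFTOCPTrajectory t₁ t₂ z ξ y v) (hω : ∀ t, t₁ ≤ t → t < t₂ → ω t = v t) {t : ℕ}
    (h1 : t₁ ≤ t) (h2 : t ≤ t₂) : y t = rollout S.A S.B (fun t => S.w t (ξ t)) t₁ z ω t := by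
  induction t, h1 using Nat.le_induction with
  | base => rw [h.1, rollout_of_le _ _ _ le_rfl]
  | succ t h1 ih =>
    rw [h.2 t h1 h2, rollout_succ _ _ _ h1, ← ih (by omega), hω t h1 h2, g]

lemma stageCost_congr {y y' : ℕ → E n} {v v' : ℕ → E m} (hy : ∀ t, t₁ ≤ t → t < t₂ → y t = y' t)
    (hv : ∀ t, t₁ ≤ t → t < t₂ → v t = v' t) : S.stageCost t₁ t₂ y v = S.stageCost t₁ t₂ y' v' :=
  Finset.sum_congr rfl fun t ht => by
    obtain ⟨h1, h2⟩ := Finset.mem_Ico.1 ht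
    rw [hy t h1 h2, hv t h1 h2]

lemma continuous_extendActions (t p : ℕ) :
    Continuous fun ω : PiLp 2 fun _ : Fin p => E m => extendActions t ω := by
  refine continuous_pi fun s => ?_
  unfold extendActions
  split_ifs
  · fun_prop
  · exact continuous_const

/-- A trajectory of minimal cost exists among those that end in a closed set. -/
lemma exists_minimizer (hμ : 0 < μ) (hf : S.CostsOn μ ℓ t₁ t₂) (h12 : t₁ ≤ t₂) {F : E n → ℝ}
    (hF : Continuous F) (hF0 : ∀ x, 0 ≤ F x) {Z : Set (E n)} (hZ : IsClosed Z)
    (hne : ∃ y v, S.IsFTOCPTrajectory t₁ t₂ z ξ y v ∧ y t₂ ∈ Z) :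
    ∃ y v, S.IsFTOCPTrajectory t₁ t₂ z ξ y v ∧ y t₂ ∈ Z ∧
      ∀ y' v', S.IsFTOCPTrajectory t₁ t₂ z ξ y' v' → y' t₂ ∈ Z →
        S.stageCost t₁ t₂ y v + F (y t₂) ≤ S.stageCost t₁ t₂ y' v' + F (y' t₂) := by
  obtain ⟨N, rfl⟩ := Nat.exists_eq_add_of_le h12
  set R : (PiLp 2 fun _ : Fin N => E m) → ℕ → E n := fun ω =>
    rollout S.A S.B (fun t => S.w t (ξ t)) t₁ z (extendActions t₁ ω) with hR
  have hRc : ∀ t, Continuous fun ω => R ω t := fun t =>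
    (continuous_rollout S.A S.B _ t₁ t z).comp (continuous_extendActions t₁ N)
  set J : (PiLp 2 fun _ : Fin N => E m) → ℝ := fun ω =>
    S.stageCost t₁ (t₁ + N) (R ω) (extendActions t₁ ω) + F (R ω (t₁ + N)) with hJ
  have hext : ∀ v : ℕ → E m, ∀ t, t₁ ≤ t → t < t₁ + N →
      extendActions t₁ (WithLp.toLp 2 fun i : Fin N => v (t₁ + i)) t = v t := by
    intro v t h1 h2
    obtain ⟨i, rfl⟩ := Nat.exists_eq_add_of_le h1
    exact extendActions_add t₁ _ ⟨i, by omega⟩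
  have hend : ∀ y v, S.IsFTOCPTrajectory t₁ (t₁ + N) z ξ y v → ∀ t, t₁ ≤ t → t ≤ t₁ + N →
      R (WithLp.toLp 2 fun i : Fin N => v (t₁ + i)) t = y t := fun y v h t h1 h2 =>
    (h.eq_rollout (hext v) h1 h2).symm
  have hJe : ∀ y v, S.IsFTOCPTrajectory t₁ (t₁ + N) z ξ y v →
      J (WithLp.toLp 2 fun i : Fin N => v (t₁ + i)) =
        S.stageCost t₁ (t₁ + N) y v + F (y (t₁ + N)) := by
    intro y v h
    simp only [J]
    rw [hend y v h _ (by omega) le_rfl, stageCost_congr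
      (fun t h1 h2 => hend y v h t h1 h2.le) (hext v)]
  have hJc : Continuous J := by
    refine Continuous.add ?_ (hF.comp (hRc _))
    refine continuous_finsetSum _ fun t ht => ?_
    obtain ⟨h1, h2⟩ := Finset.mem_Ico.1 ht
    exact ((hf t h1 h2).1.continuous.comp (hRc t)).add ((hf t h1 h2).2.continuous.comp
      ((continuous_apply t).comp (continuous_extendActions t₁ N)))
  -- Coercivity comes from the action costs alone, since the actions determine the states and all
  -- other costs are nonnegative.
  have hlow : ∀ ω, μ / 2 * ‖ω‖ ^ 2 ≤ J ω := by
    intro ω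
    rw [PiLp.norm_sq_eq_of_L2, Finset.mul_sum]
    refine le_trans ?_ (le_add_of_nonneg_right (hF0 _))
    unfold stageCost
    rw [Finset.sum_Ico_eq_sum_range, Nat.add_sub_cancel_left,
      ← Fin.sum_univ_eq_sum_range (fun k => S.fx (t₁ + k) (R ω (t₁ + k)) +
        S.fu (t₁ + k) (extendActions t₁ ω (t₁ + k))) N]
    refine Finset.sum_le_sum fun i _ => ?_
    have hi := hf (t₁ + i) (by omega) (by omega)
    rw [extendActions_add]
    have := hi.1.nonneg (R ω (t₁ + i))
    have := hi.2.quadratic_lower (ω i)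
    linarith
  have hcoer : Filter.Tendsto J (Filter.cocompact _) Filter.atTop := by
    refine Filter.tendsto_atTop_mono hlow ?_
    exact Filter.Tendsto.const_mul_atTop (by positivity)
      ((Filter.tendsto_pow_atTop two_ne_zero).comp (tendsto_norm_cocompact_atTop))
  obtain ⟨y₀, v₀, h0, h0Z⟩ := hne
  have hcl : IsClosed {ω | R ω (t₁ + N) ∈ Z} := hZ.preimage (hRc _)
  obtain ⟨ω, hωZ, hmin⟩ := hJc.continuousOn.exists_isMinOn' hcl
    (x₀ := WithLp.toLp 2 fun i : Fin N => v₀ (t₁ + i))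
    (by rw [Set.mem_ofPred_eq, hend y₀ v₀ h0 _ (by omega) le_rfl]; exact h0Z)
    ((hcoer.eventually_ge_atTop _).filter_mono inf_le_left)
  refine ⟨R ω, extendActions t₁ ω, isFTOCPTrajectory_rollout _ _ _ _ _, hωZ, ?_⟩
  intro y' v' h' hZ'
  rw [← hJe y' v' h']
  exact hmin (by rw [Set.mem_ofPred_eq, hend y' v' h' _ (by omega) le_rfl]; exact hZ')

lemma exists_solution_terminal (hμ : 0 < μ) (hf : S.CostsOn μ ℓ t₁ t₂)
    (hF : IsWellConditioned μ ℓ S.FT) (h12 : t₁ ≤ t₂) (z : E n) (ξ : ∀ t, E (S.r t)) :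
    ∃ y v, S.IsFTOCPSolution t₁ t₂ z ξ S.terminalCost y v := by
  obtain ⟨y, v, h, -, hm⟩ := exists_minimizer (z := z) (ξ := ξ) hμ hf h12 hF.continuous hF.nonneg
    isClosed_univ ⟨_, _, isFTOCPTrajectory_rollout t₁ t₂ z ξ 0, Set.mem_univ _⟩
  exact ⟨y, v, isFTOCPSolution_terminal_iff.2 ⟨h, fun y' v' h' => hm y' v' h' (Set.mem_univ _)⟩⟩

/-- The system coasts with zero actions until `d` steps before the end; surjectivity of the last
controllability matrix then corrects the final state. -/
lemma exists_trajectory_to (hS : S.Assumptions μ ℓ d σ a b b' Lw Dw) (h12 : t₁ + d ≤ t₂)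
    (hT : t₂ ≤ S.T) (z ζ : E n) (ξ : ∀ t, E (S.r t)) :
    ∃ y v, S.IsFTOCPTrajectory t₁ t₂ z ξ y v ∧ y t₂ = ζ := by
  obtain ⟨s, rfl⟩ : ∃ s, t₂ = s + d := ⟨t₂ - d, by omega⟩
  obtain ⟨ω, hω⟩ := surjective_of_sigmaMin_pos _ (hS.controllable.1.1.2 s hT)
    (ζ - rollout S.A S.B (fun t => S.w t (ξ t)) t₁ z 0 (s + d))
  refine ⟨_, _, isFTOCPTrajectory_rollout t₁ (s + d) z ξ (0 + extendActions s ω), ?_⟩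
  rw [rollout_add, response_eq_of_zero_before _ _ (show t₁ ≤ s by omega)
    (fun t ht => extendActions_of_lt ω ht), ← controllabilityMatrix_eq_response, hω]
  abel

lemma exists_solution_indicator (hμ : 0 < μ) (hS : S.Assumptions μ ℓ d σ a b b' Lw Dw)
    (h12 : t₁ + d ≤ t₂) (hT : t₂ ≤ S.T) (z ζ : E n) (ξ : ∀ t, E (S.r t)) :
    ∃ y v, S.IsFTOCPSolution t₁ t₂ z ξ (indicatorCost ζ) y v := by
  obtain ⟨y, v, h, hζ, hm⟩ := exists_minimizer (z := z) (ξ := ξ) hμ (hS.costsOn hT)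
    (show t₁ ≤ t₂ by omega) (F := 0) continuous_const (fun _ => le_rfl)
    (isClosed_singleton (x := ζ)) (exists_trajectory_to hS h12 hT z ζ ξ)
  exact ⟨y, v, isFTOCPSolution_indicator_iff.2 ⟨h, hζ, fun y' v' h' hζ' => by
    simpa using hm y' v' h' hζ'⟩⟩

/-! ### The principle of optimality -/

/-- Concatenation of sequences at time `s`. -/
def splice {α : Type*} (s : ℕ) (f f' : ℕ → α) (t : ℕ) : α := if t < s then f t else f' t

lemma splice_of_lt {α : Type*} {s t : ℕ} (f f' : ℕ → α) (h : t < s) : splice s f f' t = f t :=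
  if_pos h

lemma splice_of_ge {α : Type*} {s t : ℕ} (f f' : ℕ → α) (h : s ≤ t) : splice s f f' t = f' t :=
  if_neg (by omega)

lemma IsFTOCPTrajectory.splice {s : ℕ} {y y' : ℕ → E n} {v v' : ℕ → E m} (h1 : t₁ ≤ s)
    (h : S.IsFTOCPTrajectory t₁ s z ξ y v) (h' : S.IsFTOCPTrajectory s t₂ (y s) ξ y' v') :
    S.IsFTOCPTrajectory t₁ t₂ z ξ (splice s y y') (splice s v v') := by
  constructor
  · rcases h1.eq_or_lt with rfl | h1
    · rw [splice_of_ge _ _ le_rfl, h'.1, h.1]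
    · rw [splice_of_lt _ _ h1, h.1]
  · intro t ht ht2
    rcases lt_trichotomy (t + 1) s with hs | hs | hs
    · rw [splice_of_lt _ _ hs, splice_of_lt _ _ (by omega), splice_of_lt _ _ (by omega),
        h.2 t ht (by omega)]
    · rw [splice_of_ge _ _ hs.ge, splice_of_lt _ _ (by omega), splice_of_lt _ _ (by omega), hs,
        h'.1, ← hs, h.2 t ht (by omega)]
    · rw [splice_of_ge _ _ hs.le, splice_of_ge _ _ (by omega), splice_of_ge _ _ (by omega),
        h'.2 t (by omega) ht2]

lemma stageCost_add {s : ℕ} (h1 : t₁ ≤ s) (h2 : s ≤ t₂) (y : ℕ → E n) (v : ℕ → E m) :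
    S.stageCost t₁ s y v + S.stageCost s t₂ y v = S.stageCost t₁ t₂ y v :=
  Finset.sum_Ico_consecutive _ h1 h2

lemma stageCost_splice {s : ℕ} (h1 : t₁ ≤ s) (h2 : s ≤ t₂) (y y' : ℕ → E n) (v v' : ℕ → E m) :
    S.stageCost t₁ t₂ (splice s y y') (splice s v v') =
      S.stageCost t₁ s y v + S.stageCost s t₂ y' v' := by
  rw [← stageCost_add h1 h2]
  congr 1
  · exact stageCost_congr (fun t _ h => splice_of_lt _ _ h) (fun t _ h => splice_of_lt _ _ h)
  · exact stageCost_congr (fun t h _ => splice_of_ge _ _ h) (fun t h _ => splice_of_ge _ _ h)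

lemma IsFTOCPTrajectory.head {s : ℕ} {y : ℕ → E n} {v : ℕ → E m}
    (h : S.IsFTOCPTrajectory t₁ t₂ z ξ y v) (h2 : s ≤ t₂) : S.IsFTOCPTrajectory t₁ s z ξ y v :=
  ⟨h.1, fun t ht ht2 => h.2 t ht (by omega)⟩

lemma IsFTOCPTrajectory.tail {s : ℕ} {y : ℕ → E n} {v : ℕ → E m}
    (h : S.IsFTOCPTrajectory t₁ t₂ z ξ y v) (h1 : t₁ ≤ s) : S.IsFTOCPTrajectory s t₂ (y s) ξ y v :=
  ⟨rfl, fun t ht ht2 => h.2 t (by omega) ht2⟩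

lemma IsFTOCPSolution.tail {s : ℕ} {y : ℕ → E n} {v : ℕ → E m}
    (h : S.IsFTOCPSolution t₁ t₂ z ξ S.terminalCost y v) (h1 : t₁ ≤ s) (h2 : s ≤ t₂) :
    S.IsFTOCPSolution s t₂ (y s) ξ S.terminalCost y v := by
  rw [isFTOCPSolution_terminal_iff] at h ⊢
  refine ⟨h.1.tail h1, fun y' v' h' => ?_⟩
  have := h.2 _ _ ((h.1.head h2).splice h1 h')
  rw [stageCost_splice h1 h2, ← stageCost_add h1 h2, splice_of_ge _ _ h2] at this
  linarith

/-- A cheaper way to reach the same intermediate state could be spliced onto the rest of the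
trajectory. Optimal solutions thus become comparable with MPC's problems, whose terminal cost is an
indicator. -/
lemma IsFTOCPSolution.head {s : ℕ} {y : ℕ → E n} {v : ℕ → E m}
    (h : S.IsFTOCPSolution t₁ t₂ z ξ S.terminalCost y v) (h1 : t₁ ≤ s) (h2 : s ≤ t₂) :
    S.IsFTOCPSolution t₁ s z ξ (indicatorCost (y s)) y v := by
  rw [isFTOCPSolution_terminal_iff] at h
  rw [isFTOCPSolution_indicator_iff]
  refine ⟨h.1.head h2, rfl, fun y' v' h' hs => ?_⟩
  have := h.2 _ _ (h'.splice h1 (hs ▸ h.1.tail h1))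
  rw [stageCost_splice h1 h2, ← stageCost_add h1 h2, splice_of_ge _ _ h2] at this
  linarith

/-! ### Properties of optimal trajectories -/

/-- Replacing the action by `0` changes one summand only, and the quadratic lower bound makes the
change strictly favourable unless the action was already zero. -/
lemma action_eq_zero_of_stageCost_le (hμ : 0 < μ) (hf : S.CostsOn μ ℓ t₁ t₂) {y : ℕ → E n}
    {v : ℕ → E m} {t : ℕ} (h1 : t₁ ≤ t) (h2 : t < t₂)
    (h : S.stageCost t₁ t₂ y v ≤ S.stageCost t₁ t₂ y (Function.update v t 0)) : v t = 0 := by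
  have hmem : t ∈ Finset.Ico t₁ t₂ := Finset.mem_Ico.2 ⟨h1, h2⟩
  unfold stageCost at h
  rw [← Finset.add_sum_erase _ _ hmem, ← Finset.add_sum_erase _ _ hmem,
    Function.update_self, (hf t h1 h2).2.zero] at h
  have he : ∑ s ∈ (Finset.Ico t₁ t₂).erase t, (S.fx s (y s) + S.fu s (Function.update v t 0 s)) =
      ∑ s ∈ (Finset.Ico t₁ t₂).erase t, (S.fx s (y s) + S.fu s (v s)) :=
    Finset.sum_congr rfl fun s hs => by rw [Function.update_of_ne (Finset.ne_of_mem_erase hs)]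
  rw [he] at h
  have hq := (hf t h1 h2).2.quadratic_lower (v t)
  have : ‖v t‖ ^ 2 ≤ 0 := by nlinarith
  exact norm_eq_zero.1 (pow_eq_zero_iff two_ne_zero |>.1 (le_antisymm this (sq_nonneg _)))

lemma IsFTOCPTrajectory.update {y : ℕ → E n} {v : ℕ → E m}
    (h : S.IsFTOCPTrajectory t₁ t₂ z ξ y v) {t : ℕ} (hB : S.B t = 0) (u : E m) :
    S.IsFTOCPTrajectory t₁ t₂ z ξ y (Function.update v t u) := by
  refine ⟨h.1, fun s h1 h2 => ?_⟩
  rw [h.2 s h1 h2, g, g]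
  rcases eq_or_ne s t with rfl | hs
  · simp [hB]
  · rw [Function.update_of_ne hs]

lemma IsFTOCPSolution.action_eq_zero_terminal (hμ : 0 < μ) (hf : S.CostsOn μ ℓ t₁ t₂)
    {y : ℕ → E n} {v : ℕ → E m} (h : S.IsFTOCPSolution t₁ t₂ z ξ S.terminalCost y v) {t : ℕ}
    (h1 : t₁ ≤ t) (h2 : t < t₂) (hB : S.B t = 0) : v t = 0 := by
  rw [isFTOCPSolution_terminal_iff] at h
  have := h.2 _ _ (h.1.update hB 0)
  exact action_eq_zero_of_stageCost_le hμ hf h1 h2 (by linarith)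

lemma IsFTOCPSolution.action_eq_zero_indicator (hμ : 0 < μ) (hf : S.CostsOn μ ℓ t₁ t₂) {ζ : E n}
    {y : ℕ → E n} {v : ℕ → E m} (h : S.IsFTOCPSolution t₁ t₂ z ξ (indicatorCost ζ) y v) {t : ℕ}
    (h1 : t₁ ≤ t) (h2 : t < t₂) (hB : S.B t = 0) : v t = 0 := by
  rw [isFTOCPSolution_indicator_iff] at h
  exact action_eq_zero_of_stageCost_le hμ hf h1 h2 (h.2.2 _ _ (h.1.update hB 0) h.2.1)

lemma cost_eq_stageCost (x : ℕ → E n) (u : ℕ → E m) :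
    S.cost x u = S.stageCost 0 S.T x u + S.FT (x S.T) := by
  rw [cost, stageCost, Finset.range_eq_Ico]

/-- The cost of a trajectory exceeds the optimal cost by at most the squared distance: the
first-order term vanishes. -/
lemma cost_sub_cost_le (hμ : 0 < μ) (hS : S.Assumptions μ ℓ d σ a b b' Lw Dw) {x₀ : E n}
    {xs x : ℕ → E n} {us u : ℕ → E m} (hopt : S.IsOPT x₀ ξ xs us)
    (h : S.IsFTOCPTrajectory 0 S.T x₀ ξ x u) :
    S.cost x u - S.cost xs us ≤ ℓ * (∑ t ∈ Finset.range S.T,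
      (‖x t - xs t‖ ^ 2 + ‖u t - us t‖ ^ 2) + ‖x S.T - xs S.T‖ ^ 2) := by
  have htr := (isFTOCPSolution_terminal_iff.1 hopt).1
  have hfo := first_order_terminal (hS.costsOn le_rfl) hS.FT hopt
    (η := fun t => x t - xs t) (ω := fun t => u t - us t) (by simp [h.1, htr.1])
    (fun t h1 h2 => by
      simp only [h.2 t h1 h2, htr.2 t h1 h2, g, map_sub]
      abel)
  have hF := hS.FT.quadratic_upper hμ.le (xs S.T) (x S.T)
  have hsum : S.stageCost 0 S.T x u - S.stageCost 0 S.T xs us ≤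
      ∑ t ∈ Finset.Ico 0 S.T, (inner ℝ (gradient (S.fx t) (xs t)) (x t - xs t) +
        inner ℝ (gradient (S.fu t) (us t)) (u t - us t)) +
      ℓ * ∑ t ∈ Finset.Ico 0 S.T, (‖x t - xs t‖ ^ 2 + ‖u t - us t‖ ^ 2) := by
    unfold stageCost
    rw [← Finset.sum_sub_distrib, Finset.mul_sum, ← Finset.sum_add_distrib]
    apply Finset.sum_le_sum
    intro t ht
    have hT := (Finset.mem_Ico.1 ht).2
    have h1 := (hS.fx t hT).quadratic_upper hμ.le (xs t) (x t)
    have h2 := (hS.fu t hT).quadratic_upper hμ.le (us t) (u t)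
    linarith
  rw [cost_eq_stageCost, cost_eq_stageCost, Finset.range_eq_Ico]
  linarith

/-- The optimal states are bounded in mean square. -/
lemma sum_sq_opt_le (hμ : 0 < μ) (hℓ : 0 < ℓ) (hσ : 0 < σ) (ha : 0 < a) (hb : 0 < b)
    (hS : S.Assumptions μ ℓ d σ a b b' Lw Dw) (hξ : ∀ t < S.T, ξ t ∈ S.Ξ t) {x₀ : E n}
    {xs : ℕ → E n} {us : ℕ → E m} (hopt : S.IsOPT x₀ ξ xs us) :
    ∑ t ∈ Finset.range S.T, ‖xs t‖ ^ 2 ≤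
      energyGain μ d (costateGain ℓ d σ a b) * (‖x₀‖ ^ 2 + S.T * Dw ^ 2) := by
  obtain ⟨p, hp, hpT⟩ := hopt.exists_isKKT_terminal (hS.costsOn le_rfl) hS.FT (Nat.zero_le _)
  have htr := (isFTOCPSolution_terminal_iff.1 hopt).1
  -- The zero trajectory is a KKT point of the undisturbed system. Comparing the optimum with it
  -- under the constant weight `ρ = 1` bounds the optimal states by the initial state and the
  -- disturbances.
  have h0 : S.IsKKT 0 S.T (fun _ => 0) (fun _ => 0) (fun _ => 0) :=
    ⟨fun t _ ht => by simp [(hS.fx t ht).gradient_zero],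
      fun t _ ht => by simp [(hS.fu t ht).gradient_zero]⟩
  have hK : 0 ≤ costateGain ℓ d σ a b := costateGain_nonneg
  have key := energy_le_of_isKKT_terminal (t₁ := 0) (N := S.T) (ρ := 1) (c := fun t => S.w t (ξ t))
    (c' := fun _ => 0) (y := xs) (v := us) (p := p) (y' := fun _ => 0) (v' := fun _ => 0)
    (p' := fun _ => 0) hμ hℓ hσ ha hb hS (Nat.zero_add _) (by rwa [Nat.zero_add])
    (by rwa [Nat.zero_add]) (by rwa [Nat.zero_add]) (by simp [hS.FT.gradient_zero])
    (by rw [Nat.zero_add]; exact htr.2) (by simp)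
    (by simpa using (ratioGap_pos hμ hK).le)
  simp only [one_pow, one_mul, Nat.zero_add, sub_zero, htr.1] at key
  have h1 : ∑ t ∈ Finset.range S.T, ‖S.w (0 + t) (ξ (0 + t))‖ ^ 2 ≤ S.T * Dw ^ 2 := by
    calc _ ≤ ∑ t ∈ Finset.range S.T, Dw ^ 2 := by
          apply Finset.sum_le_sum
          intro t ht
          have ht' : 0 + t < S.T := by simpa using ht
          exact pow_le_pow_left₀ (norm_nonneg _) (hS.norm_w _ ht' _ (hξ _ ht')) 2
      _ = _ := by simp
  have h2 : ∑ t ∈ Finset.range S.T, ‖xs t‖ ^ 2 ≤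
      ∑ t ∈ Finset.range S.T, (‖xs t‖ ^ 2 + ‖us t‖ ^ 2) :=
    Finset.sum_le_sum fun t _ => le_add_of_nonneg_right (sq_nonneg _)
  have hG : 0 ≤ energyGain μ d (costateGain ℓ d σ a b) := energyGain_nonneg hK
  calc _ ≤ _ := h2
    _ ≤ _ := le_add_of_nonneg_right (sq_nonneg ‖xs S.T‖)
    _ ≤ _ := key
    _ ≤ _ := by gcongr

end Problem

/-! ### Discounted sums -/

/-- The discounted sum `∑ s < t, lam ^ (t - 1 - s) * e s`. -/
def discounted (lam : ℝ) (e : ℕ → ℝ) : ℕ → ℝ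
  | 0 => 0
  | t + 1 => lam * discounted lam e t + e t

/-- Convexity of the square gives `(lam * x + e) ^ 2 ≤ lam * x ^ 2 + e ^ 2 / (1 - lam)`; summing
lets the discounted part be absorbed on the left. -/
lemma sum_discounted_sq_le {lam : ℝ} (h0 : 0 < lam) (h1 : lam < 1) (e : ℕ → ℝ) (T : ℕ) :
    ∑ t ∈ Finset.range (T + 1), discounted lam e t ^ 2 ≤
      (∑ t ∈ Finset.range T, e t ^ 2) / (1 - lam) ^ 2 := by
  have hl : 0 < 1 - lam := by linarith
  have hstep : ∀ t, discounted lam e (t + 1) ^ 2 ≤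
      lam * discounted lam e t ^ 2 + e t ^ 2 / (1 - lam) := by
    intro t
    set x := discounted lam e t
    have : lam * x ^ 2 + e t ^ 2 / (1 - lam) - (lam * x + e t) ^ 2 =
        lam / (1 - lam) * ((1 - lam) * x - e t) ^ 2 := by
      field_simp; ring
    have h2 : 0 ≤ lam / (1 - lam) * ((1 - lam) * x - e t) ^ 2 := by positivity
    simp only [discounted]
    linarith
  have hsum : ∑ t ∈ Finset.range (T + 1), discounted lam e t ^ 2 ≤
      lam * ∑ t ∈ Finset.range (T + 1), discounted lam e t ^ 2 +
        (∑ t ∈ Finset.range T, e t ^ 2) / (1 - lam) := by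
    nth_rw 1 [Finset.sum_range_succ']
    rw [Finset.sum_range_succ]
    have h3 : ∑ t ∈ Finset.range T, discounted lam e (t + 1) ^ 2 ≤
        lam * ∑ t ∈ Finset.range T, discounted lam e t ^ 2 +
          (∑ t ∈ Finset.range T, e t ^ 2) / (1 - lam) := by
      rw [Finset.mul_sum, Finset.sum_div, ← Finset.sum_add_distrib]
      exact Finset.sum_le_sum fun t _ => hstep t
    have h4 : discounted lam e 0 = 0 := rfl
    rw [h4]
    nlinarith [mul_nonneg h0.le (sq_nonneg (discounted lam e T))]
  rw [le_div_iff₀ (by positivity)]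
  rw [← sub_le_iff_le_add', le_div_iff₀ hl] at hsum
  linarith

lemma geom_sum_le {lam : ℝ} (h0 : 0 < lam) (h1 : lam < 1) (k : ℕ) :
    ∑ i ∈ Finset.range k, lam ^ i ≤ 1 / (1 - lam) := by
  rw [le_div_iff₀ (by linarith), geom_sum_mul_neg]
  linarith [pow_pos h0 k]

lemma sq_geom_weighted_sum_le {lam : ℝ} (h0 : 0 < lam) (h1 : lam < 1) (k : ℕ) (r : ℕ → ℝ) :
    (∑ i ∈ Finset.range k, lam ^ i * r i) ^ 2 ≤
      (∑ i ∈ Finset.range k, lam ^ i * r i ^ 2) / (1 - lam) := by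
  have h := Finset.sum_sq_le_sum_mul_sum_of_sq_le_mul (Finset.range k)
    (r := fun i => lam ^ i * r i) (f := fun i => lam ^ i) (g := fun i => lam ^ i * r i ^ 2)
    (fun i _ => by positivity) (fun i _ => by positivity) (fun i _ => le_of_eq (by ring))
  refine h.trans ?_
  rw [div_eq_mul_one_div, mul_comm]
  exact mul_le_mul_of_nonneg_left (geom_sum_le h0 h1 k)
    (Finset.sum_nonneg fun i _ => by positivity)

/-- The per-step errors are controlled by the prediction errors and the terminal states if the
feedback of earlier errors is weak. -/
lemma sum_error_sq_le {lam H Lg : ℝ} (h0 : 0 < lam) (h1 : lam < 1) (hH : 1 ≤ H) (hLg : 0 < Lg)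
    {T k : ℕ} (hk : 4 * H ^ 3 * Lg * lam ^ k ≤ (1 - lam) ^ 2) {e χ : ℕ → ℝ} {r : ℕ → ℕ → ℝ}
    (he0 : ∀ t, 0 ≤ e t)
    (he : ∀ t < T, e t ≤ H * ∑ τ ∈ Finset.range k, lam ^ τ * r t τ + H * lam ^ k * χ t +
      H ^ 2 * lam ^ (2 * k) * (H * Lg * discounted lam e t)) :
    ∑ t ∈ Finset.range T, e t ^ 2 ≤ 6 * H ^ 2 *
      ((∑ t ∈ Finset.range T, ∑ τ ∈ Finset.range k, lam ^ τ * r t τ ^ 2) / (1 - lam) +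
        lam ^ (2 * k) * ∑ t ∈ Finset.range T, χ t ^ 2) := by
  have hl : 0 < 1 - lam := by linarith
  set Q := ∑ t ∈ Finset.range T, e t ^ 2 with hQ
  have hQ0 : 0 ≤ Q := Finset.sum_nonneg fun _ _ => sq_nonneg _
  set β := H ^ 2 * lam ^ (2 * k) * (H * Lg) with hβ
  have hβ0 : 0 ≤ β := by positivity
  -- Four times `β` is the lookahead quantity times another `lam ^ k`, hence at most `(1 - lam) ^ 2
  -- ≤ 1 - lam`.
  have hβ1 : β ≤ (1 - lam) / 4 := by
    have hp : lam ^ k ≤ 1 := pow_le_one₀ h0.le h1.le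
    have hp0 : 0 < lam ^ k := pow_pos h0 k
    have e1 : 4 * β = (4 * H ^ 3 * Lg * lam ^ k) * lam ^ k := by rw [hβ]; ring
    have e2 : (4 * H ^ 3 * Lg * lam ^ k) * lam ^ k ≤ (1 - lam) ^ 2 * 1 :=
      mul_le_mul hk hp hp0.le (by positivity)
    nlinarith
  have hpt : ∀ t ∈ Finset.range T, e t ^ 2 ≤
      3 * H ^ 2 * ((∑ τ ∈ Finset.range k, lam ^ τ * r t τ ^ 2) / (1 - lam)) +
      3 * H ^ 2 * lam ^ (2 * k) * χ t ^ 2 + 3 * β ^ 2 * discounted lam e t ^ 2 := by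
    intro t ht
    have hh := he t (Finset.mem_range.1 ht)
    have hs := sq_geom_weighted_sum_le h0 h1 k (r t)
    set X := ∑ τ ∈ Finset.range k, lam ^ τ * r t τ
    have h2 : e t ^ 2 ≤ (H * X + H * lam ^ k * χ t +
      H ^ 2 * lam ^ (2 * k) * (H * Lg * discounted lam e t)) ^ 2 :=
      pow_le_pow_left₀ (he0 t) hh 2
    have h3 : ∀ x y z : ℝ, (x + y + z) ^ 2 ≤ 3 * x ^ 2 + 3 * y ^ 2 + 3 * z ^ 2 := fun x y z => by
      nlinarith [sq_nonneg (x - y), sq_nonneg (x - z), sq_nonneg (y - z)]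
    calc e t ^ 2 ≤ _ := h2
      _ ≤ _ := h3 _ _ _
      _ = 3 * H ^ 2 * X ^ 2 + 3 * H ^ 2 * lam ^ (2 * k) * χ t ^ 2 +
          3 * β ^ 2 * discounted lam e t ^ 2 := by rw [hβ, pow_mul']; ring
      _ ≤ _ := by gcongr
  have hsum := Finset.sum_le_sum hpt
  rw [Finset.sum_add_distrib, Finset.sum_add_distrib, ← Finset.mul_sum, ← Finset.mul_sum,
    ← Finset.mul_sum, ← Finset.sum_div] at hsum
  have hD : ∑ t ∈ Finset.range T, discounted lam e t ^ 2 ≤ Q / (1 - lam) ^ 2 := by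
    refine le_trans ?_ (sum_discounted_sq_le h0 h1 e T)
    rw [Finset.sum_range_succ]
    linarith [sq_nonneg (discounted lam e T)]
  -- The factors `1 - lam` cancel, and the feedback returns at most half of `Q`, which is absorbed
  -- on the left and doubles the constant `3 * H ^ 2`.
  have hfb : 3 * β ^ 2 * ∑ t ∈ Finset.range T, discounted lam e t ^ 2 ≤ Q / 2 := by
    calc _ ≤ 3 * ((1 - lam) / 4) ^ 2 * (Q / (1 - lam) ^ 2) := by gcongr
      _ = 3 / 16 * Q := by field_simp; ring
      _ ≤ Q / 2 := by linarith
  linarith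

/-! ### Tracking error of MPC. -/

namespace Problem

variable {n m : ℕ} {S : Problem n m} {μ ℓ : ℝ} {d : ℕ} {σ a b b' Lw Dw : ℝ}
  {ξs : ∀ t, E (S.r t)} {ξp : ℕ → ∀ s, E (S.r s)} {k : ℕ} {x₀ : E n} {H lam Lg : ℝ}

lemma predPower_nonneg (τ : ℕ) : 0 ≤ S.predPower ξs ξp τ :=
  Finset.sum_nonneg fun _ _ => sq_nonneg _

/-- The prediction error, cut off beyond the horizon. -/
def cutError (S : Problem n m) (ξs : ∀ t, E (S.r t)) (ξp : ℕ → ∀ s, E (S.r s)) (t τ : ℕ) : ℝ :=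
  if t + τ < S.T then S.predError ξs ξp t τ else 0

lemma sum_cutError_sq_le (h0 : 0 < lam) :
    ∑ t ∈ Finset.range S.T, ∑ τ ∈ Finset.range k, lam ^ τ * S.cutError ξs ξp t τ ^ 2 ≤
      ∑ τ ∈ Finset.range k, lam ^ τ * S.predPower ξs ξp τ := by
  rw [Finset.sum_comm]
  refine Finset.sum_le_sum fun τ _ => ?_
  rw [← Finset.mul_sum, predPower, Finset.sum_filter]
  refine mul_le_mul_of_nonneg_left ?_ (by positivity)
  rw [Finset.sum_range_succ]
  refine le_trans ?_ (le_add_of_nonneg_right (by split_ifs <;> positivity))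
  refine Finset.sum_le_sum fun t _ => ?_
  unfold cutError
  split_ifs with h1 h2 h2
  · exact le_rfl
  · omega
  · rw [zero_pow two_ne_zero]; positivity
  · simp

/-- The distance of the MPC action from the optimal action at the current state. -/
lemma mpc_error_le (hS : S.PerturbationBounds d H lam) (h0 : 0 < lam) (hH : 0 ≤ H) (hkd : d ≤ k)
    (hξs : ∀ t ≤ S.T, ξs t ∈ S.Ξ t)
    (hξp : ∀ t s, t ≤ s → s ≤ min (t + k) S.T → ξp t s ∈ S.Ξ s)
    {t : ℕ} (ht : t < S.T) {x : E n} {y yo : ℕ → E n} {v vo : ℕ → E m}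
    (h : S.IsFTOCPSolution t (min (t + k) S.T) x (ξp t) (S.mpcTerminalCost k t) y v)
    (ho : S.IsFTOCPSolution t S.T x ξs S.terminalCost yo vo) :
    ‖v t - vo t‖ ≤ H * ∑ τ ∈ Finset.range k, lam ^ τ * S.cutError ξs ξp t τ +
      H * lam ^ k * (if t + k < S.T then ‖yo (t + k)‖ else 0) := by
  by_cases htk : t + k < S.T
  · have hmin : min (t + k) S.T = t + k := by omega
    rw [hmin, mpcTerminalCost, if_pos htk] at h
    -- By the principle of optimality the re-optimized solution, cut at `t + k`, is the solution
    -- with its own state there as target. It differs from MPC's problem only in the parameters and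
    -- in the target `0`.
    have h1 := hS.parameters_indicator t (t + k) (by omega) htk.le x 0 (yo (t + k)) (ξp t) ξs
      (fun s h1 h2 => hξp t s h1 (by omega)) (fun s h1 h2 => hξs s (by omega)) _ _ _ _ h
      (ho.head (by omega) htk.le)
    rw [if_pos htk]
    refine h1.trans (le_of_eq ?_)
    rw [Finset.sum_Ico_eq_sum_range, Nat.add_sub_cancel_left, zero_sub, norm_neg, Finset.mul_sum]
    congr 1
    refine Finset.sum_congr rfl fun τ hτ => ?_
    have := Finset.mem_range.1 hτ
    rw [Nat.add_sub_cancel_left, cutError, if_pos (by omega), predError, mul_assoc]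
  · have hmin : min (t + k) S.T = S.T := by omega
    rw [hmin, mpcTerminalCost, if_neg htk] at h
    have h1 := hS.parameters_terminal t ht x (ξp t) ξs
      (fun s h1 h2 => hξp t s h1 (by omega)) (fun s h1 h2 => hξs s (by omega)) _ _ _ _ h ho
    rw [if_neg htk, mul_zero, add_zero, Finset.mul_sum]
    refine h1.trans ?_
    rw [Finset.sum_Ico_eq_sum_range]
    calc _ = ∑ τ ∈ Finset.range (S.T - t), H * (lam ^ τ * S.cutError ξs ξp t τ) := by
          refine Finset.sum_congr rfl fun τ hτ => ?_
          have := Finset.mem_range.1 hτ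
          rw [Nat.add_sub_cancel_left, cutError, if_pos (by omega), predError, mul_assoc]
      _ ≤ _ := by
          refine Finset.sum_le_sum_of_subset_of_nonneg (Finset.range_mono (by omega)) ?_
          intro τ _ _
          have : 0 ≤ S.cutError ξs ξp t τ := by
            unfold cutError
            split_ifs
            · exact norm_nonneg _
            · exact le_rfl
          positivity

/-- Re-optimizing from the states of a trajectory: the distance to the optimal trajectory is
controlled by the discounted sum of the per-step errors. -/
lemma reoptimized_sub_le (hS : S.PerturbationBounds d H lam) (hH : 0 ≤ H) (h0 : 0 < lam)
    (hξs : ∀ t ≤ S.T, ξs t ∈ S.Ξ t)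
    (hLg : ∀ t < S.T, ∀ x u u', ‖S.g t x u (ξs t) - S.g t x u' (ξs t)‖ ≤ Lg * ‖u - u'‖)
    {xs x : ℕ → E n} {us u : ℕ → E m} (hopt : S.IsOPT x₀ ξs xs us)
    (htr : S.IsFTOCPTrajectory 0 S.T x₀ ξs x u) {Y : ℕ → ℕ → E n} {V : ℕ → ℕ → E m}
    (hY : ∀ s ≤ S.T, S.IsFTOCPSolution s S.T (x s) ξs S.terminalCost (Y s) (V s))
    {s t : ℕ} (hst : s ≤ t) (ht : t ≤ S.T) :
    ‖Y s t - xs t‖ ≤ H * Lg * (lam ^ (t - s) * discounted lam (fun r => ‖u r - V r r‖) s) := by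
  have hmem : ∀ t₁ t, t₁ ≤ t → t < S.T → ξs t ∈ S.Ξ t := fun _ t _ h => hξs t h.le
  induction s with
  | zero =>
    have h1 := (hS.initial_terminal 0 (Nat.zero_le _) _ _ ξs (hmem 0) _ _ _ _
      (hY 0 (Nat.zero_le _)) hopt).1 t hst ht
    rw [htr.1, sub_self, norm_zero, mul_zero] at h1
    simpa [discounted] using h1
  | succ s ih =>
    have h1 := ih (by omega)
    have hs : s < S.T := by omega
    have hYs := (isFTOCPSolution_terminal_iff.1 (hY s hs.le)).1
    -- The tail of the solution restarted at `s` and the solution restarted at `s + 1` solve the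
    -- same problem, with initial states that differ only through the error of the action at `s`.
    have h2 := (hS.initial_terminal (s + 1) hs _ _ ξs (hmem _) _ _ _ _ (hY (s + 1) hs)
      ((hY s hs.le).tail (Nat.le_succ s) hs)).1 t hst ht
    have h3 : ‖x (s + 1) - Y s (s + 1)‖ ≤ Lg * ‖u s - V s s‖ := by
      rw [htr.2 s (Nat.zero_le _) hs, hYs.2 s le_rfl hs, hYs.1]
      exact hLg s hs _ _ _
    have h4 : t - s = (t - (s + 1)) + 1 := by omega
    calc ‖Y (s + 1) t - xs t‖ ≤ ‖Y (s + 1) t - Y s t‖ + ‖Y s t - xs t‖ :=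
          norm_sub_le_norm_sub_add_norm_sub _ _ _
      _ ≤ H * lam ^ (t - (s + 1)) * (Lg * ‖u s - V s s‖) +
          H * Lg * (lam ^ (t - s) * discounted lam (fun r => ‖u r - V r r‖) s) :=
          add_le_add (h2.trans (by gcongr)) h1
      _ = _ := by rw [h4, pow_succ, discounted]; ring

/-- The distance of the MPC trajectory from the optimal one. -/
theorem mpc_distance_le (hμ : 0 < μ) (hA : S.Assumptions μ ℓ d σ a b b' Lw Dw)
    (hS : S.PerturbationBounds d H lam) (h0 : 0 < lam) (h1 : lam < 1) (hH : 1 ≤ H) (hLg0 : 0 < Lg)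
    (hkd : d ≤ k) (hk : 4 * H ^ 3 * Lg * lam ^ k ≤ (1 - lam) ^ 2)
    (hξs : ∀ t ≤ S.T, ξs t ∈ S.Ξ t)
    (hξp : ∀ t s, t ≤ s → s ≤ min (t + k) S.T → ξp t s ∈ S.Ξ s)
    (hLg : ∀ t < S.T, ∀ x u u', ‖S.g t x u (ξs t) - S.g t x u' (ξs t)‖ ≤ Lg * ‖u - u'‖)
    {xs x : ℕ → E n} {us u : ℕ → E m} (hopt : S.IsOPT x₀ ξs xs us)
    (hmpc : S.IsMPC k x₀ ξs ξp x u) :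
    ∑ t ∈ Finset.range S.T, (‖x t - xs t‖ ^ 2 + ‖u t - us t‖ ^ 2) + ‖x S.T - xs S.T‖ ^ 2 ≤
      ((1 + 2 * H ^ 2) * (H * Lg / (1 - lam)) ^ 2 + 2) * (6 * H ^ 2 *
        ((∑ τ ∈ Finset.range k, lam ^ τ * S.predPower ξs ξp τ) / (1 - lam) +
          lam ^ (2 * k) * ∑ t ∈ Finset.range S.T, ‖xs t‖ ^ 2)) := by
  have hH0 : 0 ≤ H := by linarith
  have hl : 0 < 1 - lam := by linarith
  have htr : S.IsFTOCPTrajectory 0 S.T x₀ ξs x u := ⟨hmpc.1, fun t _ ht => (hmpc.2 t ht).2⟩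
  have hex : ∀ s, ∃ Y V, s ≤ S.T → S.IsFTOCPSolution s S.T (x s) ξs S.terminalCost Y V := by
    intro s
    by_cases hs : s ≤ S.T
    · obtain ⟨Y, V, h⟩ := exists_solution_terminal hμ (hA.costsOn le_rfl) hA.FT hs (x s) ξs
      exact ⟨Y, V, fun _ => h⟩
    · exact ⟨0, 0, fun h => absurd h hs⟩
  choose Y V hY using hex
  have hYx : ∀ s ≤ S.T, Y s s = x s := fun s hs => (isFTOCPSolution_terminal_iff.1 (hY s hs)).1.1
  set e : ℕ → ℝ := fun t => ‖u t - V t t‖ with he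
  set D : ℕ → ℝ := fun t => ‖x t - xs t‖ with hD
  have hDle : ∀ t ≤ S.T, D t ≤ H * Lg * discounted lam e t := by
    intro t ht
    have := reoptimized_sub_le hS hH0 h0 hξs hLg hopt htr hY le_rfl ht
    rwa [hYx t ht, Nat.sub_self, pow_zero, one_mul] at this
  have hrestart : ∀ t ≤ S.T, (∀ s, t ≤ s → s ≤ S.T → ‖Y t s - xs s‖ ≤ H * lam ^ (s - t) * D t) ∧
      (∀ s, t ≤ s → s < S.T → ‖V t s - us s‖ ≤ H * lam ^ (s - t) * D t) := fun t ht =>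
    hS.initial_terminal t ht _ _ ξs (fun s _ hs => hξs s hs.le) _ _ _ _ (hY t ht)
      (IsFTOCPSolution.tail hopt (Nat.zero_le t) ht)
  set χ : ℕ → ℝ := fun t => if t + k < S.T then ‖xs (t + k)‖ else 0 with hχ
  have herr : ∀ t < S.T, e t ≤ H * ∑ τ ∈ Finset.range k, lam ^ τ * S.cutError ξs ξp t τ +
      H * lam ^ k * χ t + H ^ 2 * lam ^ (2 * k) * (H * Lg * discounted lam e t) := by
    intro t ht
    obtain ⟨⟨y, v, hsol, huv⟩, -⟩ := hmpc.2 t ht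
    have e1 := mpc_error_le hS h0 hH0 hkd hξs hξp ht hsol (hY t ht.le)
    rw [← huv] at e1
    -- The state replaced by the target `0` is close to the optimal state at `t + k`, the gap being
    -- the current distance damped by `lam ^ k`; together with the prefactor `H * lam ^ k` this
    -- gives the feedback coefficient with `lam ^ (2 * k)`.
    have e2 : (if t + k < S.T then ‖Y t (t + k)‖ else 0) ≤
        χ t + H * lam ^ k * (H * Lg * discounted lam e t) := by
      have hdt := hDle t ht.le
      have hD0 : 0 ≤ D t := norm_nonneg _
      simp only [χ]
      split_ifs with htk
      · have e3 := (hrestart t ht.le).1 (t + k) (by omega) htk.le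
        rw [Nat.add_sub_cancel_left] at e3
        have e4 : ‖Y t (t + k)‖ ≤ ‖xs (t + k)‖ + ‖Y t (t + k) - xs (t + k)‖ := by
          have := norm_add_le (xs (t + k)) (Y t (t + k) - xs (t + k))
          rwa [add_sub_cancel] at this
        have e5 : H * lam ^ k * D t ≤ H * lam ^ k * (H * Lg * discounted lam e t) := by gcongr
        linarith
      · have : 0 ≤ H * Lg * discounted lam e t := hD0.trans hdt
        positivity
    have e6 := mul_le_mul_of_nonneg_left e2 (show 0 ≤ H * lam ^ k by positivity)
    calc e t ≤ _ := e1
      _ ≤ _ := add_le_add_right e6 _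
      _ = _ := by rw [pow_mul']; ring
  have hE := sum_error_sq_le h0 h1 hH hLg0 hk (fun t => norm_nonneg _) herr
  set Q := ∑ t ∈ Finset.range S.T, e t ^ 2 with hQ
  have hχsum : ∑ t ∈ Finset.range S.T, χ t ^ 2 ≤ ∑ t ∈ Finset.range S.T, ‖xs t‖ ^ 2 := by
    calc ∑ t ∈ Finset.range S.T, χ t ^ 2
        = ∑ t ∈ (Finset.range S.T).filter (fun t => t + k < S.T), ‖xs (t + k)‖ ^ 2 := by
          rw [Finset.sum_filter]
          exact Finset.sum_congr rfl fun t _ => by simp only [χ]; split_ifs <;> simp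
      _ = ∑ t ∈ ((Finset.range S.T).filter (fun t => t + k < S.T)).image (· + k), ‖xs t‖ ^ 2 :=
          (Finset.sum_image (f := fun t => ‖xs t‖ ^ 2)
            fun _ _ _ _ h => Nat.add_right_cancel h).symm
      _ ≤ _ := by
          refine Finset.sum_le_sum_of_subset_of_nonneg ?_ (fun _ _ _ => sq_nonneg _)
          intro t ht
          obtain ⟨s, hs, rfl⟩ := Finset.mem_image.1 ht
          exact Finset.mem_range.2 (Finset.mem_filter.1 hs).2
  have hDsum : ∑ t ∈ Finset.range (S.T + 1), D t ^ 2 ≤ (H * Lg / (1 - lam)) ^ 2 * Q := by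
    calc _ ≤ ∑ t ∈ Finset.range (S.T + 1), (H * Lg) ^ 2 * discounted lam e t ^ 2 := by
          refine Finset.sum_le_sum fun t ht => ?_
          rw [← mul_pow]
          exact pow_le_pow_left₀ (norm_nonneg _)
            (hDle t (by have := Finset.mem_range.1 ht; omega)) 2
      _ ≤ (H * Lg) ^ 2 * (Q / (1 - lam) ^ 2) := by
          rw [← Finset.mul_sum]
          exact mul_le_mul_of_nonneg_left (sum_discounted_sq_le h0 h1 e S.T) (by positivity)
      _ = _ := by rw [div_pow]; ring
  -- The action error splits at the re-optimized action: the per-step error plus the effect of the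
  -- current state distance.
  have hu : ∀ t ∈ Finset.range S.T, ‖x t - xs t‖ ^ 2 + ‖u t - us t‖ ^ 2 ≤
      (1 + 2 * H ^ 2) * D t ^ 2 + 2 * e t ^ 2 := by
    intro t ht
    have ht' := Finset.mem_range.1 ht
    have e1 := (hrestart t ht'.le).2 t le_rfl ht'
    rw [Nat.sub_self, pow_zero, mul_one] at e1
    have e2 : ‖u t - us t‖ ≤ e t + H * D t :=
      (norm_sub_le_norm_sub_add_norm_sub _ (V t t) _).trans (add_le_add_right e1 _)
    have e3 := pow_le_pow_left₀ (norm_nonneg _) e2 2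
    nlinarith [sq_nonneg (e t - H * D t)]
  have hfin : ∑ t ∈ Finset.range S.T, (‖x t - xs t‖ ^ 2 + ‖u t - us t‖ ^ 2) +
      ‖x S.T - xs S.T‖ ^ 2 ≤ ((1 + 2 * H ^ 2) * (H * Lg / (1 - lam)) ^ 2 + 2) * Q := by
    have e1 := Finset.sum_le_sum hu
    rw [Finset.sum_add_distrib (f := fun t => (1 + 2 * H ^ 2) * D t ^ 2), ← Finset.mul_sum,
      ← Finset.mul_sum] at e1
    rw [Finset.sum_range_succ] at hDsum
    have e2 := mul_le_mul_of_nonneg_left hDsum (show 0 ≤ 1 + 2 * H ^ 2 by positivity)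
    have e3 : 0 ≤ 2 * H ^ 2 * ‖x S.T - xs S.T‖ ^ 2 := by positivity
    have e4 : D S.T = ‖x S.T - xs S.T‖ := rfl
    rw [e4] at e2
    linarith
  refine hfin.trans (mul_le_mul_of_nonneg_left (hE.trans ?_) (by positivity))
  gcongr
  exact sum_cutError_sq_le h0

end Problem

/-! ### The lookahead against the controllability index. -/

lemma sigmaMin_zero_le {V W : Type*} [NormedAddCommGroup V] [InnerProductSpace ℝ V]
    [CompleteSpace V] [NormedAddCommGroup W] [InnerProductSpace ℝ W] [CompleteSpace W] :
    sigmaMin (0 : V →L[ℝ] W) ≤ 0 := by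
  by_cases h : ∃ y : W, ‖y‖ = 1
  · obtain ⟨y, hy⟩ := h
    exact csInf_le ⟨0, by rintro _ ⟨_, _, rfl⟩; exact norm_nonneg _⟩ ⟨y, hy, by simp⟩
  -- Without unit vectors the infimum is over the empty set and takes the default value `0`.
  · have : {s : ℝ | ∃ y : W, ‖y‖ = 1 ∧
        s = ‖ContinuousLinearMap.adjoint (0 : V →L[ℝ] W) y‖} = ∅ := by
      ext s
      simp only [Set.mem_ofPred_eq, Set.mem_empty_iff_false, iff_false]
      rintro ⟨y, hy, -⟩
      exact h ⟨y, hy⟩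
    rw [sigmaMin, this, Real.sInf_empty]

lemma mul_pow_le_of_log_le {H lam Lg : ℝ} {k : ℕ} (h0 : 0 < lam) (h1 : lam < 1) (hH : 1 ≤ H)
    (hLg : 0 < Lg)
    (h : Real.log (4 * H ^ 3 * Lg / (1 - lam) ^ 2) / Real.log (1 / lam) ≤ k) :
    4 * H ^ 3 * Lg * lam ^ k ≤ (1 - lam) ^ 2 := by
  have hl : 0 < 1 - lam := by linarith
  have hlog : 0 < Real.log (1 / lam) := Real.log_pos (by rw [lt_div_iff₀ h0]; linarith)
  rw [div_le_iff₀ hlog, ← Real.log_pow, Real.log_le_log_iff (by positivity) (by positivity),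
    div_le_iff₀ (by positivity), one_div, inv_pow, ← div_eq_inv_mul,
    le_div_iff₀ (by positivity)] at h
  exact h

/-- Norms in `B = B P B`. A bound on the pseudoinverse thus keeps a nonzero `B` away from zero,
which ties `L_g` to `b'`. -/
lemma IsMoorePenroseInverse.one_le_norm_mul {n m : ℕ} {B : E m →L[ℝ] E n} {P : E n →L[ℝ] E m}
    (h : IsMoorePenroseInverse B P) (hB : B ≠ 0) : 1 ≤ ‖B‖ * ‖P‖ := by
  have hB' : 0 < ‖B‖ := norm_pos_iff.2 hB
  have h1 : ‖B‖ ≤ ‖B‖ * (‖P‖ * ‖B‖) := by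
    conv_lhs => rw [← h.left]
    exact (ContinuousLinearMap.opNorm_comp_le _ _).trans
      (mul_le_mul_of_nonneg_left (ContinuousLinearMap.opNorm_comp_le _ _) (norm_nonneg _))
  have h2 : ‖B‖ * 1 ≤ ‖B‖ * (‖B‖ * ‖P‖) := by linarith
  exact le_of_mul_le_mul_left h2 hB'

namespace Problem

variable {n m : ℕ} {S : Problem n m} {μ ℓ : ℝ} {d : ℕ} {σ a b b' Lw Dw : ℝ}
  {ξs : ∀ t, E (S.r t)} {ξp : ℕ → ∀ s, E (S.r s)} {k : ℕ} {x₀ : E n} {H lam Lg : ℝ}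

/-- Controllability within the horizon needs an action that has an effect. -/
lemma exists_B_ne_zero (hS : S.Assumptions μ ℓ d σ a b b' Lw Dw) (hd : d ≤ S.T) :
    ∃ t < S.T, S.B t ≠ 0 := by
  by_contra! h
  have hM : controllabilityMatrix S.A S.B 0 d = 0 := by
    unfold controllabilityMatrix
    refine Finset.sum_eq_zero fun i _ => ?_
    rw [h (0 + i) (by omega)]
    simp
  have h1 := hS.controllable.1.1.2 0 (by omega)
  rw [hM] at h1
  exact absurd h1 (not_lt.2 sigmaMin_zero_le)

/-- If some action has an effect, the lookahead condition forces `d ≤ k`. -/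
lemma index_le_lookahead (hS : S.Assumptions μ ℓ d σ a b b' Lw Dw) (h0 : 0 < lam)
    (h1 : lam < 1) (hH : 1 ≤ H) (hHb : b' / lam ^ d ≤ H) (hLg0 : 0 < Lg)
    (hLg : ∀ t < S.T, ∀ x u u', ‖S.g t x u (ξs t) - S.g t x u' (ξs t)‖ ≤ Lg * ‖u - u'‖)
    (hk : 4 * H ^ 3 * Lg * lam ^ k ≤ (1 - lam) ^ 2) (hB : ∃ t < S.T, S.B t ≠ 0) : d ≤ k := by
  obtain ⟨t, ht, hBt⟩ := hB
  obtain ⟨P, hP, hPb⟩ := hS.norm_pinv t ht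
  have hBL : ‖S.B t‖ ≤ Lg := by
    refine ContinuousLinearMap.opNorm_le_bound _ hLg0.le fun u => ?_
    simpa [g] using hLg t ht 0 u 0
  have h2 : 1 ≤ Lg * b' := (hP.one_le_norm_mul hBt).trans (by gcongr)
  by_contra! hkd
  have h3 : lam ^ d ≤ lam ^ k := pow_le_pow_of_le_one h0.le h1.le hkd.le
  have hd0 : 0 < lam ^ d := pow_pos h0 d
  rw [div_le_iff₀ hd0] at hHb
  -- If `k < d`, then `b' ≤ H * lam ^ d ≤ H * lam ^ k`, and `1 ≤ Lg * b'` makes the left side of the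
  -- lookahead condition at least `4`, while its right side is at most `1`.
  have h4 : 1 ≤ Lg * (H * lam ^ k) :=
    h2.trans (mul_le_mul_of_nonneg_left (hHb.trans (by gcongr)) hLg0.le)
  have h5 : 1 ≤ H ^ 2 := one_le_pow₀ hH
  have h6 : 4 * H ^ 3 * Lg * lam ^ k = 4 * (H ^ 2 * (Lg * (H * lam ^ k))) := by ring
  have h7 : 1 ≤ H ^ 2 * (Lg * (H * lam ^ k)) := one_le_mul_of_one_le_of_one_le h5 h4
  have h8 : (1 - lam) ^ 2 ≤ 1 := pow_le_one₀ (by linarith) (by linarith)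
  linarith

lemma exists_isMPC (hμ : 0 < μ) (hS : S.Assumptions μ ℓ d σ a b b' Lw Dw) (hdk : d ≤ k)
    (x₀ : E n) (ξs : ∀ t, E (S.r t)) (ξp : ℕ → ∀ s, E (S.r s)) :
    ∃ x u, S.IsMPC k x₀ ξs ξp x u := by
  have hex : ∀ (t : ℕ) (z : E n), ∃ u : E m, t < S.T →
      ∃ y v, S.IsFTOCPSolution t (min (t + k) S.T) z (ξp t) (S.mpcTerminalCost k t) y v ∧
        u = v t := by
    intro t z
    by_cases ht : t < S.T
    · by_cases htk : t + k < S.T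
      · obtain ⟨y, v, h⟩ := exists_solution_indicator hμ hS (show t + d ≤ t + k by omega) htk.le
          z 0 (ξp t)
        refine ⟨v t, fun _ => ⟨y, v, ?_, rfl⟩⟩
        rwa [mpcTerminalCost, if_pos htk, show min (t + k) S.T = t + k by omega]
      · obtain ⟨y, v, h⟩ := exists_solution_terminal hμ (hS.costsOn le_rfl) hS.FT ht.le z (ξp t)
        refine ⟨v t, fun _ => ⟨y, v, ?_, rfl⟩⟩
        rwa [mpcTerminalCost, if_neg htk, show min (t + k) S.T = S.T by omega]
    · exact ⟨0, fun h => absurd h ht⟩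
  choose π hπ using hex
  let x : ℕ → E n := fun t => Nat.rec x₀ (fun t z => S.g t z (π t z) (ξs t)) t
  exact ⟨x, fun t => π t (x t), rfl, fun t ht => ⟨hπ t (x t) ht, rfl⟩⟩

/-- If no action has an effect, MPC is optimal. -/
lemma cost_eq_of_B_eq_zero (hμ : 0 < μ) (hS : S.Assumptions μ ℓ d σ a b b' Lw Dw) (hk : 1 ≤ k)
    (hB : ∀ t < S.T, S.B t = 0) {xs x : ℕ → E n} {us u : ℕ → E m} (hopt : S.IsOPT x₀ ξs xs us)
    (hmpc : S.IsMPC k x₀ ξs ξp x u) : S.cost x u = S.cost xs us := by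
  have hus : ∀ t < S.T, us t = 0 := fun t ht =>
    IsFTOCPSolution.action_eq_zero_terminal hμ (hS.costsOn le_rfl) hopt (Nat.zero_le t) ht (hB t ht)
  have hu : ∀ t < S.T, u t = 0 := by
    intro t ht
    obtain ⟨⟨y, v, h, huv⟩, -⟩ := hmpc.2 t ht
    have h2 : t < min (t + k) S.T := by omega
    have hc : S.CostsOn μ ℓ t (min (t + k) S.T) := hS.costsOn (min_le_right _ _)
    rw [huv]
    unfold mpcTerminalCost at h
    split_ifs at h
    · exact h.action_eq_zero_indicator hμ hc le_rfl h2 (hB t ht)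
    · exact h.action_eq_zero_terminal hμ hc le_rfl h2 (hB t ht)
  have htr := (isFTOCPSolution_terminal_iff.1 hopt).1
  have hx : ∀ t ≤ S.T, x t = xs t := by
    intro t
    induction t with
    | zero => intro _; rw [hmpc.1, htr.1]
    | succ t ih =>
      intro ht
      rw [(hmpc.2 t ht).2, htr.2 t (Nat.zero_le t) ht, ih (by omega), hu t ht, hus t ht]
  rw [cost, cost, hx _ le_rfl]
  congr 1
  refine Finset.sum_congr rfl fun t ht => ?_
  have ht' := Finset.mem_range.1 ht
  rw [hx t ht'.le, hu t ht', hus t ht']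

end Problem

/-- The constant of the regret bound. -/
def regretConstant (ℓ G H lam Lg Dw D₀ : ℝ) : ℝ :=
  ℓ * (((1 + 2 * H ^ 2) * (H * Lg / (1 - lam)) ^ 2 + 2) * (6 * H ^ 2 *
    (1 / (1 - lam) + G * (D₀ ^ 2 + Dw ^ 2))))

/-! ### Assembly of the regret bound. -/

namespace Problem

variable {n m : ℕ} {S : Problem n m} {μ ℓ : ℝ} {d : ℕ} {σ a b b' Lw Dw : ℝ}
  {ξs : ∀ t, E (S.r t)} {ξp : ℕ → ∀ s, E (S.r s)} {k : ℕ} {x₀ : E n} {H lam Lg D₀ : ℝ}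

theorem regret_le (hμ : 0 < μ) (hℓ : 0 < ℓ) (hσ : 0 < σ) (ha : 0 < a) (hb : 0 < b)
    (hA : S.Assumptions μ ℓ d σ a b b' Lw Dw)
    (hS : S.PerturbationBounds d H lam) (h0 : 0 < lam) (h1 : lam < 1) (hH : 1 ≤ H) (hLg0 : 0 < Lg)
    (hkd : d ≤ k) (hk : 4 * H ^ 3 * Lg * lam ^ k ≤ (1 - lam) ^ 2) (hx₀ : ‖x₀‖ ≤ D₀)
    (hξs : ∀ t ≤ S.T, ξs t ∈ S.Ξ t)
    (hξp : ∀ t s, t ≤ s → s ≤ min (t + k) S.T → ξp t s ∈ S.Ξ s)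
    (hLg : ∀ t < S.T, ∀ x u u', ‖S.g t x u (ξs t) - S.g t x u' (ξs t)‖ ≤ Lg * ‖u - u'‖)
    {xs x : ℕ → E n} {us u : ℕ → E m} (hopt : S.IsOPT x₀ ξs xs us)
    (hmpc : S.IsMPC k x₀ ξs ξp x u) :
    S.cost x u - S.cost xs us ≤
      regretConstant ℓ (energyGain μ d (costateGain ℓ d σ a b)) H lam Lg Dw D₀ *
        (Real.sqrt (S.T * ∑ τ ∈ Finset.range k, lam ^ τ * S.predPower ξs ξp τ +
          lam ^ (2 * k) * (S.T : ℝ) ^ 2) +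
          ∑ τ ∈ Finset.range k, lam ^ τ * S.predPower ξs ξp τ) := by
  have hl : 0 < 1 - lam := by linarith
  set G := energyGain μ d (costateGain ℓ d σ a b)
  have hG : 0 ≤ G := energyGain_nonneg costateGain_nonneg
  set Pw := ∑ τ ∈ Finset.range k, lam ^ τ * S.predPower ξs ξp τ
  have hPw : 0 ≤ Pw := Finset.sum_nonneg fun τ _ =>
    mul_nonneg (by positivity) (predPower_nonneg τ)
  set R := Real.sqrt (S.T * Pw + lam ^ (2 * k) * (S.T : ℝ) ^ 2)
  have hR0 : 0 ≤ R := Real.sqrt_nonneg _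
  have hreg := (cost_sub_cost_le hμ hA hopt ⟨hmpc.1, fun t _ ht => (hmpc.2 t ht).2⟩).trans
    (mul_le_mul_of_nonneg_left
      (mpc_distance_le hμ hA hS h0 h1 hH hLg0 hkd hk hξs hξp hLg hopt hmpc) hℓ.le)
  have hX : ∑ t ∈ Finset.range S.T, ‖xs t‖ ^ 2 ≤ G * (D₀ ^ 2 + Dw ^ 2) * S.T := by
    -- The initial-state term is absorbed into a multiple of `T`, which requires `T ≥ 1`; for `T =
    -- 0` the sum is empty.
    rcases Nat.eq_zero_or_pos S.T with hT | hT
    · simp [hT]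
    · have hT1 : (1 : ℝ) ≤ S.T := by exact_mod_cast hT
      have hD : ‖x₀‖ ^ 2 ≤ D₀ ^ 2 * S.T :=
        (pow_le_pow_left₀ (norm_nonneg _) hx₀ 2).trans
          (le_mul_of_one_le_right (sq_nonneg _) hT1)
      refine (sum_sq_opt_le hμ hℓ hσ ha hb hA (fun t ht => hξs t ht.le) hopt).trans ?_
      rw [mul_assoc]
      refine mul_le_mul_of_nonneg_left ?_ hG
      linarith
  -- Here half of the decay is given away: `lam ^ k * T` is the square root of the second term under
  -- the root.
  have hTR : lam ^ (2 * k) * (S.T : ℝ) ≤ R := by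
    have e1 : lam ^ (2 * k) * (S.T : ℝ) ≤ lam ^ k * S.T := by
      exact mul_le_mul_of_nonneg_right (pow_le_pow_of_le_one h0.le h1.le (by omega))
        (by positivity)
    refine e1.trans (Real.le_sqrt_of_sq_le ?_)
    have e2 : (lam ^ k * (S.T : ℝ)) ^ 2 = lam ^ (2 * k) * (S.T : ℝ) ^ 2 := by
      rw [mul_pow, pow_mul']
    rw [e2]
    have : 0 ≤ (S.T : ℝ) * Pw := by positivity
    linarith
  have hin : Pw / (1 - lam) + lam ^ (2 * k) * ∑ t ∈ Finset.range S.T, ‖xs t‖ ^ 2 ≤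
      (1 / (1 - lam) + G * (D₀ ^ 2 + Dw ^ 2)) * (R + Pw) := by
    have e1 : lam ^ (2 * k) * ∑ t ∈ Finset.range S.T, ‖xs t‖ ^ 2 ≤
        G * (D₀ ^ 2 + Dw ^ 2) * R := by
      calc _ ≤ lam ^ (2 * k) * (G * (D₀ ^ 2 + Dw ^ 2) * S.T) := by gcongr
        _ = G * (D₀ ^ 2 + Dw ^ 2) * (lam ^ (2 * k) * S.T) := by ring
        _ ≤ _ := by gcongr
    have e2 : 0 ≤ 1 / (1 - lam) * R := by positivity
    have e3 : 0 ≤ G * (D₀ ^ 2 + Dw ^ 2) * Pw := by positivity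
    have e4 : Pw / (1 - lam) = 1 / (1 - lam) * Pw := by ring
    rw [e4]
    linarith
  refine hreg.trans ?_
  calc _ ≤ ℓ * (((1 + 2 * H ^ 2) * (H * Lg / (1 - lam)) ^ 2 + 2) * (6 * H ^ 2 *
        ((1 / (1 - lam) + G * (D₀ ^ 2 + Dw ^ 2)) * (R + Pw)))) := by gcongr
    _ = _ := by rw [regretConstant]; ring

end Problem

end MPCRegret

end

open MPCRegret in
theorem theorem4p1 (μ ℓ : ℝ) (d : ℕ) (σ a b b' Lw : ℝ) (hμ : 0 < μ) (hℓ : 0 < ℓ) (hσ : 0 < σ)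
    (ha : 0 < a) (hb : 0 < b) (hb' : 0 < b') (hLw : 0 ≤ Lw) :
    -- `H₁` and `lam₁` depend only on `μ, ℓ, d, σ, a, b, b', Lw`
    ∃ H₁ lam₁ : ℝ, 1 ≤ H₁ ∧ 0 < lam₁ ∧ lam₁ < 1 ∧
      -- they are constants of the exponentially decaying perturbation bounds
      (∀ (n m : ℕ) (S : Problem n m) (Dw : ℝ), S.Assumptions μ ℓ d σ a b b' Lw Dw →
        S.PerturbationBounds d H₁ lam₁) ∧
      -- the regret bound; its constant does not depend on `n, m`, the problem (including `T`), `k`,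
      -- the initial state, the true parameters or the predictions
      ∀ Dw D₀ Lg : ℝ, 0 < Lg → ∃ C : ℝ, 0 ≤ C ∧
        ∀ (n m : ℕ) (S : Problem n m), S.Assumptions μ ℓ d σ a b b' Lw Dw →
        ∀ (x₀ : E n) (ξs : ∀ t, E (S.r t)) (ξp : ℕ → ∀ s, E (S.r s)) (k : ℕ),
          ‖x₀‖ ≤ D₀ →
          (∀ t ≤ S.T, ξs t ∈ S.Ξ t) →
          (∀ t s, t ≤ s → s ≤ min (t + k) S.T → ξp t s ∈ S.Ξ s) →
          (∀ t < S.T, ∀ x u u',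
            ‖S.g t x u (ξs t) - S.g t x u' (ξs t)‖ ≤ Lg * ‖u - u'‖) →
          1 ≤ k →
          Real.log (4 * H₁ ^ 3 * Lg / (1 - lam₁) ^ 2) / Real.log (1 / lam₁) ≤ k →
          (∃ xs us, S.IsOPT x₀ ξs xs us) ∧
          (d ≤ S.T → ∃ x u, S.IsMPC k x₀ ξs ξp x u) ∧
          ∀ xs us x u, S.IsOPT x₀ ξs xs us → S.IsMPC k x₀ ξs ξp x u →
            S.cost x u - S.cost xs us ≤
              C * (Real.sqrt (S.T * ∑ τ ∈ Finset.range k, lam₁ ^ τ * S.predPower ξs ξp τ +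
                    lam₁ ^ (2 * k) * (S.T : ℝ) ^ 2) +
                ∑ τ ∈ Finset.range k, lam₁ ^ τ * S.predPower ξs ξp τ) := by
  have hK : 0 ≤ costateGain ℓ d σ a b := costateGain_nonneg
  set G := energyGain μ d (costateGain ℓ d σ a b) with hGdef
  have hG : 0 ≤ G := energyGain_nonneg hK
  set lam := decayRate μ d (costateGain ℓ d σ a b)
  have h0 : 0 < lam := decayRate_pos hμ hK
  have h1 : lam < 1 := decayRate_lt_one hμ hK
  have hl : 0 < 1 - lam := by linarith
  have hs1 : 0 ≤ Real.sqrt G * (1 + Lw) := by positivity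
  have hs2 : 0 ≤ b' / lam ^ d := by positivity
  -- The summand `1` gives `H ≥ 1`, the second serves the perturbation bounds, and `b' / lam ^ d`
  -- makes the lookahead condition force `d ≤ k`.
  set H := 1 + Real.sqrt G * (1 + Lw) + b' / lam ^ d with hHdef
  have hH : 1 ≤ H := by linarith
  have hpert : ∀ (n m : ℕ) (S : Problem n m) (Dw : ℝ), S.Assumptions μ ℓ d σ a b b' Lw Dw →
      S.PerturbationBounds d H lam := fun n m S Dw hS =>
    Problem.perturbationBounds hμ hℓ hσ ha hb hLw hS (by linarith)
  refine ⟨H, lam, hH, h0, h1, hpert, fun Dw D₀ Lg hLg0 =>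
    ⟨regretConstant ℓ G H lam Lg Dw D₀, by unfold regretConstant; positivity, ?_⟩⟩
  intro n m S hS x₀ ξs ξp k hx₀ hξs hξp hLg hk1 hk
  have hk' := mul_pow_le_of_log_le h0 h1 hH hLg0 hk
  have hdk : (∃ t < S.T, S.B t ≠ 0) → d ≤ k :=
    Problem.index_le_lookahead hS h0 h1 hH (by linarith) hLg0 hLg hk'
  refine ⟨Problem.exists_solution_terminal hμ (hS.costsOn le_rfl) hS.FT (Nat.zero_le _) x₀ ξs,
    fun hd => Problem.exists_isMPC hμ hS (hdk (Problem.exists_B_ne_zero hS hd)) x₀ ξs ξp, ?_⟩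
  intro xs us x u hopt hmpc
  -- Only a nonzero `B_t` forces `d ≤ k`. Otherwise the regret is zero, and the claim reduces to
  -- nonnegativity of the bound.
  by_cases hB : ∃ t < S.T, S.B t ≠ 0
  · exact Problem.regret_le hμ hℓ hσ ha hb hS (hpert n m S Dw hS) h0 h1 hH hLg0 (hdk hB) hk' hx₀
      hξs hξp hLg hopt hmpc
  · push Not at hB
    rw [Problem.cost_eq_of_B_eq_zero hμ hS hk1 hB hopt hmpc, sub_self]
    have hP : 0 ≤ ∑ τ ∈ Finset.range k, lam ^ τ * S.predPower ξs ξp τ :=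
      Finset.sum_nonneg fun τ _ => mul_nonneg (by positivity) (Problem.predPower_nonneg τ)
    have hC : 0 ≤ regretConstant ℓ G H lam Lg Dw D₀ := by unfold regretConstant; positivity
    positivity
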